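/- A digraph is \emph{1-out-regular} if each of its vertices has out-degree exactly $1$. In the problem \textsc{1-Out-Regular Vertex Deletion} the input is a finite digraph $D$ without loops and parallel arcs, together with an integer $k \ge 0$, and the question is whether there is a set $X \subseteq V(D)$ with $|X| \le k$ such that every nontrivial strong component of $D - X$ (that is, every strong component with at least two vertices) induces a 1-out-regular digraph. Theorem. \textsc{1-Out-Regular Vertex Deletion} can be solved in time $2^{O(k \log k)} \cdot n^{O(1)}$, where $n = |V(D)|$. That is, there are a single algorithm (a program of a unit-cost random access machine with addition and subtraction of natural numbers, which receives $n$, $k$ and the adjacency matrix of $D$), a function $f$ with $f(k) = O(k \log k)$ as $k \to \infty$, and a constant $c$, such that on every input $(D,k)$ the algorithm halts after at most $2^{f(k)} \cdot \max(n,1)^{c}$ steps with the correct yes/no answer. -/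

import Mathlib

open Filter Asymptotics

namespace Digraph

/-- The subdigraph `D[S]` induced by a set `S` of vertices. -/
def induced {V : Type*} (D : Digraph V) (S : Set V) : Digraph S :=
  ⟨fun u v => D.Adj u v⟩

/-- There is a directed path (possibly of length zero) from `u` to `v`. -/
def HasPath {V : Type*} (D : Digraph V) (u v : V) : Prop :=
  Relation.ReflTransGen D.Adj u v

/-- A strong component: a maximal set of vertices any two of which are joined by directed paths
in both directions. -/
def IsStrongComponent {V : Type*} (D : Digraph V) (S : Set V) : Prop :=
  Maximal (fun T : Set V => ∀ u ∈ T, ∀ v ∈ T, D.HasPath u v) S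

/-- Every vertex has out-degree exactly one. -/
def IsOneOutRegular {V : Type*} (D : Digraph V) : Prop :=
  ∀ v, ∃! w, D.Adj v w

/-- The digraph `D - X`, on the vertices outside `X`. -/
def deleteVertices {V : Type*} (D : Digraph V) (X : Set V) : Digraph (Xᶜ : Set V) :=
  D.induced Xᶜ

/-- Every nontrivial strong component (one with at least two vertices) of `D - X` induces a
`1`-out-regular digraph. -/
def IsOneOutRegularDeletionSet {V : Type*} (D : Digraph V) (X : Set V) : Prop :=
  ∀ S, (D.deleteVertices X).IsStrongComponent S → S.Nontrivial →
    ((D.deleteVertices X).induced S).IsOneOutRegular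

/-- `(D, k)` is a yes-instance of `1`-Out-Regular Vertex Deletion. -/
def OneOutRegularVertexDeletion {V : Type*} (D : Digraph V) (k : ℕ) : Prop :=
  ∃ X : Finset V, X.card ≤ k ∧ D.IsOneOutRegularDeletionSet (X : Set V)

end Digraph

/-! ### Random access machines

Programs of a random access machine with unit cost, whose arithmetic is addition and truncated
subtraction of natural numbers (no multiplication). A program is a finite object, so it mentions
only finitely many registers and arrays. -/

namespace RAM

/-- Memory contents: registers `reg x`, and arrays `arr a` with cells `arr a i`. -/
structure State where
  reg : ℕ → ℕ
  arr : ℕ → ℕ → ℕ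

/-- Store `m` in register `x`. -/
def State.setReg (s : State) (x m : ℕ) : State :=
  { s with reg := Function.update s.reg x m }

/-- Store `m` in cell `i` of array `a`. -/
def State.setArr (s : State) (a i m : ℕ) : State :=
  { s with arr := Function.update s.arr a (Function.update (s.arr a) i m) }

/-- Expressions: constants, registers, array cells with a computed index, sum, truncated
difference. -/
inductive Expr where
  | const (m : ℕ)
  | reg (x : ℕ)
  | read (a : ℕ) (i : Expr)
  | add (e₁ e₂ : Expr)
  | sub (e₁ e₂ : Expr)

/-- The value of an expression. -/
def Expr.eval (s : State) : Expr → ℕ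
  | .const m => m
  | .reg x => s.reg x
  | .read a i => s.arr a (i.eval s)
  | .add e₁ e₂ => e₁.eval s + e₂.eval s
  | .sub e₁ e₂ => e₁.eval s - e₂.eval s

/-- The number of elementary operations that evaluate an expression. -/
def Expr.cost : Expr → ℕ
  | .const _ => 1
  | .reg _ => 1
  | .read _ i => i.cost + 1
  | .add e₁ e₂ => e₁.cost + e₂.cost + 1
  | .sub e₁ e₂ => e₁.cost + e₂.cost + 1

/-- Programs. The guard of a conditional or of a loop holds when its value is not zero. -/
inductive Program where
  | skip
  | assign (x : ℕ) (e : Expr)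
  | write (a : ℕ) (i e : Expr)
  | seq (P Q : Program)
  | ite (b : Expr) (P Q : Program)
  | loop (b : Expr) (P : Program)

/-- `Runs P s t s'`: started in `s`, the program `P` halts in `s'` after `t` steps. -/
inductive Runs : Program → State → ℕ → State → Prop
  | skip (s : State) : Runs .skip s 1 s
  | assign (x : ℕ) (e : Expr) (s : State) :
      Runs (.assign x e) s (e.cost + 1) (s.setReg x (e.eval s))
  | write (a : ℕ) (i e : Expr) (s : State) :
      Runs (.write a i e) s (i.cost + e.cost + 1) (s.setArr a (i.eval s) (e.eval s))
  | seq {P Q : Program} {s s₁ s₂ : State} {t₁ t₂ : ℕ} :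
      Runs P s t₁ s₁ → Runs Q s₁ t₂ s₂ → Runs (.seq P Q) s (t₁ + t₂) s₂
  | ite_true {b : Expr} {P Q : Program} {s s₁ : State} {t : ℕ} :
      b.eval s ≠ 0 → Runs P s t s₁ → Runs (.ite b P Q) s (b.cost + 1 + t) s₁
  | ite_false {b : Expr} {P Q : Program} {s s₁ : State} {t : ℕ} :
      b.eval s = 0 → Runs Q s t s₁ → Runs (.ite b P Q) s (b.cost + 1 + t) s₁
  | loop_exit {b : Expr} {P : Program} {s : State} :
      b.eval s = 0 → Runs (.loop b P) s (b.cost + 1) s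
  | loop_step {b : Expr} {P : Program} {s s₁ s₂ : State} {t₁ t₂ : ℕ} :
      b.eval s ≠ 0 → Runs P s t₁ s₁ → Runs (.loop b P) s₁ t₂ s₂ →
      Runs (.loop b P) s (b.cost + 1 + t₁ + t₂) s₂

open Classical in
/-- The initial memory for an instance `(D, k)` with vertices `0, …, n - 1`: register `0` holds
`n`, register `1` holds `k`, array `0` holds the adjacency matrix of `D` row by row, and the rest
of the memory is zero. -/
noncomputable def inputState {n : ℕ} (D : Digraph (Fin n)) (k : ℕ) : State where
  reg := fun x => if x = 0 then n else if x = 1 then k else 0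
  arr := fun a p =>
    if a = 0 ∧ ∃ i j : Fin n, D.Adj i j ∧ p = (i : ℕ) * n + (j : ℕ) then 1 else 0

end RAM

/-! ### A language of bounded loops, compiled to the machine with polynomial time bounds. -/

namespace RAM

/-! A nontrivial strong component is 1-out-regular exactly when none of its vertices has two
successors inside it (`isOneOutRegularDeletionSet_iff`). The algorithm is iterative compression:
vertices are released one at a time, those not yet released count as deleted, and a solution W of
size at most k + 1 has to be turned into one of size at most k.

Let Y be a solution of size at most k. Guess which vertices of W lie in Y (level 0), and give the
others levels in 1, ..., k + 1 that never descend along paths of D - Y and coincide only within a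
strong component (`exists_numbering`, `exists_levels`). The kept vertices of W are the terminals.
Let C be the set of vertices that reach a terminal in D - Y. Once the vertices of level 0 are
deleted, the boundary of C, that is the set of vertices outside C with an arc into C, is contained
in Y \ W.

The search looks for such a C by collecting a set A of vertices declared to lie outside it. By
submodularity, among the sets that contain the terminals, avoid A and have minimum boundary there is
a smallest one, B, and C can be shrunk into B at no cost, so that each of its vertices reaches a
terminal inside C (`exists_good_subset`). A nonterminal vertex of C with only one successor in B
therefore has a forced continuation. Follow the forced paths from the highest unfinished level q. If
one meets a terminal of lower level, its first vertex is outside C. If one meets a vertex with two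
successors in B, then one of these successors or the first vertex of the path is outside C. If
neither happens, take a boundary vertex y of B with a successor x in B: either x is outside C, or y
has to be deleted. If there is no such y, then B is closed under predecessors and level q is
finished.

Let kk be the remaining budget and λ the minimum size of a boundary. Each step lowers 2 kk + q - λ:
declaring a vertex of B to be outside C raises λ, because every minimum separator contains B; a
deletion lowers kk by one and λ by at most one; a level is finished only when λ = 0. So there are at
most 3k + 1 steps, each with at most three branches (`Config.Inv.exists_step`,
`Config.Inv.exists_run`). In the end components with a terminal are in order, and the others avoid W
altogether, so the deleted set is a solution (`Config.Inv.sol`).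

The set B is found by augmenting paths in the network with split vertices, where it appears as the
set of nodes that reach a terminal in the residual network (`isFar_of_residual`, `farCommand_spec`).
Levels and branches are digits in base k + 4 of a number below (k + 4)^(4k + 2), and all these
numbers are tried. Each outcome is verified, so wrong guesses do no harm, and the simulation has to
be faithful for a single number only (`exists_guess`, `Compression.next`). The program uses only
loops bounded by fixed parameters, one of which is the number of guesses, so its time is polynomial
in the largest parameter. This already has the form 2^O(k log k) times a power of n
(`exists_runs_solver`, `isBigO_logb`). -/

/-- Expressions with conditionals and bounded sums. In `sum x b e` the register `x` is the summation
variable and the value of register `b` is the (exclusive) upper bound. -/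
inductive Term where
  | const (m : ℕ)
  | reg (x : ℕ)
  | read (a : ℕ) (i : Term)
  | add (e₁ e₂ : Term)
  | sub (e₁ e₂ : Term)
  | ite (c e₁ e₂ : Term)
  | sum (x b : ℕ) (e : Term)

/-- The value of a term. -/
def Term.eval : Term → State → ℕ
  | .const m, _ => m
  | .reg x, s => s.reg x
  | .read a i, s => s.arr a (i.eval s)
  | .add e₁ e₂, s => e₁.eval s + e₂.eval s
  | .sub e₁ e₂, s => e₁.eval s - e₂.eval s
  | .ite c e₁ e₂, s => if c.eval s = 0 then e₂.eval s else e₁.eval s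
  | .sum x b e, s => ∑ i ∈ Finset.range (s.reg b), e.eval (s.setReg x i)

/-- Registers below `p` are parameters, which bound the sums; registers from `60` on are reserved
for the evaluation of terms. -/
def Term.wf (p : ℕ) : Term → Bool
  | .const _ => true
  | .reg x => decide (x < 60)
  | .read _ i => i.wf p
  | .add e₁ e₂ => e₁.wf p && e₂.wf p
  | .sub e₁ e₂ => e₁.wf p && e₂.wf p
  | .ite c e₁ e₂ => c.wf p && e₁.wf p && e₂.wf p
  | .sum x b e => decide (b < p) && decide (p ≤ x) && decide (x < 60) && e.wf p

/-- A program that stores the value of a term in register `d`, using the registers above `d` as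
scratch memory. -/
def Term.compile : Term → ℕ → Program
  | .const m, d => .assign d (.const m)
  | .reg x, d => .assign d (.reg x)
  | .read a i, d => .seq (i.compile d) (.assign d (.read a (.reg d)))
  | .add e₁ e₂, d => .seq (e₁.compile d) (.seq (e₂.compile (d + 1))
      (.assign d (.add (.reg d) (.reg (d + 1)))))
  | .sub e₁ e₂, d => .seq (e₁.compile d) (.seq (e₂.compile (d + 1))
      (.assign d (.sub (.reg d) (.reg (d + 1)))))
  | .ite c e₁ e₂, d => .seq (c.compile d) (.ite (.reg d) (e₁.compile d) (e₂.compile d))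
  | .sum x b e, d => .seq (.assign d (.const 0)) (.seq (.assign (d + 1) (.reg x))
      (.seq (.assign x (.const 0)) (.seq (.loop (.sub (.reg b) (.reg x))
        (.seq (e.compile (d + 2)) (.seq (.assign d (.add (.reg d) (.reg (d + 2))))
          (.assign x (.add (.reg x) (.const 1)))))) (.assign x (.reg (d + 1))))))

/-- A bound on the time needed to evaluate a term, as a function of the parameters. -/
def Term.time (ρ : ℕ → ℕ) : Term → ℕ
  | .const _ => 2
  | .reg _ => 2
  | .read _ i => i.time ρ + 3
  | .add e₁ e₂ => e₁.time ρ + e₂.time ρ + 4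
  | .sub e₁ e₂ => e₁.time ρ + e₂.time ρ + 4
  | .ite c e₁ e₂ => c.time ρ + e₁.time ρ + e₂.time ρ + 2
  | .sum _ b e => ρ b * (e.time ρ + 12) + 12

@[simp] theorem State.setReg_reg (s : State) (x m y : ℕ) :
    (s.setReg x m).reg y = if y = x then m else s.reg y := by
  simp [State.setReg, Function.update_apply]

@[simp] theorem State.setReg_arr (s : State) (x m : ℕ) : (s.setReg x m).arr = s.arr := rfl

@[simp] theorem State.setArr_reg (s : State) (a i m : ℕ) : (s.setArr a i m).reg = s.reg := rfl

@[simp] theorem State.setArr_arr (s : State) (a i m b : ℕ) :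
    (s.setArr a i m).arr b = if b = a then Function.update (s.arr a) i m else s.arr b := by
  by_cases h : b = a
  · subst h; simp [State.setArr]
  · simp [State.setArr, h]

/-- Two states that differ only in scratch registers. -/
def State.Agree (s s' : State) : Prop := (∀ y < 60, s'.reg y = s.reg y) ∧ s'.arr = s.arr

theorem State.Agree.refl (s : State) : s.Agree s := ⟨fun _ _ => rfl, rfl⟩

theorem State.Agree.setReg {s s' : State} (h : s.Agree s') (x m : ℕ) :
    (s.setReg x m).Agree (s'.setReg x m) := by
  refine ⟨fun y hy => ?_, h.2⟩
  by_cases hyx : y = x <;> simp [hyx, h.1 y hy]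

/-- Well-formed terms mention no register from 60 on, so whatever earlier evaluations left in
scratch memory cannot influence them. -/
theorem Term.eval_agree {p : ℕ} (e : Term) : e.wf p → ∀ {s s' : State}, s.Agree s' →
    e.eval s' = e.eval s := by
  induction e with
  | const m => intro _ s s' _; rfl
  | reg x => intro h s s' ha; exact ha.1 x (by simpa [Term.wf] using h)
  | read a i ih => intro h s s' ha; simp only [Term.eval, ih h ha, ha.2]
  | add e₁ e₂ h₁ h₂ =>
    intro h s s' ha
    simp only [Term.wf, Bool.and_eq_true] at h
    simp only [Term.eval, h₁ h.1 ha, h₂ h.2 ha]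
  | sub e₁ e₂ h₁ h₂ =>
    intro h s s' ha
    simp only [Term.wf, Bool.and_eq_true] at h
    simp only [Term.eval, h₁ h.1 ha, h₂ h.2 ha]
  | ite c e₁ e₂ hc h₁ h₂ =>
    intro h s s' ha
    simp only [Term.wf, Bool.and_eq_true] at h
    simp only [Term.eval, hc h.1.1 ha, h₁ h.1.2 ha, h₂ h.2 ha]
  | sum x b e ih =>
    intro h s s' ha
    simp only [Term.wf, Bool.and_eq_true, decide_eq_true_eq] at h
    simp only [Term.eval, ha.1 b (by omega)]
    exact Finset.sum_congr rfl fun i _ => ih h.2 (ha.setReg x i)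

/-- The loop rule for counting loops. -/
theorem exists_runs_loop {x b m T : ℕ} {P : Program} (I : ℕ → State → Prop)
    (hI : ∀ i s, I i s → s.reg x = i ∧ s.reg b = m)
    (hstep : ∀ i < m, ∀ s, I i s → ∃ t s', Runs P s t s' ∧ t ≤ T ∧ I (i + 1) s')
    {s : State} (h0 : I 0 s) :
    ∃ t s', Runs (.loop (.sub (.reg b) (.reg x)) P) s t s' ∧ t ≤ m * (T + 4) + 4 ∧ I m s' := by
  have key : ∀ j i s, i + j = m → I i s →
      ∃ t s', Runs (.loop (.sub (.reg b) (.reg x)) P) s t s' ∧ t ≤ j * (T + 4) + 4 ∧ I m s' := by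
    intro j
    induction j with
    | zero =>
      intro i s hij hi
      obtain ⟨h₁, h₂⟩ := hI i s hi
      refine ⟨_, s, Runs.loop_exit (by simp only [Expr.eval]; omega), by simp [Expr.cost], ?_⟩
      rwa [← show i = m by omega]
    | succ j ih =>
      intro i s hij hi
      obtain ⟨h₁, h₂⟩ := hI i s hi
      obtain ⟨t₁, s₁, hr₁, ht₁, hi₁⟩ := hstep i (by omega) s hi
      obtain ⟨t₂, s₂, hr₂, ht₂, hi₂⟩ := ih (i + 1) s₁ (by omega) hi₁
      refine ⟨_, s₂, Runs.loop_step (by simp only [Expr.eval]; omega) hr₁ hr₂, ?_, hi₂⟩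
      simp only [Expr.cost]
      rw [Nat.succ_mul]
      omega
  exact key m 0 s (by omega) h0

/-- Scratch memory is a stack with `d` as its top: a partial result waits in `d` while the next
operand is evaluated from `d + 1` on, and the frame condition on the registers below the current top
protects it. A sum needs two cells, one for the accumulator and one for the old value of the
summation variable, which is restored at the end. -/
theorem Term.exists_runs {p : ℕ} {ρ : ℕ → ℕ} (hp : p ≤ 60) (e : Term) : e.wf p →
    ∀ (d : ℕ) (s : State), 60 ≤ d → (∀ b < p, s.reg b = ρ b) →
    ∃ t s', Runs (e.compile d) s t s' ∧ t ≤ e.time ρ ∧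
      s'.reg d = e.eval s ∧ (∀ y < d, s'.reg y = s.reg y) ∧ s'.arr = s.arr := by
  induction e with
  | const m =>
    intro _ d s _ _
    refine ⟨_, _, Runs.assign _ _ _, by simp [Expr.cost, Term.time], by simp [Expr.eval, Term.eval],
      fun y hy => ?_, rfl⟩
    simp [hy.ne]
  | reg x =>
    intro _ d s _ _
    refine ⟨_, _, Runs.assign _ _ _, by simp [Expr.cost, Term.time], by simp [Expr.eval, Term.eval],
      fun y hy => ?_, rfl⟩
    simp [hy.ne]
  | read a i ih =>
    intro h d s hd hρ
    obtain ⟨t, s', hr, ht, hv, hf, ha⟩ := ih h d s hd hρ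
    refine ⟨_, _, hr.seq (Runs.assign _ _ _), by simp [Expr.cost, Term.time]; omega,
      by simp [Expr.eval, Term.eval, hv, ha], fun y hy => ?_, by simp [ha]⟩
    simp [hy.ne, hf y hy]
  | add e₁ e₂ h₁ h₂ =>
    intro h d s hd hρ
    simp only [Term.wf, Bool.and_eq_true] at h
    obtain ⟨t₁, s₁, hr₁, ht₁, hv₁, hf₁, ha₁⟩ := h₁ h.1 d s hd hρ
    obtain ⟨t₂, s₂, hr₂, ht₂, hv₂, hf₂, ha₂⟩ := h₂ h.2 (d + 1) s₁ (by omega)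
      (fun b hb => by rw [hf₁ b (by omega), hρ b hb])
    refine ⟨_, _, hr₁.seq (hr₂.seq (Runs.assign _ _ _)), by simp [Expr.cost, Term.time]; omega,
      ?_, fun y hy => ?_, by simp [ha₁, ha₂]⟩
    · have : e₂.eval s₁ = e₂.eval s := e₂.eval_agree h.2 ⟨fun y hy => hf₁ y (by omega), ha₁⟩
      simp [Expr.eval, Term.eval, hv₂, hf₂ d (by omega), hv₁, this]
    · simp [hy.ne, hf₂ y (by omega), hf₁ y hy]
  | sub e₁ e₂ h₁ h₂ =>
    intro h d s hd hρ
    simp only [Term.wf, Bool.and_eq_true] at h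
    obtain ⟨t₁, s₁, hr₁, ht₁, hv₁, hf₁, ha₁⟩ := h₁ h.1 d s hd hρ
    obtain ⟨t₂, s₂, hr₂, ht₂, hv₂, hf₂, ha₂⟩ := h₂ h.2 (d + 1) s₁ (by omega)
      (fun b hb => by rw [hf₁ b (by omega), hρ b hb])
    refine ⟨_, _, hr₁.seq (hr₂.seq (Runs.assign _ _ _)), by simp [Expr.cost, Term.time]; omega,
      ?_, fun y hy => ?_, by simp [ha₁, ha₂]⟩
    · have : e₂.eval s₁ = e₂.eval s := e₂.eval_agree h.2 ⟨fun y hy => hf₁ y (by omega), ha₁⟩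
      simp [Expr.eval, Term.eval, hv₂, hf₂ d (by omega), hv₁, this]
    · simp [hy.ne, hf₂ y (by omega), hf₁ y hy]
  | ite c e₁ e₂ hc h₁ h₂ =>
    intro h d s hd hρ
    simp only [Term.wf, Bool.and_eq_true] at h
    obtain ⟨t, s', hr, ht, hv, hf, ha⟩ := hc h.1.1 d s hd hρ
    have hag : s.Agree s' := ⟨fun y hy => hf y (by omega), ha⟩
    have hρ' : ∀ b < p, s'.reg b = ρ b := fun b hb => by rw [hf b (by omega), hρ b hb]
    by_cases hz : c.eval s = 0
    · obtain ⟨t₂, s₂, hr₂, ht₂, hv₂, hf₂, ha₂⟩ := h₂ h.2 d s' hd hρ'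
      refine ⟨_, s₂, hr.seq (Runs.ite_false (by simpa [Expr.eval, hv] using hz) hr₂),
        by simp [Expr.cost, Term.time]; omega, ?_, fun y hy => by rw [hf₂ y hy, hf y hy],
        by rw [ha₂, ha]⟩
      rw [hv₂, e₂.eval_agree h.2 hag]
      simp [Term.eval, hz]
    · obtain ⟨t₂, s₂, hr₂, ht₂, hv₂, hf₂, ha₂⟩ := h₁ h.1.2 d s' hd hρ'
      refine ⟨_, s₂, hr.seq (Runs.ite_true (by simpa [Expr.eval, hv] using hz) hr₂),
        by simp [Expr.cost, Term.time]; omega, ?_, fun y hy => by rw [hf₂ y hy, hf y hy],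
        by rw [ha₂, ha]⟩
      rw [hv₂, e₁.eval_agree h.1.2 hag]
      simp [Term.eval, hz]
  | sum x b e ih =>
    intro h d s hd hρ
    simp only [Term.wf, Bool.and_eq_true, decide_eq_true_eq] at h
    obtain ⟨⟨⟨hbp, hpx⟩, hx⟩, he⟩ := h
    -- The state on entry to the loop: empty accumulator in `d`, old value of `x` saved in `d + 1`,
    -- counter `x` at zero.
    set s₁ := ((s.setReg d 0).setReg (d + 1) (s.reg x)).setReg x 0 with hs₁
    obtain ⟨t, s', hr, ht, hi⟩ := exists_runs_loop (x := x) (b := b) (m := s.reg b)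
      (T := e.time ρ + 8) (P := .seq (e.compile (d + 2))
        (.seq (.assign d (.add (.reg d) (.reg (d + 2)))) (.assign x (.add (.reg x) (.const 1)))))
      (fun i s' => s'.reg d = ∑ j ∈ Finset.range i, e.eval (s.setReg x j) ∧
        s'.reg (d + 1) = s.reg x ∧ (∀ y < d, s'.reg y = (s.setReg x i).reg y) ∧ s'.arr = s.arr)
      (fun i s' hi => ⟨by simp [hi.2.2.1 x (by omega)], by
        have := hi.2.2.1 b (by omega)
        simpa [show b ≠ x by omega] using this⟩)
      (by
        rintro i - s' ⟨hv, hsv, hf, ha⟩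
        obtain ⟨t, s₂, hr, ht, hv₂, hf₂, ha₂⟩ := ih he (d + 2) s' (by omega) (fun c hc => by
          rw [hf c (by omega), State.setReg_reg, if_neg (by omega), hρ c hc])
        refine ⟨_, _, hr.seq ((Runs.assign _ _ _).seq (Runs.assign _ _ _)),
          by simp [Expr.cost]; omega, ?_, ?_, fun y hy => ?_, by simp [ha₂, ha]⟩
        · have : e.eval s' = e.eval (s.setReg x i) :=
            e.eval_agree he ⟨fun y hy => hf y (by omega), ha⟩
          simp [Expr.eval, show d ≠ x by omega, hf₂ d (by omega), hv₂, hv, Finset.sum_range_succ,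
            this]
        · simp [show d + 1 ≠ x by omega, hf₂ (d + 1) (by omega), hsv]
        · by_cases hyx : y = x
          · subst hyx
            simp [Expr.eval, hy.ne, hf₂ y (by omega), hf y hy]
          · have := hf y hy
            simp only [State.setReg_reg, if_neg hyx] at this ⊢
            rw [if_neg (by omega), hf₂ y (by omega), this])
      (s := s₁) (by
        refine ⟨by simp [hs₁, show d ≠ x by omega], by simp [hs₁, show d + 1 ≠ x by omega],
          fun y hy => ?_, by simp [hs₁]⟩
        by_cases hyx : y = x
        · simp [hs₁, hyx]
        · simp [hs₁, hyx, show y ≠ d by omega, show y ≠ d + 1 by omega])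
    obtain ⟨hv, hsv, hf, ha⟩ := hi
    have hs₁' : (((s.setReg d ((Expr.const 0).eval s)).setReg (d + 1)
        ((Expr.reg x).eval (s.setReg d ((Expr.const 0).eval s)))).setReg x
        ((Expr.const 0).eval ((s.setReg d ((Expr.const 0).eval s)).setReg (d + 1)
        ((Expr.reg x).eval (s.setReg d ((Expr.const 0).eval s)))))) = s₁ := by
      simp [hs₁, Expr.eval, show x ≠ d by omega]
    refine ⟨_, _, (Runs.assign _ _ _).seq ((Runs.assign _ _ _).seq ((Runs.assign _ _ _).seq
      (Runs.seq (by rw [hs₁']; exact hr) (Runs.assign _ _ _)))), ?_, ?_, fun y hy => ?_, by simp [ha]⟩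
    · simp only [Expr.cost, Term.time, ← hρ b hbp]
      rw [show e.time ρ + 8 + 4 = e.time ρ + 12 by ring] at ht
      omega
    · simp [show d ≠ x by omega, hv, Term.eval]
    · by_cases hyx : y = x
      · simp [hyx, Expr.eval, hsv]
      · simp [hyx, hf y hy]

/-- Straight-line code, conditionals and counting loops. In `loop x b c` the register `x` counts from
`0` up to the value of the register `b`. -/
inductive Command where
  | skip
  | set (x : ℕ) (e : Term)
  | put (a : ℕ) (i e : Term)
  | seq (c₁ c₂ : Command)
  | ite (e : Term) (c₁ c₂ : Command)
  | loop (x b : ℕ) (c : Command)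

/-- The states at the beginning of the rounds of a counting loop with body `f`. -/
def loopState (x : ℕ) (f : State → State) (s : State) : ℕ → State
  | 0 => s.setReg x 0
  | i + 1 => (f (loopState x f s i)).setReg x (i + 1)

/-- The effect of a command. -/
def Command.exec : Command → State → State
  | .skip, s => s
  | .set x e, s => s.setReg x (e.eval s)
  | .put a i e, s => s.setArr a (i.eval s) (e.eval s)
  | .seq c₁ c₂, s => c₂.exec (c₁.exec s)
  | .ite e c₁ c₂, s => if e.eval s = 0 then c₂.exec s else c₁.exec s
  | .loop x b c, s => loopState x c.exec s (s.reg b)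

/-- The command does not assign to register `x`. -/
def Command.keeps (x : ℕ) : Command → Bool
  | .skip => true
  | .set y _ => decide (x ≠ y)
  | .put _ _ _ => true
  | .seq c₁ c₂ => c₁.keeps x && c₂.keeps x
  | .ite _ c₁ c₂ => c₁.keeps x && c₂.keeps x
  | .loop y _ c => decide (x ≠ y) && c.keeps x

/-- The command does not write to array `a`. -/
def Command.keepsArr (a : ℕ) : Command → Bool
  | .skip => true
  | .set _ _ => true
  | .put b _ _ => decide (a ≠ b)
  | .seq c₁ c₂ => c₁.keepsArr a && c₂.keepsArr a
  | .ite _ c₁ c₂ => c₁.keepsArr a && c₂.keepsArr a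
  | .loop _ _ c => c.keepsArr a

/-- The command does not write to the parameters, which are the registers below `p`, nor to scratch
registers, and its loops are bounded by parameters. -/
def Command.wf (p : ℕ) : Command → Bool
  | .skip => true
  | .set x e => decide (p ≤ x) && decide (x < 60) && e.wf p
  | .put _ i e => i.wf p && e.wf p
  | .seq c₁ c₂ => c₁.wf p && c₂.wf p
  | .ite e c₁ c₂ => e.wf p && c₁.wf p && c₂.wf p
  | .loop x b c => decide (b < p) && decide (p ≤ x) && decide (x < 60) && c.keeps x && c.wf p

/-- The translation of a command to a program. -/
def Command.compile : Command → Program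
  | .skip => .skip
  | .set x e => .seq (e.compile 60) (.assign x (.reg 60))
  | .put a i e => .seq (i.compile 60) (.seq (e.compile 61) (.write a (.reg 60) (.reg 61)))
  | .seq c₁ c₂ => .seq c₁.compile c₂.compile
  | .ite e c₁ c₂ => .seq (e.compile 60) (.ite (.reg 60) c₁.compile c₂.compile)
  | .loop x b c => .seq (.assign x (.const 0)) (.loop (.sub (.reg b) (.reg x))
      (.seq c.compile (.assign x (.add (.reg x) (.const 1)))))

/-- A bound on the running time of a command, as a function of the parameters. -/
def Command.time (ρ : ℕ → ℕ) : Command → ℕ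
  | .skip => 1
  | .set _ e => e.time ρ + 2
  | .put _ i e => i.time ρ + e.time ρ + 3
  | .seq c₁ c₂ => c₁.time ρ + c₂.time ρ
  | .ite e c₁ c₂ => e.time ρ + c₁.time ρ + c₂.time ρ + 2
  | .loop _ b c => ρ b * (c.time ρ + 8) + 6

theorem Command.exec_reg {x : ℕ} (c : Command) : c.keeps x → ∀ s, (c.exec s).reg x = s.reg x := by
  induction c with
  | skip => intro _ s; rfl
  | set y e =>
    intro h s
    simp only [Command.keeps, decide_eq_true_eq] at h
    simp [Command.exec, h]
  | put a i e => intro _ s; rfl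
  | seq c₁ c₂ h₁ h₂ =>
    intro h s
    simp only [Command.keeps, Bool.and_eq_true] at h
    simp [Command.exec, h₁ h.1, h₂ h.2]
  | ite e c₁ c₂ h₁ h₂ =>
    intro h s
    simp only [Command.keeps, Bool.and_eq_true] at h
    simp only [Command.exec]
    split_ifs
    · exact h₂ h.2 s
    · exact h₁ h.1 s
  | loop y b c ih =>
    intro h s
    simp only [Command.keeps, Bool.and_eq_true, decide_eq_true_eq] at h
    simp only [Command.exec]
    induction s.reg b with
    | zero => simp [loopState, h.1]
    | succ m hm => simp [loopState, h.1, ih h.2, hm]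

theorem Command.exec_arr {a : ℕ} (c : Command) : c.keepsArr a →
    ∀ s, (c.exec s).arr a = s.arr a := by
  induction c with
  | skip => intro _ s; rfl
  | set y e => intro h s; rfl
  | put b i e =>
    intro h s
    simp only [Command.keepsArr, decide_eq_true_eq] at h
    simp [Command.exec, h]
  | seq c₁ c₂ h₁ h₂ =>
    intro h s
    simp only [Command.keepsArr, Bool.and_eq_true] at h
    simp [Command.exec, h₁ h.1, h₂ h.2]
  | ite e c₁ c₂ h₁ h₂ =>
    intro h s
    simp only [Command.keepsArr, Bool.and_eq_true] at h
    simp only [Command.exec]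
    split_ifs
    · exact h₂ h.2 s
    · exact h₁ h.1 s
  | loop y b c ih =>
    intro h s
    simp only [Command.keepsArr] at h
    simp only [Command.exec]
    induction s.reg b with
    | zero => simp [loopState]
    | succ m hm => simp [loopState, ih h, hm]

theorem Command.keeps_of_wf {p x : ℕ} (hx : x < p) (c : Command) : c.wf p → c.keeps x := by
  induction c with
  | skip => intro _; rfl
  | put a i e => intro _; rfl
  | set y e =>
    simp only [Command.wf, Command.keeps, Bool.and_eq_true, decide_eq_true_eq]
    omega
  | seq c₁ c₂ h₁ h₂ =>
    simp only [Command.wf, Command.keeps, Bool.and_eq_true]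
    exact fun h => ⟨h₁ h.1, h₂ h.2⟩
  | ite e c₁ c₂ h₁ h₂ =>
    simp only [Command.wf, Command.keeps, Bool.and_eq_true]
    exact fun h => ⟨h₁ h.1.2, h₂ h.2⟩
  | loop y b c ih =>
    simp only [Command.wf, Command.keeps, Bool.and_eq_true, decide_eq_true_eq]
    exact fun h => ⟨by omega, ih h.2⟩

/-- A simulation up to scratch registers, hence the second state `s₀`. A well-formed command never
changes a parameter, so the same `ρ` serves for all of its parts and the time bound depends on the
parameters alone. -/
theorem Command.exists_runs {p : ℕ} {ρ : ℕ → ℕ} (hp : p ≤ 60) (c : Command) : c.wf p →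
    ∀ s s₀ : State, s.Agree s₀ → (∀ b < p, s.reg b = ρ b) →
    ∃ t s', Runs c.compile s₀ t s' ∧ t ≤ c.time ρ ∧ (c.exec s).Agree s' := by
  induction c with
  | skip => intro _ s s₀ ha _; exact ⟨_, _, Runs.skip _, le_rfl, ha⟩
  | set x e =>
    intro h s s₀ ha hρ
    simp only [Command.wf, Bool.and_eq_true, decide_eq_true_eq] at h
    obtain ⟨t, s', hr, ht, hv, hf, har⟩ := e.exists_runs (ρ := ρ) hp h.2 60 s₀ le_rfl
      (fun b hb => by rw [ha.1 b (by omega), hρ b hb])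
    refine ⟨_, _, hr.seq (Runs.assign _ _ _), by simp [Expr.cost, Command.time]; omega, ?_⟩
    rw [e.eval_agree h.2 ha] at hv
    refine ⟨fun y hy => ?_, by simp [Command.exec, har, ha.2]⟩
    simp [Command.exec, Expr.eval, hv, hf y hy, ha.1 y hy]
  | put a i e =>
    intro h s s₀ ha hρ
    simp only [Command.wf, Bool.and_eq_true] at h
    obtain ⟨t, s', hr, ht, hv, hf, har⟩ := i.exists_runs (ρ := ρ) hp h.1 60 s₀ le_rfl
      (fun b hb => by rw [ha.1 b (by omega), hρ b hb])
    have ha' : s.Agree s' := ⟨fun y hy => by rw [hf y hy, ha.1 y hy], by rw [har, ha.2]⟩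
    obtain ⟨t', s'', hr', ht', hv', hf', har'⟩ := e.exists_runs (ρ := ρ) hp h.2 61 s' (by omega)
      (fun b hb => by rw [ha'.1 b (by omega), hρ b hb])
    refine ⟨_, _, hr.seq (hr'.seq (Runs.write _ _ _ _)),
      by simp [Expr.cost, Command.time]; omega, ?_⟩
    rw [e.eval_agree h.2 ha'] at hv'
    rw [i.eval_agree h.1 ha, ← hf' 60 (by omega)] at hv
    have ha'' : s''.arr = s.arr := by rw [har', ha'.2]
    refine ⟨fun y hy => ?_, ?_⟩
    · simp [Command.exec, hf' y (by omega), ha'.1 y hy]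
    · simp [Command.exec, State.setArr, Expr.eval, hv, hv', ha'']
  | seq c₁ c₂ h₁ h₂ =>
    intro h s s₀ ha hρ
    simp only [Command.wf, Bool.and_eq_true] at h
    obtain ⟨t₁, s₁, hr₁, ht₁, ha₁⟩ := h₁ h.1 s s₀ ha hρ
    obtain ⟨t₂, s₂, hr₂, ht₂, ha₂⟩ := h₂ h.2 _ s₁ ha₁
      (fun b hb => by rw [c₁.exec_reg (c₁.keeps_of_wf hb h.1), hρ b hb])
    exact ⟨_, _, hr₁.seq hr₂, by simp [Command.time]; omega, ha₂⟩
  | ite e c₁ c₂ h₁ h₂ =>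
    intro h s s₀ ha hρ
    simp only [Command.wf, Bool.and_eq_true] at h
    obtain ⟨t, s', hr, ht, hv, hf, har⟩ := e.exists_runs (ρ := ρ) hp h.1.1 60 s₀ le_rfl
      (fun b hb => by rw [ha.1 b (by omega), hρ b hb])
    have ha' : s.Agree s' := ⟨fun y hy => by rw [hf y hy, ha.1 y hy], by rw [har, ha.2]⟩
    rw [e.eval_agree h.1.1 ha] at hv
    by_cases hz : e.eval s = 0
    · obtain ⟨t₂, s₂, hr₂, ht₂, ha₂⟩ := h₂ h.2 s s' ha' hρ
      refine ⟨_, _, hr.seq (Runs.ite_false (by simpa [Expr.eval, hv] using hz) hr₂),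
        by simp [Expr.cost, Command.time]; omega, ?_⟩
      simpa [Command.exec, hz] using ha₂
    · obtain ⟨t₂, s₂, hr₂, ht₂, ha₂⟩ := h₁ h.1.2 s s' ha' hρ
      refine ⟨_, _, hr.seq (Runs.ite_true (by simpa [Expr.eval, hv] using hz) hr₂),
        by simp [Expr.cost, Command.time]; omega, ?_⟩
      simpa [Command.exec, hz] using ha₂
  | loop x b c ih =>
    intro h s s₀ ha hρ
    simp only [Command.wf, Bool.and_eq_true, decide_eq_true_eq] at h
    obtain ⟨⟨⟨⟨hbp, hpx⟩, hx⟩, hk⟩, hc⟩ := h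
    -- The loop bound is a parameter, so it does not move while the loop runs.
    have hpar : ∀ q < p, ∀ i, (loopState x c.exec s i).reg q = s.reg q := by
      intro q hq i
      induction i with
      | zero => simp [loopState, show q ≠ x by omega]
      | succ i hi =>
        simp [loopState, show q ≠ x by omega, c.exec_reg (c.keeps_of_wf hq hc), hi]
    have hcount : ∀ i, (loopState x c.exec s i).reg x = i := by
      rintro (_ | i) <;> simp [loopState]
    obtain ⟨t, s', hr, ht, hi⟩ := exists_runs_loop (x := x) (b := b) (m := s.reg b)
      (T := c.time ρ + 4) (P := .seq c.compile (.assign x (.add (.reg x) (.const 1))))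
      (fun i s' => (loopState x c.exec s i).Agree s')
      (fun i s' hi => ⟨by rw [hi.1 x hx, hcount], by rw [hi.1 b (by omega), hpar b hbp]⟩)
      (by
        intro i _ s' hi
        obtain ⟨t, s'', hr, ht, ha'⟩ := ih hc _ s' hi (fun q hq => by rw [hpar q hq, hρ q hq])
        refine ⟨_, _, hr.seq (Runs.assign _ _ _), by simp [Expr.cost]; omega, ?_⟩
        have : (Expr.add (Expr.reg x) (Expr.const 1)).eval s'' = i + 1 := by
          simp only [Expr.eval]
          rw [ha'.1 x hx, c.exec_reg hk, hcount]
        rw [this]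
        exact ha'.setReg x (i + 1))
      (s := s₀.setReg x 0) (ha.setReg x 0)
    refine ⟨_, _, (Runs.assign _ _ _).seq hr, ?_, hi⟩
    simp only [Expr.cost, Command.time, ← hρ b hbp]
    rw [show c.time ρ + 4 + 4 = c.time ρ + 8 by ring] at ht
    omega

theorem Term.exists_time_le {p : ℕ} (e : Term) : e.wf p → ∃ C d : ℕ, ∀ (ρ : ℕ → ℕ) (M : ℕ),
    1 ≤ M → (∀ b < p, ρ b ≤ M) → e.time ρ ≤ C * M ^ d := by
  have mono : ∀ {C d D M : ℕ}, 1 ≤ M → d ≤ D → C * M ^ d ≤ C * M ^ D := fun hM hd =>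
    Nat.mul_le_mul_left _ (Nat.pow_le_pow_right hM hd)
  induction e with
  | const m => intro _; exact ⟨2, 0, fun ρ M _ _ => by simp [Term.time]⟩
  | reg x => intro _; exact ⟨2, 0, fun ρ M _ _ => by simp [Term.time]⟩
  | read a i ih =>
    intro h
    obtain ⟨C, d, hC⟩ := ih h
    refine ⟨C + 3, d, fun ρ M hM hρ => ?_⟩
    have h₁ := hC ρ M hM hρ
    have := Nat.one_le_pow d M hM
    simp only [Term.time, add_mul]
    omega
  | add e₁ e₂ h₁ h₂ =>
    intro h
    simp only [Term.wf, Bool.and_eq_true] at h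
    obtain ⟨C₁, d₁, hC₁⟩ := h₁ h.1
    obtain ⟨C₂, d₂, hC₂⟩ := h₂ h.2
    refine ⟨C₁ + C₂ + 4, d₁ + d₂, fun ρ M hM hρ => ?_⟩
    have h₁ := (hC₁ ρ M hM hρ).trans (mono hM (Nat.le_add_right d₁ d₂))
    have h₂ := (hC₂ ρ M hM hρ).trans (mono hM (Nat.le_add_left d₂ d₁))
    have := Nat.one_le_pow (d₁ + d₂) M hM
    simp only [Term.time, add_mul]
    omega
  | sub e₁ e₂ h₁ h₂ =>
    intro h
    simp only [Term.wf, Bool.and_eq_true] at h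
    obtain ⟨C₁, d₁, hC₁⟩ := h₁ h.1
    obtain ⟨C₂, d₂, hC₂⟩ := h₂ h.2
    refine ⟨C₁ + C₂ + 4, d₁ + d₂, fun ρ M hM hρ => ?_⟩
    have h₁ := (hC₁ ρ M hM hρ).trans (mono hM (Nat.le_add_right d₁ d₂))
    have h₂ := (hC₂ ρ M hM hρ).trans (mono hM (Nat.le_add_left d₂ d₁))
    have := Nat.one_le_pow (d₁ + d₂) M hM
    simp only [Term.time, add_mul]
    omega
  | ite c e₁ e₂ h₀ h₁ h₂ =>
    intro h
    simp only [Term.wf, Bool.and_eq_true] at h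
    obtain ⟨C₀, d₀, hC₀⟩ := h₀ h.1.1
    obtain ⟨C₁, d₁, hC₁⟩ := h₁ h.1.2
    obtain ⟨C₂, d₂, hC₂⟩ := h₂ h.2
    refine ⟨C₀ + C₁ + C₂ + 2, d₀ + d₁ + d₂, fun ρ M hM hρ => ?_⟩
    have h₀ := (hC₀ ρ M hM hρ).trans (mono hM (show d₀ ≤ d₀ + d₁ + d₂ by omega))
    have h₁ := (hC₁ ρ M hM hρ).trans (mono hM (show d₁ ≤ d₀ + d₁ + d₂ by omega))
    have h₂ := (hC₂ ρ M hM hρ).trans (mono hM (show d₂ ≤ d₀ + d₁ + d₂ by omega))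
    have := Nat.one_le_pow (d₀ + d₁ + d₂) M hM
    simp only [Term.time, add_mul]
    omega
  | sum x b e ih =>
    intro h
    simp only [Term.wf, Bool.and_eq_true, decide_eq_true_eq] at h
    obtain ⟨C, d, hC⟩ := ih h.2
    refine ⟨C + 24, d + 1, fun ρ M hM hρ => ?_⟩
    have h₁ := hC ρ M hM hρ
    have h₂ := hρ b h.1.1.1
    have h₃ := Nat.one_le_pow d M hM
    simp only [Term.time]
    calc ρ b * (e.time ρ + 12) + 12 ≤ M * (C * M ^ d + 12 * M ^ d) + 12 * (M * M ^ d) := by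
          gcongr
          · omega
          · nlinarith
      _ = _ := by ring

/-- All loops and sums are bounded by parameters, so nesting turns into the exponent, and `C` and
`d` depend on the text of the command only. Termination and the time bound thus hold on every branch
of the search, also where the computed data are meaningless. -/
theorem Command.exists_time_le {p : ℕ} (c : Command) : c.wf p → ∃ C d : ℕ, ∀ (ρ : ℕ → ℕ) (M : ℕ),
    1 ≤ M → (∀ b < p, ρ b ≤ M) → c.time ρ ≤ C * M ^ d := by
  have mono : ∀ {C d D M : ℕ}, 1 ≤ M → d ≤ D → C * M ^ d ≤ C * M ^ D := fun hM hd =>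
    Nat.mul_le_mul_left _ (Nat.pow_le_pow_right hM hd)
  induction c with
  | skip => intro _; exact ⟨1, 0, fun ρ M _ _ => by simp [Command.time]⟩
  | set x e =>
    intro h
    simp only [Command.wf, Bool.and_eq_true] at h
    obtain ⟨C, d, hC⟩ := e.exists_time_le h.2
    refine ⟨C + 2, d, fun ρ M hM hρ => ?_⟩
    have h₁ := hC ρ M hM hρ
    have := Nat.one_le_pow d M hM
    simp only [Command.time, add_mul]
    omega
  | put a i e =>
    intro h
    simp only [Command.wf, Bool.and_eq_true] at h
    obtain ⟨C₁, d₁, hC₁⟩ := i.exists_time_le h.1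
    obtain ⟨C₂, d₂, hC₂⟩ := e.exists_time_le h.2
    refine ⟨C₁ + C₂ + 3, d₁ + d₂, fun ρ M hM hρ => ?_⟩
    have h₁ := (hC₁ ρ M hM hρ).trans (mono hM (Nat.le_add_right d₁ d₂))
    have h₂ := (hC₂ ρ M hM hρ).trans (mono hM (Nat.le_add_left d₂ d₁))
    have := Nat.one_le_pow (d₁ + d₂) M hM
    simp only [Command.time, add_mul]
    omega
  | seq c₁ c₂ h₁ h₂ =>
    intro h
    simp only [Command.wf, Bool.and_eq_true] at h
    obtain ⟨C₁, d₁, hC₁⟩ := h₁ h.1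
    obtain ⟨C₂, d₂, hC₂⟩ := h₂ h.2
    refine ⟨C₁ + C₂, d₁ + d₂, fun ρ M hM hρ => ?_⟩
    have h₁ := (hC₁ ρ M hM hρ).trans (mono hM (Nat.le_add_right d₁ d₂))
    have h₂ := (hC₂ ρ M hM hρ).trans (mono hM (Nat.le_add_left d₂ d₁))
    simp only [Command.time, add_mul]
    omega
  | ite e c₁ c₂ h₁ h₂ =>
    intro h
    simp only [Command.wf, Bool.and_eq_true] at h
    obtain ⟨C₀, d₀, hC₀⟩ := e.exists_time_le h.1.1
    obtain ⟨C₁, d₁, hC₁⟩ := h₁ h.1.2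
    obtain ⟨C₂, d₂, hC₂⟩ := h₂ h.2
    refine ⟨C₀ + C₁ + C₂ + 2, d₀ + d₁ + d₂, fun ρ M hM hρ => ?_⟩
    have h₀ := (hC₀ ρ M hM hρ).trans (mono hM (show d₀ ≤ d₀ + d₁ + d₂ by omega))
    have h₁ := (hC₁ ρ M hM hρ).trans (mono hM (show d₁ ≤ d₀ + d₁ + d₂ by omega))
    have h₂ := (hC₂ ρ M hM hρ).trans (mono hM (show d₂ ≤ d₀ + d₁ + d₂ by omega))
    have := Nat.one_le_pow (d₀ + d₁ + d₂) M hM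
    simp only [Command.time, add_mul]
    omega
  | loop x b c ih =>
    intro h
    simp only [Command.wf, Bool.and_eq_true, decide_eq_true_eq] at h
    obtain ⟨C, d, hC⟩ := ih h.2
    refine ⟨C + 14, d + 1, fun ρ M hM hρ => ?_⟩
    have h₁ := hC ρ M hM hρ
    have h₂ := hρ b h.1.1.1.1
    have h₃ := Nat.one_le_pow d M hM
    simp only [Command.time]
    calc ρ b * (c.time ρ + 8) + 6 ≤ M * (C * M ^ d + 8 * M ^ d) + 6 * (M * M ^ d) := by
          gcongr
          · omega
          · nlinarith
      _ = _ := by ring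

end RAM

/-! ### Vertex separators, submodularity and the farthest minimum separator. -/

namespace CycleDeletion

open Relation

/-- The least `i < b` with `p i`, or `b` if there is none. -/
noncomputable def firstBelow (b : ℕ) (p : ℕ → Prop) : ℕ := sInf {i | p i ∨ b ≤ i}

theorem firstBelow_mem (b : ℕ) (p : ℕ → Prop) : p (firstBelow b p) ∨ b ≤ firstBelow b p :=
  Nat.sInf_mem (s := {i | p i ∨ b ≤ i}) ⟨b, Or.inr le_rfl⟩

theorem firstBelow_le (b : ℕ) (p : ℕ → Prop) : firstBelow b p ≤ b :=
  Nat.sInf_le (s := {i | p i ∨ b ≤ i}) (Or.inr le_rfl)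

theorem le_of_firstBelow {b i : ℕ} {p : ℕ → Prop} (h : p i) : firstBelow b p ≤ i :=
  Nat.sInf_le (s := {i | p i ∨ b ≤ i}) (Or.inl h)

theorem firstBelow_spec {b : ℕ} {p : ℕ → Prop} (h : firstBelow b p < b) : p (firstBelow b p) :=
  (firstBelow_mem b p).resolve_right (by omega)

theorem firstBelow_lt {b i : ℕ} {p : ℕ → Prop} (hi : i < b) (h : p i) : firstBelow b p < b :=
  (le_of_firstBelow h).trans_lt hi

theorem firstBelow_congr {b : ℕ} {p q : ℕ → Prop} (h : ∀ i < b, p i ↔ q i) :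
    firstBelow b p = firstBelow b q := by
  unfold firstBelow
  congr 1
  ext i
  by_cases hi : i < b
  · simp [h i hi]
  · simp [not_lt.mp hi]

section Boundary

variable (n : ℕ) (H : ℕ → ℕ → Prop)

open Classical in
/-- The vertices outside `C` with an arc into `C`. -/
noncomputable def boundary (C : Set ℕ) : Finset ℕ :=
  (Finset.range n).filter fun u => u ∉ C ∧ ∃ v ∈ C, H u v

variable {n H}

theorem mem_boundary {C : Set ℕ} {u : ℕ} :
    u ∈ boundary n H C ↔ u < n ∧ u ∉ C ∧ ∃ v ∈ C, H u v := by
  simp [boundary]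

/-- Submodularity. It suffices to compare unions with unions and intersections with intersections: a
vertex in both boundaries on the left lies outside `B` and `C` and has an arc into `B ∩ C`, so it is
in both boundaries on the right. -/
theorem card_boundary_inter_add_card_boundary_union (B C : Set ℕ) :
    (boundary n H (B ∩ C)).card + (boundary n H (B ∪ C)).card ≤
      (boundary n H B).card + (boundary n H C).card := by
  classical
  rw [← Finset.card_union_add_card_inter, ← Finset.card_union_add_card_inter (boundary n H B)]
  refine add_le_add (Finset.card_le_card fun u => ?_) (Finset.card_le_card fun u => ?_)
  · simp only [Finset.mem_union, mem_boundary, Set.mem_inter_iff, Set.mem_union]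
    rintro (⟨hu, h, v, hv, huv⟩ | ⟨hu, h, v, hv | hv, huv⟩)
    · by_cases hB : u ∈ B
      · exact Or.inr ⟨hu, fun hC => h ⟨hB, hC⟩, v, hv.2, huv⟩
      · exact Or.inl ⟨hu, hB, v, hv.1, huv⟩
    · exact Or.inl ⟨hu, fun hB => h (Or.inl hB), v, hv, huv⟩
    · exact Or.inr ⟨hu, fun hC => h (Or.inr hC), v, hv, huv⟩
  · simp only [Finset.mem_inter, mem_boundary, Set.mem_inter_iff, Set.mem_union]
    rintro ⟨⟨hu, h, v, hv, huv⟩, -, h', -⟩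
    exact ⟨⟨hu, fun hB => h' (Or.inl hB), v, hv.1, huv⟩,
      hu, fun hC => h' (Or.inr hC), v, hv.2, huv⟩

variable (T : ℕ → Prop) (A : ℕ → ℕ)

/-- `C` contains the terminals `T` and avoids the vertices marked by `A`, so that deleting its
boundary cuts all paths from `A` to `T`. -/
def Sep (C : Set ℕ) : Prop := (∀ v, T v → v ∈ C) ∧ ∀ v ∈ C, A v = 0

variable {T A}

theorem Sep.inter {B C : Set ℕ} (hB : Sep T A B) (hC : ∀ v, T v → v ∈ C) : Sep T A (B ∩ C) :=
  ⟨fun v hv => ⟨hB.1 v hv, hC v hv⟩, fun v hv => hB.2 v hv.1⟩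

theorem Sep.union {B C : Set ℕ} (hB : Sep T A B) (hC : Sep T A C) : Sep T A (B ∪ C) :=
  ⟨fun v hv => Or.inl (hB.1 v hv), fun v hv => hv.elim (hB.2 v) (hC.2 v)⟩

variable (n H T A)

/-- The separator of minimum size that is farthest from the sources `A`. -/
structure IsFar (B : Set ℕ) : Prop where
  sep : Sep T A B
  card_le : ∀ C, Sep T A C → (boundary n H B).card ≤ (boundary n H C).card
  subset : ∀ C, Sep T A C → (boundary n H C).card ≤ (boundary n H B).card → B ⊆ C

variable {n H T A}

/-- Uniqueness lets the set found by the machine be identified with the chosen set `far`. -/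
theorem IsFar.eq {B B' : Set ℕ} (hB : IsFar n H T A B) (hB' : IsFar n H T A B') : B = B' :=
  (hB.subset B' hB'.sep (hB'.card_le B hB.sep)).antisymm
    (hB'.subset B hB.sep (hB.card_le B' hB'.sep))

/-- `B ∪ C` is a separator, so its boundary is at least as large as that of `B`, and submodularity
leaves the rest for `B ∩ C`. This is how an unknown separator is pushed into `B` for free. -/
theorem IsFar.card_inter_le {B C : Set ℕ} (hB : IsFar n H T A B) (hC : Sep T A C) :
    (boundary n H (B ∩ C)).card ≤ (boundary n H C).card := by
  have h₁ := card_boundary_inter_add_card_boundary_union (n := n) (H := H) B C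
  have h₂ := hB.card_le _ (hB.sep.union hC)
  omega

/-- Minimize the boundary first and then the number of elements. Intersecting the result with
another minimum separator keeps the boundary minimum, so the intersection cannot be smaller. -/
theorem exists_isFar (hT : ∀ v, T v → v < n) {C : Set ℕ} (hC : Sep T A C) :
    ∃ B, IsFar n H T A B := by
  classical
  have hne : ∃ m, ∃ C, Sep T A C ∧ (boundary n H C).card = m := ⟨_, C, hC, rfl⟩
  obtain ⟨C₀, hC₀, hm⟩ := Nat.find_spec hne
  have hmin : ∀ C, Sep T A C → (boundary n H C₀).card ≤ (boundary n H C).card := fun C hC => by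
    rw [hm]; exact Nat.find_min' hne ⟨C, hC, rfl⟩
  have hinter : ∀ B C, Sep T A B → Sep T A C → (boundary n H B).card ≤ (boundary n H C₀).card →
      (boundary n H C).card ≤ (boundary n H C₀).card →
      (boundary n H (B ∩ C)).card ≤ (boundary n H C₀).card := by
    intro B C hB hC h₁ h₂
    have h₃ := card_boundary_inter_add_card_boundary_union (n := n) (H := H) B C
    have h₄ := hmin _ (hB.union hC)
    omega
  -- Restricting to numbers below `n` makes the sets finite without enlarging the boundary, and
  -- loses no terminal by `hT`.
  have hne' : ∃ m, ∃ S : Finset ℕ, Sep T A (S : Set ℕ) ∧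
      (boundary n H (S : Set ℕ)).card ≤ (boundary n H C₀).card ∧ S.card = m := by
    refine ⟨_, (Finset.range n).filter (· ∈ C₀), ?_, Finset.card_le_card fun u hu => ?_, rfl⟩
    · refine ⟨fun v hv => ?_, fun v hv => ?_⟩
      · simp [hT v hv, hC₀.1 v hv]
      · simp only [Finset.coe_filter, Finset.mem_range, Set.mem_ofPred_eq] at hv
        exact hC₀.2 v hv.2
    · simp only [mem_boundary, Finset.coe_filter, Finset.mem_range, Set.mem_ofPred_eq] at hu ⊢
      obtain ⟨hu, hu', v, hv, huv⟩ := hu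
      exact ⟨hu, fun h => hu' ⟨hu, h⟩, v, hv.2, huv⟩
  obtain ⟨S, hS, hSm, hSc⟩ := Nat.find_spec hne'
  refine ⟨S, hS, fun C hC => hSm.trans (hmin C hC), fun C hC hle => ?_⟩
  have h₁ := hinter S C hS hC hSm (hle.trans hSm)
  have hcoe : ((S.filter (· ∈ C) : Finset ℕ) : Set ℕ) = (S : Set ℕ) ∩ C := by
    ext; simp
  have h₂ := Nat.find_min' hne' ⟨S.filter (· ∈ C), by rw [hcoe]; exact hS.inter hC.1,
    by rw [hcoe]; exact h₁, rfl⟩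
  have h₃ := Finset.eq_of_subset_of_card_le (Finset.filter_subset (· ∈ C) S) (by omega)
  intro v hv
  have : v ∈ S.filter (· ∈ C) := by rw [h₃]; exact hv
  exact (Finset.mem_filter.mp this).2

open Classical in
variable (n H T A) in
/-- The farthest separator of minimum size. -/
noncomputable def far : Set ℕ := if h : ∃ B, IsFar n H T A B then h.choose else ∅

theorem isFar_far (hT : ∀ v, T v → v < n) {C : Set ℕ} (hC : Sep T A C) :
    IsFar n H T A (far n H T A) := by
  have h := exists_isFar (H := H) hT hC
  rw [far, dif_pos h]
  exact h.choose_spec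

end Boundary

/-! ### Stabilization of increasing sequences of sets. -/

section Stabilize

/-- An increasing sequence of sets of numbers below `n` in which equality of consecutive members
persists is constant from `n` on. -/
theorem stable_of_le {n : ℕ} (S : ℕ → Set ℕ) (hn : ∀ r, ∀ v ∈ S r, v < n)
    (hmono : ∀ r, S r ⊆ S (r + 1)) (hst : ∀ r, S (r + 1) ⊆ S r → S (r + 2) ⊆ S (r + 1)) :
    S (n + 1) ⊆ S n := by
  by_contra hcon
  have hne : ∀ r ≤ n, ¬ S (r + 1) ⊆ S r := by
    intro r hr h
    apply hcon
    have : ∀ j, S (r + j + 1) ⊆ S (r + j) := by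
      intro j
      induction j with
      | zero => exact h
      | succ j ih => exact hst _ ih
    have h' := this (n - r)
    rwa [Nat.add_sub_cancel' hr] at h'
  -- If no step up to `n` were stationary, each would add an element, which makes `n + 1` elements
  -- below `n`.
  have hcard : ∀ r ≤ n + 1, r ≤ (S r).ncard := by
    intro r
    induction r with
    | zero => simp
    | succ r ih =>
      intro hr
      have hfin : (S (r + 1)).Finite := (Set.finite_lt_nat n).subset (hn (r + 1))
      have := Set.ncard_lt_ncard (ssubset_of_subset_not_subset (hmono r) (hne r (by omega))) hfin
      have := ih (by omega)
      omega
  have h₁ := hcard (n + 1) le_rfl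
  have h₂ : (S (n + 1)).ncard ≤ n := by
    have := Set.ncard_le_ncard (t := {v | v < n}) (hn (n + 1)) (Set.finite_lt_nat n)
    have h₃ : ({v | v < n} : Set ℕ) = (Finset.range n : Finset ℕ) := by ext; simp
    rwa [h₃, Set.ncard_coe_finset, Finset.card_range] at this
  omega

end Stabilize

end CycleDeletion

/-! ### The branching step, its invariant and its measure. -/

namespace CycleDeletion

open Relation

section Step

variable (n : ℕ) (adj : ℕ → ℕ → Prop) (lvl : ℕ → ℕ)

/-- The arcs of `D - X`, where `X` is the set of vertices marked by `del`. -/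
def Arc (del : ℕ → ℕ) (u v : ℕ) : Prop := u < n ∧ v < n ∧ adj u v ∧ del u = 0 ∧ del v = 0

/-- The vertices whose level is between `1` and `q`. -/
def Terminal (q v : ℕ) : Prop := v < n ∧ lvl v ≠ 0 ∧ lvl v ≤ q

/-- The path relation of the subdigraph induced by `C`. -/
def PathIn (H : ℕ → ℕ → Prop) (C : Set ℕ) : ℕ → ℕ → Prop :=
  ReflTransGen fun u v => u ∈ C ∧ v ∈ C ∧ H u v

/-- In the subdigraph induced by `C`, paths between terminals do not descend in level, and no vertex
reached from a terminal `w` has two successors from which one can return to the level of `w`. -/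
structure Good (H : ℕ → ℕ → Prop) (T : ℕ → Prop) (C : Set ℕ) : Prop where
  mono : ∀ w w', T w → T w' → PathIn H C w w' → lvl w ≤ lvl w'
  unique : ∀ w v x y w₁ w₂, T w → T w₁ → T w₂ → lvl w₁ ≤ lvl w → lvl w₂ ≤ lvl w → x ≠ y →
    v ∈ C → x ∈ C → y ∈ C → H v x → H v y → PathIn H C w v → PathIn H C x w₁ → PathIn H C y w₂ →
    False

variable {n adj lvl}

theorem PathIn.mono {H H' : ℕ → ℕ → Prop} {C C' : Set ℕ} (hH : ∀ u v, H u v → H' u v)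
    (hC : C ⊆ C') {u v : ℕ} (h : PathIn H C u v) : PathIn H' C' u v :=
  ReflTransGen.mono (fun _ _ h => ⟨hC h.1, hC h.2.1, hH _ _ h.2.2⟩) _ _ h

theorem Good.mono_set {H : ℕ → ℕ → Prop} {T : ℕ → Prop} {C C' : Set ℕ} (hC : C' ⊆ C)
    (h : Good lvl H T C) : Good lvl H T C' where
  mono w w' hw hw' hp := h.mono w w' hw hw' (hp.mono (fun _ _ h => h) hC)
  unique w v x y w₁ w₂ hw h₁ h₂ hl₁ hl₂ hxy hv hx hy hvx hvy p₁ p₂ p₃ :=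
    h.unique w v x y w₁ w₂ hw h₁ h₂ hl₁ hl₂ hxy (hC hv) (hC hx) (hC hy) hvx hvy
      (p₁.mono (fun _ _ h => h) hC) (p₂.mono (fun _ _ h => h) hC) (p₃.mono (fun _ _ h => h) hC)

theorem Good.mono_arc {H H' : ℕ → ℕ → Prop} {T : ℕ → Prop} {C : Set ℕ}
    (hH : ∀ u v, H' u v → H u v) (h : Good lvl H T C) : Good lvl H' T C where
  mono w w' hw hw' hp := h.mono w w' hw hw' (hp.mono hH le_rfl)
  unique w v x y w₁ w₂ hw h₁ h₂ hl₁ hl₂ hxy hv hx hy hvx hvy p₁ p₂ p₃ :=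
    h.unique w v x y w₁ w₂ hw h₁ h₂ hl₁ hl₂ hxy hv hx hy (hH _ _ hvx) (hH _ _ hvy)
      (p₁.mono hH le_rfl) (p₂.mono hH le_rfl) (p₃.mono hH le_rfl)

theorem Good.mono_terminal {H : ℕ → ℕ → Prop} {T T' : ℕ → Prop} {C : Set ℕ}
    (hT : ∀ v, T' v → T v) (h : Good lvl H T C) : Good lvl H T' C where
  mono w w' hw hw' hp := h.mono w w' (hT _ hw) (hT _ hw') hp
  unique w v x y w₁ w₂ hw h₁ h₂ := h.unique w v x y w₁ w₂ (hT _ hw) (hT _ h₁) (hT _ h₂)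

/-- A good separator can be shrunk into the farthest minimum separator such that all of its vertices
have a path to a terminal. -/
theorem exists_good_subset {H : ℕ → ℕ → Prop} {T : ℕ → Prop} {A : ℕ → ℕ} {B C : Set ℕ}
    (hB : IsFar n H T A B) (hC : Sep T A C) (hg : Good lvl H T C) :
    ∃ C', C' ⊆ B ∧ Sep T A C' ∧ Good lvl H T C' ∧
      (boundary n H C').card ≤ (boundary n H C).card ∧
      ∀ v ∈ C', ∃ w, T w ∧ PathIn H C' v w := by
  set C₁ := B ∩ C
  set C' := {v | v ∈ C₁ ∧ ∃ w, T w ∧ PathIn H C₁ v w}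
  have hC₁ : Sep T A C₁ := hB.sep.inter hC.1
  have hsub : C' ⊆ C₁ := fun v hv => hv.1
  have hpath : ∀ v w, v ∈ C₁ → T w → PathIn H C₁ v w → PathIn H C' v w := by
    intro v w hv hw hp
    induction hp using ReflTransGen.head_induction_on with
    | refl => exact ReflTransGen.refl
    | head h₁ h₂ ih =>
      exact ReflTransGen.head ⟨⟨h₁.1, w, hw, ReflTransGen.head h₁ h₂⟩, ⟨h₁.2.1, w, hw, h₂⟩, h₁.2.2⟩
        (ih h₁.2.1)
  refine ⟨C', fun v hv => hv.1.1, ⟨fun v hv => ⟨hC₁.1 v hv, v, hv, ReflTransGen.refl⟩,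
    fun v hv => hC₁.2 v hv.1⟩, hg.mono_set fun v hv => hv.1.2, ?_, ?_⟩
  · refine le_trans (Finset.card_le_card fun u => ?_) (hB.card_inter_le hC)
    simp only [mem_boundary]
    rintro ⟨hu, hu', v, hv, huv⟩
    refine ⟨hu, fun hu₁ => hu' ⟨hu₁, ?_⟩, v, hv.1, huv⟩
    obtain ⟨w, hw, hp⟩ := hv.2
    exact ⟨w, hw, ReflTransGen.head ⟨hu₁, hv.1, huv⟩ hp⟩
  · rintro v ⟨hv, w, hw, hp⟩
    exact ⟨w, hw, hpath v w hv hw hp⟩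

variable (n lvl)

/-- `v` has at least two successors. -/
def Branching (E : ℕ → ℕ → Prop) (v : ℕ) : Prop := ∃ x < n, ∃ y < n, E v x ∧ E v y ∧ x ≠ y

open Classical in
/-- After sufficiently many rounds `r`, the value `trace r v` is `x + 1` if a vertex `w` of level `q`
has `x` as its only successor and the forced path from `x` leads to `v`, where forced paths stop at
terminals and at vertices with several successors. -/
noncomputable def trace (q : ℕ) (E : ℕ → ℕ → Prop) : ℕ → ℕ → ℕ
  | 0, v => if ∃ w < n, q ≠ 0 ∧ lvl w = q ∧ ¬ Branching n E w ∧ E w v then v + 1 else 0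
  | r + 1, v =>
    if trace q E r v ≠ 0 then trace q E r v
    else
      let u := firstBelow n fun u =>
        trace q E r u ≠ 0 ∧ ¬ Terminal n lvl q u ∧ ¬ Branching n E u ∧ E u v
      if u < n then trace q E r u else 0

variable {n lvl}

theorem trace_of_le {q : ℕ} {E : ℕ → ℕ → Prop} {r r' v : ℕ} (h : trace n lvl q E r v ≠ 0)
    (hr : r ≤ r') : trace n lvl q E r' v = trace n lvl q E r v := by
  induction r', hr using Nat.le_induction with
  | base => rfl
  | succ m _ ih => rw [trace, if_pos (by rw [ih]; exact h), ih]

/-- Soundness of the trace: a nonzero value names the first vertex of an actual forced path, which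
is the vertex that a branch may declare outside the separator. -/
theorem trace_spec {q : ℕ} {E : ℕ → ℕ → Prop} (r v : ℕ) (h : trace n lvl q E r v ≠ 0) :
    ∃ w x, trace n lvl q E r v = x + 1 ∧ w < n ∧ q ≠ 0 ∧ lvl w = q ∧ ¬ Branching n E w ∧ E w x ∧
      ReflTransGen (fun u u' => ¬ Terminal n lvl q u ∧ ¬ Branching n E u ∧ E u u') x v := by
  induction r generalizing v with
  | zero =>
    rw [trace] at h ⊢
    split_ifs at h ⊢ with h'
    · obtain ⟨w, hw, hq, hl, hb, he⟩ := h'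
      exact ⟨w, v, rfl, hw, hq, hl, hb, he, ReflTransGen.refl⟩
    · exact absurd rfl h
  | succ r ih =>
    rw [trace] at h ⊢
    split_ifs at h ⊢ with h₁
    · exact ih v h₁
    · simp only at h ⊢
      split_ifs at h ⊢ with h₂
      · obtain ⟨h₃, h₄, h₅, h₆⟩ := firstBelow_spec h₂
        obtain ⟨w, x, hx, hw, hq, hl, hb, he, hp⟩ := ih _ h₃
        exact ⟨w, x, hx, hw, hq, hl, hb, he, hp.tail ⟨h₄, h₅, h₆⟩⟩
      · exact absurd rfl h

theorem trace_succ_ne_zero {q : ℕ} {E : ℕ → ℕ → Prop} {r u v : ℕ} (hu : u < n)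
    (h : trace n lvl q E r u ≠ 0) (hT : ¬ Terminal n lvl q u) (hb : ¬ Branching n E u)
    (he : E u v) : trace n lvl q E (r + 1) v ≠ 0 := by
  rw [trace]
  split_ifs with h₁
  · exact h₁
  · have h₂ := firstBelow_lt (b := n) (p := fun u =>
        trace n lvl q E r u ≠ 0 ∧ ¬ Terminal n lvl q u ∧ ¬ Branching n E u ∧ E u v)
      hu ⟨h, hT, hb, he⟩
    simp only [h₂, if_true]
    exact (firstBelow_spec h₂).1

/-- Completeness of the trace: by `stable_of_le` the traced set has stabilized after `n` rounds, so
one more forced arc does not leave it. -/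
theorem trace_closed {q : ℕ} {E : ℕ → ℕ → Prop} (hE : ∀ u v, E u v → u < n ∧ v < n) {u v : ℕ}
    (h : trace n lvl q E n u ≠ 0) (hT : ¬ Terminal n lvl q u) (hb : ¬ Branching n E u)
    (he : E u v) : trace n lvl q E n v ≠ 0 := by
  refine stable_of_le (n := n) (fun r => {v | trace n lvl q E r v ≠ 0}) ?_ ?_ ?_
    (trace_succ_ne_zero (hE _ _ he).1 h hT hb he)
  · intro r
    induction r with
    | zero =>
      intro v hv
      obtain ⟨w, x, -, -, -, -, -, h₁, h₂⟩ := trace_spec 0 v hv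
      rcases ReflTransGen.cases_tail h₂ with rfl | ⟨c, -, -, -, h₃⟩
      · exact (hE _ _ h₁).2
      · exact (hE _ _ h₃).2
    | succ r ih =>
      intro v hv
      obtain ⟨w, x, -, -, -, -, -, h₁, h₂⟩ := trace_spec (r + 1) v hv
      rcases ReflTransGen.cases_tail h₂ with rfl | ⟨c, -, -, -, h₃⟩
      · exact (hE _ _ h₁).2
      · exact (hE _ _ h₃).2
  · intro r v (hv : trace n lvl q E r v ≠ 0)
    change trace n lvl q E (r + 1) v ≠ 0
    rwa [trace_of_le hv (Nat.le_succ r)]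
  · intro r hr v (hv : trace n lvl q E (r + 2) v ≠ 0)
    change trace n lvl q E (r + 1) v ≠ 0
    intro hcon
    rw [trace, if_neg (by simpa using hcon)] at hv
    simp only at hv
    split_ifs at hv with h₂
    · obtain ⟨h₃, h₄, h₅, h₆⟩ := firstBelow_spec h₂
      exact trace_succ_ne_zero h₂ (hr h₃) h₄ h₅ h₆ hcon
    · exact hv rfl

/-- The data of a search node: the vertices marked by `del` are deleted, those marked by `A` must not
reach a terminal, and the levels above `q` are finished. -/
structure Config where
  del : ℕ → ℕ
  A : ℕ → ℕ
  q : ℕ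

variable (n adj lvl)

/-- The side of the terminals in the farthest minimum separator. -/
noncomputable def Config.far (σ : Config) : Set ℕ :=
  CycleDeletion.far n (Arc n adj σ.del) (Terminal n lvl σ.q) σ.A

/-- The arcs on the side of the terminals. -/
def Config.E (σ : Config) (u v : ℕ) : Prop := Arc n adj σ.del u v ∧ v ∈ σ.far n adj lvl

/-- The forced paths from the current level. -/
noncomputable def Config.trace (σ : Config) : ℕ → ℕ :=
  CycleDeletion.trace n lvl σ.q (σ.E n adj lvl) n

/-- The vertex `v` is reached from the current level by a forced path, and shows that this level is
not finished. -/
def Config.Bad (σ : Config) (v : ℕ) : Prop :=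
  ((σ.q ≠ 0 ∧ lvl v = σ.q) ∨ σ.trace n adj lvl v ≠ 0) ∧
    (Branching n (σ.E n adj lvl) v ∨ (Terminal n lvl σ.q v ∧ lvl v < σ.q))

open Classical in
/-- One step of the search, which follows the branch `d`. -/
noncomputable def Config.step (σ : Config) (d : ℕ) : Config :=
  let E := σ.E n adj lvl
  let v := firstBelow n (σ.Bad n adj lvl)
  if v < n then
    if lvl v ≠ 0 ∧ lvl v < σ.q then
      { σ with A := Function.update σ.A (σ.trace n adj lvl v - 1) 1 }
    else if d = 0 then
      { σ with A := Function.update σ.A (firstBelow n (E v)) 1 }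
    else if d = 1 then
      { σ with A := Function.update σ.A (firstBelow n fun y => E v y ∧ y ≠ firstBelow n (E v)) 1 }
    else
      { σ with A := Function.update σ.A (σ.trace n adj lvl v - 1) 1 }
  else
    let y := firstBelow n fun u => u ∉ σ.far n adj lvl ∧ ∃ x < n, E u x
    if y < n then
      if d = 0 then { σ with del := Function.update σ.del y 1 }
      else { σ with A := Function.update σ.A (firstBelow n (E y)) 1 }
    else { σ with q := σ.q - 1 }

variable (k m : ℕ) (del₀ : ℕ → ℕ)

/-- The invariant of the search along the branches that lead to a solution: `kk` is the remaining
budget, and `μ` bounds the number of remaining steps. -/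
structure Config.Inv (σ : Config) (kk μ : ℕ) : Prop where
  good : ∃ C, Sep (Terminal n lvl σ.q) σ.A C ∧ Good lvl (Arc n adj σ.del) (Terminal n lvl σ.q) C ∧
    (boundary n (Arc n adj σ.del) C).card ≤ kk
  measure : ∀ C, Sep (Terminal n lvl σ.q) σ.A C →
    2 * kk + σ.q ≤ μ + (boundary n (Arc n adj σ.del) C).card
  card : ((Finset.range m).filter (σ.del · ≠ 0)).card + kk ≤ k
  mono : ∀ v, del₀ v ≠ 0 → σ.del v ≠ 0
  done : ∀ w v x y, w < n → σ.q < lvl w → x ≠ y → Arc n adj σ.del v x → Arc n adj σ.del v y →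
    ReflTransGen (Arc n adj σ.del) w v → ReflTransGen (Arc n adj σ.del) x w →
    ReflTransGen (Arc n adj σ.del) y w → False

variable {n adj lvl k m del₀}

theorem terminal_lt (q v : ℕ) (h : Terminal n lvl q v) : v < n := h.1

theorem Config.E_lt (σ : Config) (u v : ℕ) (h : σ.E n adj lvl u v) : u < n ∧ v < n :=
  ⟨h.1.1, h.1.2.1⟩

/-- Adding a vertex of the far side to the sources. -/
theorem Config.Inv.add_source {σ : Config} {kk μ z : ℕ} {C : Set ℕ}
    (h : σ.Inv n adj lvl k m del₀ kk (μ + 1))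
    (hB : IsFar n (Arc n adj σ.del) (Terminal n lvl σ.q) σ.A (σ.far n adj lvl))
    (hz : z ∈ σ.far n adj lvl) (hC : Sep (Terminal n lvl σ.q) σ.A C)
    (hg : Good lvl (Arc n adj σ.del) (Terminal n lvl σ.q) C)
    (hc : (boundary n (Arc n adj σ.del) C).card ≤ kk) (hzC : z ∉ C) :
    Config.Inv n adj lvl k m del₀ { σ with A := Function.update σ.A z 1 } kk μ where
  good := by
    refine ⟨C, ⟨hC.1, fun v hv => ?_⟩, hg, hc⟩
    have : v ≠ z := fun h => hzC (h ▸ hv)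
    simpa [Function.update_of_ne this] using hC.2 v hv
  measure := by
    intro C' hC'
    have hz' : z ∉ C' := fun hz' => by simpa using hC'.2 z hz'
    have hC'' : Sep (Terminal n lvl σ.q) σ.A C' := by
      refine ⟨hC'.1, fun v hv => ?_⟩
      have : v ≠ z := fun h => hz' (h ▸ hv)
      simpa [Function.update_of_ne this] using hC'.2 v hv
    have h₁ := h.measure _ hB.sep
    -- `C'` also separates the old sources. If its boundary were minimum for these, it would contain
    -- the whole far side and in particular `z`. So the minimum has gone up by at least one.
    have h₂ : ¬ (boundary n (Arc n adj σ.del) C').card ≤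
        (boundary n (Arc n adj σ.del) (σ.far n adj lvl)).card :=
      fun hle => hz' (hB.subset C' hC'' hle hz)
    simp only at h₂ ⊢
    omega
  card := h.card
  mono := h.mono
  done := h.done

theorem arc_update {del : ℕ → ℕ} {y u v : ℕ} :
    Arc n adj (Function.update del y 1) u v ↔ Arc n adj del u v ∧ u ≠ y ∧ v ≠ y := by
  simp only [Arc, Function.update_apply]
  by_cases hu : u = y <;> by_cases hv : v = y <;> simp [hu, hv]

/-- Deleting a vertex of the boundary. -/
theorem Config.Inv.delete {σ : Config} {kk μ y : ℕ} {C : Set ℕ}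
    (h : σ.Inv n adj lvl k m del₀ kk (μ + 1)) (hC : Sep (Terminal n lvl σ.q) σ.A C)
    (hg : Good lvl (Arc n adj σ.del) (Terminal n lvl σ.q) C)
    (hc : (boundary n (Arc n adj σ.del) C).card ≤ kk)
    (hy : y ∈ boundary n (Arc n adj σ.del) C) :
    Config.Inv n adj lvl k m del₀ { σ with del := Function.update σ.del y 1 } (kk - 1) μ := by
  have hsub : ∀ u v, Arc n adj (Function.update σ.del y 1) u v → Arc n adj σ.del u v :=
    fun u v h => (arc_update.mp h).1
  have hpos : 0 < kk := (Finset.card_pos.mpr ⟨y, hy⟩).trans_le hc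
  refine ⟨⟨C, hC, hg.mono_arc hsub, ?_⟩, fun C' hC' => ?_, ?_, fun v hv => ?_, ?_⟩
  · have : boundary n (Arc n adj (Function.update σ.del y 1)) C ⊆
        (boundary n (Arc n adj σ.del) C).erase y := by
      intro u hu
      simp only [mem_boundary, Finset.mem_erase] at hu ⊢
      obtain ⟨hu, hu', v, hv, huv⟩ := hu
      rw [arc_update] at huv
      exact ⟨huv.2.1, hu, hu', v, hv, huv.1⟩
    have := Finset.card_le_card this
    rw [Finset.card_erase_of_mem hy] at this
    simp only
    omega
  · have hyT : ∀ v, Terminal n lvl σ.q v → v ≠ y := fun v hv hvy =>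
      (mem_boundary.mp hy).2.1 (hvy ▸ hC.1 v hv)
    -- Without `y`, the set `C'` can be compared in the old graph, where its boundary gains at most
    -- `y`. The minimum boundary thus drops by at most one, while `2 * kk` drops by two.
    have h₁ := h.measure (C' \ {y}) ⟨fun v hv => ⟨hC'.1 v hv, hyT v hv⟩, fun v hv => hC'.2 v hv.1⟩
    have : boundary n (Arc n adj σ.del) (C' \ {y}) ⊆
        insert y (boundary n (Arc n adj (Function.update σ.del y 1)) C') := by
      intro u hu
      simp only [mem_boundary, Finset.mem_insert] at hu ⊢
      obtain ⟨hu, hu', v, hv, huv⟩ := hu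
      by_cases huy : u = y
      · exact Or.inl huy
      · exact Or.inr ⟨hu, fun h => hu' ⟨h, huy⟩, v, hv.1, arc_update.mpr ⟨huv, huy, hv.2⟩⟩
    have := (Finset.card_le_card this).trans (Finset.card_insert_le _ _)
    simp only at h₁ ⊢
    omega
  · have : (Finset.range m).filter (Function.update σ.del y 1 · ≠ 0) ⊆
        insert y ((Finset.range m).filter (σ.del · ≠ 0)) := by
      intro u hu
      simp only [Finset.mem_filter, Finset.mem_insert, Function.update_apply] at hu ⊢
      by_cases huy : u = y
      · exact Or.inl huy
      · exact Or.inr (by simpa [huy] using hu)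
    have := (Finset.card_le_card this).trans (Finset.card_insert_le _ _)
    have := h.card
    simp only at this ⊢
    omega
  · simp only [Function.update_apply]
    split_ifs
    · simp
    · exact h.mono v hv
  · intro w v x z hw hq hxz hvx hvz p₁ p₂ p₃
    exact h.done w v x z hw hq hxz (hsub _ _ hvx) (hsub _ _ hvz) (ReflTransGen.mono hsub _ _ p₁)
      (ReflTransGen.mono hsub _ _ p₂) (ReflTransGen.mono hsub _ _ p₃)

/-- Some branch keeps the invariant. -/
theorem Config.Inv.exists_step {σ : Config} {kk μ : ℕ}
    (h : σ.Inv n adj lvl k m del₀ kk (μ + 1)) (hq : σ.q ≠ 0) :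
    ∃ d < 3, ∃ kk', (σ.step n adj lvl d).Inv n adj lvl k m del₀ kk' μ := by
  obtain ⟨C₀, hC₀, hg₀, hc₀⟩ := h.good
  have hB : IsFar n (Arc n adj σ.del) (Terminal n lvl σ.q) σ.A (σ.far n adj lvl) :=
    isFar_far (terminal_lt _) hC₀
  -- From here on the unknown separator lies in the far side and each of its vertices continues to a
  -- terminal inside it.
  obtain ⟨C, hCB, hC, hg, hc, hreach⟩ := exists_good_subset hB hC₀ hg₀
  replace hc := hc.trans hc₀
  set B := σ.far n adj lvl with hBdef
  set T := Terminal n lvl σ.q with hT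
  set H := Arc n adj σ.del with hH
  have hE : ∀ u v, σ.E n adj lvl u v ↔ H u v ∧ v ∈ B := fun u v => Iff.rfl
  -- forced paths from `x ∈ C` stay in `C`
  have hforced : ∀ x v, x ∈ C → ReflTransGen (fun u u' => ¬ T u ∧ ¬ Branching n (σ.E n adj lvl) u ∧
      σ.E n adj lvl u u') x v → v ∈ C ∧ PathIn H C x v := by
    intro x v hx hp
    induction hp with
    | refl => exact ⟨hx, ReflTransGen.refl⟩
    | @tail b c _ hbc ih =>
      obtain ⟨hbT, hbr, hbc⟩ := hbc
      obtain ⟨w, hw, hp⟩ := hreach b ih.1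
      rcases ReflTransGen.cases_head hp with rfl | ⟨c', ⟨-, hc', hbc'⟩, -⟩
      · exact absurd hw hbT
      -- `b` is not a terminal, so it has a successor `c'` in `C`; both `c` and `c'` lie in the far
      -- side, and `b` does not branch there.
      · have : c = c' := by
          by_contra hne
          exact hbr ⟨c, hbc.1.2.1, c', hbc'.2.1, hbc, ⟨hbc', hCB hc'⟩, hne⟩
        subst this
        exact ⟨hc', ih.2.tail ⟨ih.1, hc', hbc'⟩⟩
  have hsource : ∀ z ∈ B, z ∉ C →
      Config.Inv n adj lvl k m del₀ { σ with A := Function.update σ.A z 1 } kk μ :=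
    fun z hz hzC => h.add_source hB hz hC hg hc hzC
  set v := firstBelow n (σ.Bad n adj lvl) with hv
  by_cases hvn : v < n
  · obtain ⟨hreached, hbad⟩ := firstBelow_spec hvn
    rw [← hv] at hreached hbad
    by_cases hlow : lvl v ≠ 0 ∧ lvl v < σ.q
    -- No choice is needed here: if the first vertex `x` of the forced path were in `C`, the path
    -- would lead inside `C` from level `σ.q` down to the level of `v`, against `Good.mono`.
    · refine ⟨0, by omega, kk, ?_⟩
      have hne : σ.trace n adj lvl v ≠ 0 := hreached.resolve_left fun h' => by omega
      obtain ⟨w, x, hx, hw, -, hl, hb, he, hp⟩ := trace_spec n v hne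
      have hstep : σ.step n adj lvl 0 = { σ with A := Function.update σ.A x 1 } := by
        have : σ.trace n adj lvl v - 1 = x := by
          change CycleDeletion.trace n lvl σ.q (σ.E n adj lvl) n v - 1 = x
          omega
        simp only [Config.step, ← hv, hvn, if_true, if_pos hlow, this]
      rw [hstep]
      refine hsource x he.2 fun hxC => ?_
      obtain ⟨hvC, hpath⟩ := hforced x v hxC hp
      have hwT : T w := ⟨hw, by omega, by omega⟩
      have := hg.mono w v hwT ⟨hvn, hlow.1, by omega⟩
        (ReflTransGen.head ⟨hC.1 w hwT, hxC, he.1⟩ hpath)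
      omega
    · have hbr : Branching n (σ.E n adj lvl) v :=
        hbad.resolve_right fun h' => hlow ⟨h'.1.2.1, h'.2⟩
      set x := firstBelow n (σ.E n adj lvl v) with hx
      set y := firstBelow n (fun y => σ.E n adj lvl v y ∧ y ≠ x) with hy
      obtain ⟨x', hx', y', hy', hvx', hvy', hxy'⟩ := hbr
      have hvx : σ.E n adj lvl v x := firstBelow_spec (firstBelow_lt hx' hvx')
      have hvy : σ.E n adj lvl v y ∧ y ≠ x := by
        by_cases hxx : x' = x
        · exact firstBelow_spec (firstBelow_lt (p := fun y => σ.E n adj lvl v y ∧ y ≠ x) hy'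
            ⟨hvy', fun h => hxy' (hxx.trans h.symm)⟩)
        · exact firstBelow_spec (firstBelow_lt (p := fun y => σ.E n adj lvl v y ∧ y ≠ x) hx'
            ⟨hvx', hxx⟩)
      -- not both `x` and `y` can be kept if `v` is reached
      have hkey : ∀ w, w < n → lvl w = σ.q → v ∈ C → PathIn H C w v → x ∈ C → y ∈ C → False := by
        intro w hw hl hvC hp hxC hyC
        obtain ⟨w₁, hw₁, p₁⟩ := hreach x hxC
        obtain ⟨w₂, hw₂, p₂⟩ := hreach y hyC
        exact hg.unique w v x y w₁ w₂ ⟨hw, by omega, by omega⟩ hw₁ hw₂ (hl ▸ hw₁.2.2)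
          (hl ▸ hw₂.2.2) hvy.2.symm hvC hxC hyC hvx.1 hvy.1.1 hp p₁ p₂
      have hstep₀ : σ.step n adj lvl 0 = { σ with A := Function.update σ.A x 1 } := by
        simp only [Config.step, ← hv, hvn, if_true, if_neg hlow, ← hx]
      have hstep₁ : σ.step n adj lvl 1 = { σ with A := Function.update σ.A y 1 } := by
        simp only [Config.step, ← hv, hvn, if_true, if_neg hlow, ← hx, ← hy, if_neg one_ne_zero]
      by_cases hxC : x ∈ C
      swap
      · exact ⟨0, by omega, kk, hstep₀ ▸ hsource x hvx.2 hxC⟩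
      by_cases hyC : y ∈ C
      swap
      · exact ⟨1, by omega, kk, hstep₁ ▸ hsource y hvy.1.2 hyC⟩
      -- With `x` and `y` both kept, `v` must not be reached inside `C` from level `σ.q`. A vertex
      -- of that level is in `C` itself, which is absurd; otherwise the first vertex `z` of the
      -- forced path has to be outside `C`.
      rcases hreached with hl | hne
      · exact (hkey v hvn hl.2 (hC.1 v ⟨hvn, by omega, by omega⟩) ReflTransGen.refl hxC hyC).elim
      · obtain ⟨w, z, hz, hw, -, hl, hb, he, hp⟩ := trace_spec n v hne
        have hstep₂ : σ.step n adj lvl 2 = { σ with A := Function.update σ.A z 1 } := by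
          have : σ.trace n adj lvl v - 1 = z := by
            change CycleDeletion.trace n lvl σ.q (σ.E n adj lvl) n v - 1 = z
            omega
          simp only [Config.step, ← hv, hvn, if_true, if_neg hlow, this, if_neg two_ne_zero,
            show ¬ (2 = 1) by omega, if_false]
        refine ⟨2, by omega, kk, hstep₂ ▸ hsource z he.2 fun hzC => ?_⟩
        obtain ⟨hvC, hpath⟩ := hforced z v hzC hp
        exact hkey w hw hl hvC (ReflTransGen.head ⟨hC.1 w ⟨hw, by omega, by omega⟩, hzC, he.1⟩ hpath)
          hxC hyC
  · have hnobad : ∀ u < n, ¬ σ.Bad n adj lvl u := fun u hu hb => hvn (firstBelow_lt hu hb)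
    set y := firstBelow n (fun u => u ∉ B ∧ ∃ x < n, σ.E n adj lvl u x) with hy
    by_cases hyn : y < n
    · obtain ⟨hyB, x', hx', hyx'⟩ := firstBelow_spec hyn
      rw [← hy] at hyx' hyB
      have hyx := firstBelow_spec (firstBelow_lt hx' hyx')
      set x := firstBelow n (σ.E n adj lvl y) with hx
      have hstep₀ : σ.step n adj lvl 0 = { σ with del := Function.update σ.del y 1 } := by
        simp only [Config.step, ← hv, if_neg hvn, ← hBdef, ← hy, hyn, if_true]
      have hstep₁ : σ.step n adj lvl 1 = { σ with A := Function.update σ.A x 1 } := by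
        simp only [Config.step, ← hv, if_neg hvn, ← hBdef, ← hy, hyn, if_true, ← hx,
          if_neg one_ne_zero]
      -- If `x` is kept, then `y`, which lies outside the far side and hence outside `C`, is a
      -- boundary vertex of `C` and belongs to the solution.
      by_cases hxC : x ∈ C
      · refine ⟨0, by omega, kk - 1, hstep₀ ▸ h.delete hC hg hc ?_⟩
        exact mem_boundary.mpr ⟨hyn, fun hyC => hyB (hCB hyC), x, hxC, hyx.1⟩
      · exact ⟨1, by omega, kk, hstep₁ ▸ hsource x hyx.2 hxC⟩
    · have hstep : σ.step n adj lvl 0 = { σ with q := σ.q - 1 } := by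
        simp only [Config.step, ← hv, if_neg hvn, ← hBdef, ← hy, if_neg hyn]
      -- No arc enters the far side any more. So the strong components of its terminals lie inside
      -- it, and its boundary is empty, which lets the measure pay for lowering `σ.q`.
      have hclosed : ∀ u v, H u v → v ∈ B → u ∈ B := by
        intro u v huv hvB
        by_contra huB
        exact hyn (firstBelow_lt huv.1 ⟨huB, v, huv.2.1, huv, hvB⟩)
      have hmono : ∀ v, Terminal n lvl (σ.q - 1) v → T v :=
        fun v hv => ⟨hv.1, hv.2.1, hv.2.2.trans (Nat.sub_le _ _)⟩
      have hempty : (boundary n H B).card = 0 := by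
        rw [Finset.card_eq_zero, Finset.eq_empty_iff_forall_notMem]
        intro u hu
        obtain ⟨-, hu', v, hv, huv⟩ := mem_boundary.mp hu
        exact hu' (hclosed u v huv hv)
      refine ⟨0, by omega, kk, ?_⟩
      rw [hstep]
      refine ⟨⟨C, ⟨fun v hv => hC.1 v (hmono v hv), hC.2⟩, hg.mono_terminal hmono, hc⟩,
        fun C' hC' => ?_, h.card, h.mono, ?_⟩
      · have := h.measure B hB.sep
        rw [← hH] at this
        simp only
        omega
      · intro w v x z hw hwq hxz hvx hvz p₁ p₂ p₃
        rcases Nat.lt_or_ge σ.q (lvl w) with hlt | hge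
        · exact h.done w v x z hw hlt hxz hvx hvz p₁ p₂ p₃
        · simp only at hwq
          have hlw : lvl w = σ.q := by omega
          have hwB : w ∈ B := hB.sep.1 w ⟨hw, by omega, hge⟩
          have hback : ∀ a b, ReflTransGen H a b → b ∈ B → a ∈ B := by
            intro a b hp hb
            induction hp using ReflTransGen.head_induction_on with
            | refl => exact hb
            | head h₁ _ ih => exact hclosed _ _ h₁ ih
          have hxB := hback x w p₂ hwB
          have hzB := hback z w p₃ hwB
          -- Since nothing is bad, every vertex before `v` on the path from `w` is nonbranching and
          -- no terminal of lower level. Hence the path is forced from its last vertex of level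
          -- `σ.q` on, and `v` is traced.
          have hreached : (σ.q ≠ 0 ∧ lvl v = σ.q) ∨ σ.trace n adj lvl v ≠ 0 := by
            have hvB : v ∈ B := hclosed v x hvx hxB
            clear hvx hvz
            induction p₁ with
            | refl => exact Or.inl ⟨hq, hlw⟩
            | @tail b c _ hbc ih =>
              have hE' : σ.E n adj lvl b c := ⟨hbc, hvB⟩
              have ihb := ih (hclosed b c hbc hvB)
              have hnb := hnobad b hbc.1
              have hnbr : ¬ Branching n (σ.E n adj lvl) b := fun hbr => hnb ⟨ihb, Or.inl hbr⟩
              have hnlow : ¬ (T b ∧ lvl b < σ.q) := fun hbr => hnb ⟨ihb, Or.inr hbr⟩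
              by_cases hbq : lvl b = σ.q
              · right
                have h₀ : CycleDeletion.trace n lvl σ.q (σ.E n adj lvl) 0 c ≠ 0 := by
                  rw [CycleDeletion.trace, if_pos ⟨b, hbc.1, hq, hbq, hnbr, hE'⟩]
                  omega
                change CycleDeletion.trace n lvl σ.q (σ.E n adj lvl) n c ≠ 0
                rwa [trace_of_le h₀ (Nat.zero_le n)]
              · have hbT : ¬ T b := by
                  intro hbT
                  exact hnlow ⟨hbT, lt_of_le_of_ne hbT.2.2 hbq⟩
                exact Or.inr (trace_closed (σ.E_lt) (ihb.resolve_left fun h' => hbq h'.2) hbT hnbr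
                  hE')
          exact hnobad v hvx.1 ⟨hreached, Or.inl ⟨x, hvx.2.1, z, hvz.2.1, ⟨hvx, hxB⟩, ⟨hvz, hzB⟩,
            hxz⟩⟩

/-- With `μ = 0` the measure gives `2 * kk + σ.q ≤ kk` on the good separator. -/
theorem Config.Inv.q_eq_zero {σ : Config} {kk : ℕ} (h : σ.Inv n adj lvl k m del₀ kk 0) :
    σ.q = 0 := by
  obtain ⟨C, hC, -, hc⟩ := h.good
  have := h.measure C hC
  omega

/-- Without terminals the far side is empty, so nothing is bad, there is no boundary, and the
truncated `σ.q - 1` is zero again. A finished search idles, and all searches can be run for the same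
number of steps. -/
theorem Config.step_of_q_eq_zero {σ : Config} (hσ : σ.q = 0) (d : ℕ) :
    σ.step n adj lvl d = σ := by
  have hT : ∀ v, ¬ Terminal n lvl σ.q v := fun v hv => by
    have := hv.2
    omega
  have hS : Sep (Terminal n lvl σ.q) σ.A (∅ : Set ℕ) :=
    ⟨fun v hv => (hT v hv).elim, fun v hv => hv.elim⟩
  have hB : IsFar n (Arc n adj σ.del) (Terminal n lvl σ.q) σ.A (σ.far n adj lvl) :=
    isFar_far (terminal_lt _) hS
  have hfar : ∀ v, v ∉ σ.far n adj lvl := by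
    intro v hv
    refine hB.subset ∅ hS ?_ hv
    simp [boundary]
  have h₁ : ¬ firstBelow n (σ.Bad n adj lvl) < n := by
    intro hlt
    rcases (firstBelow_spec hlt).2 with ⟨x, -, y, -, hx, -⟩ | hb
    · exact hfar _ hx.2
    · exact hT _ hb.1
  have h₂ : ¬ firstBelow n (fun u => u ∉ σ.far n adj lvl ∧ ∃ x < n, σ.E n adj lvl u x) < n := by
    intro hlt
    obtain ⟨-, x, -, hx⟩ := firstBelow_spec hlt
    exact hfar _ hx.2
  simp only [Config.step, if_neg h₁, if_neg h₂]
  cases σ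
  simp_all

variable (n adj lvl) in
/-- The search, directed by the digits of a number in base `b`. -/
noncomputable def Config.run (b : ℕ) (σ : Config) : ℕ → ℕ → Config
  | 0, _ => σ
  | j + 1, r => Config.run b (σ.step n adj lvl (r % b)) j (r / b)

variable (n adj lvl) in
/-- All nodes visited by the search have a separator with a boundary of size at most `k`. -/
def Config.Feasible (k : ℕ) (σ : Config) : Prop :=
  ∃ C, Sep (Terminal n lvl σ.q) σ.A C ∧ (boundary n (Arc n adj σ.del) C).card ≤ k

theorem Config.Inv.feasible {σ : Config} {kk μ : ℕ} (h : σ.Inv n adj lvl k m del₀ kk μ) :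
    σ.Feasible n adj lvl k := by
  obtain ⟨C, hC, -, hc⟩ := h.good
  have := h.card
  exact ⟨C, hC, by omega⟩

/-- The digits of `r` record the branches supplied by `exists_step`. Feasibility along the way is
what the machine needs to compute the far side correctly. The base is only required to be at least
3, so that branches can share a base with the levels. -/
theorem Config.Inv.exists_run {b : ℕ} (hb : 3 ≤ b) {σ : Config} {kk μ : ℕ}
    (h : σ.Inv n adj lvl k m del₀ kk μ) :
    ∃ r < b ^ μ, (∀ j ≤ μ, (σ.run n adj lvl b j r).Feasible n adj lvl k) ∧
      ∃ kk' μ', (σ.run n adj lvl b μ r).q = 0 ∧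
        (σ.run n adj lvl b μ r).Inv n adj lvl k m del₀ kk' μ' := by
  have hzero : ∀ (j r : ℕ) (σ : Config), σ.q = 0 → σ.run n adj lvl b j r = σ := by
    intro j
    induction j with
    | zero => intro r σ _; rfl
    | succ j ih => intro r σ hσ; rw [Config.run, Config.step_of_q_eq_zero hσ, ih _ _ hσ]
  induction μ generalizing σ kk with
  | zero =>
    refine ⟨0, by simp, fun j hj => ?_, kk, 0, h.q_eq_zero, h⟩
    rw [Nat.le_zero.mp hj]
    exact h.feasible
  | succ μ ih =>
    by_cases hq : σ.q = 0
    · refine ⟨0, by positivity, fun j _ => ?_, kk, μ + 1, ?_, ?_⟩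
      · rw [hzero _ _ _ hq]; exact h.feasible
      · rw [hzero _ _ _ hq]; exact hq
      · rw [hzero _ _ _ hq]; exact h
    · obtain ⟨d, hd, kk', h'⟩ := h.exists_step hq
      obtain ⟨r, hr, hf, kk'', μ', h₁, h₂⟩ := ih h'
      have hdiv : (d + b * r) / b = r := by
        rw [Nat.add_mul_div_left _ _ (by omega), Nat.div_eq_of_lt (by omega), zero_add]
      have hmod : (d + b * r) % b = d := by
        rw [Nat.add_mul_mod_self_left, Nat.mod_eq_of_lt (by omega)]
      refine ⟨d + b * r, ?_, fun j hj => ?_, kk'', μ', ?_, ?_⟩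
      · rw [mul_comm b r, pow_succ]
        calc d + r * b < b + r * b := by omega
          _ = (r + 1) * b := by ring
          _ ≤ b ^ μ * b := Nat.mul_le_mul_right _ hr
      · cases j with
        | zero => exact h.feasible
        | succ j => rw [Config.run, hmod, hdiv]; exact hf j (by omega)
      · rw [Config.run, hmod, hdiv]; exact h₁
      · rw [Config.run, hmod, hdiv]; exact h₂

end Step

end CycleDeletion

/-! ### Solutions, guessed levels, and the link to strong components. -/

namespace CycleDeletion

open Relation

variable {n : ℕ} {adj : ℕ → ℕ → Prop}

variable (n adj) in
/-- In `D - X`, where `X` is marked by `del`, no vertex has two successors in its strong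
component. -/
def Sol (del : ℕ → ℕ) : Prop :=
  ∀ v x y, x ≠ y → Arc n adj del v x → Arc n adj del v y →
    ReflTransGen (Arc n adj del) x v → ReflTransGen (Arc n adj del) y v → False

theorem arc_mono {del del' : ℕ → ℕ} (h : ∀ v < n, del v ≠ 0 → del' v ≠ 0) (u v : ℕ)
    (ha : Arc n adj del' u v) : Arc n adj del u v :=
  ⟨ha.1, ha.2.1, ha.2.2.1, by_contra fun hu => h u ha.1 hu ha.2.2.2.1,
    by_contra fun hv => h v ha.2.1 hv ha.2.2.2.2⟩

theorem Sol.mono {del del' : ℕ → ℕ} (h : ∀ v < n, del v ≠ 0 → del' v ≠ 0) (hs : Sol n adj del) :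
    Sol n adj del' := fun v x y hxy hvx hvy p₁ p₂ =>
  hs v x y hxy (arc_mono h _ _ hvx) (arc_mono h _ _ hvy) (ReflTransGen.mono (arc_mono h) _ _ p₁)
    (ReflTransGen.mono (arc_mono h) _ _ p₂)

/-- A finite preordered set has a numbering that is monotone and separates its classes. -/
theorem exists_numbering {α : Type*} (R : α → α → Prop) (hrefl : ∀ a, R a a)
    (htrans : ∀ a b c, R a b → R b c → R a c) (S : Finset α) :
    ∃ f : α → ℕ, (∀ a ∈ S, 1 ≤ f a ∧ f a ≤ S.card) ∧
      (∀ a ∈ S, ∀ b ∈ S, R a b → f a ≤ f b) ∧ ∀ a ∈ S, ∀ b ∈ S, f a = f b → R a b := by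
  classical
  induction S using Finset.strongInduction with
  | H S ih =>
    rcases S.eq_empty_or_nonempty with rfl | hne
    · exact ⟨fun _ => 0, by simp, by simp, by simp⟩
    -- Having the fewest elements above it, `a₀` lies in a maximal class. This class gets the top
    -- number, one more than the number of remaining elements, and these are numbered by induction.
    · obtain ⟨a₀, ha₀, hmin⟩ := S.exists_min_image (fun a => (S.filter (R a)).card) hne
      have hback : ∀ b ∈ S, R a₀ b → R b a₀ := by
        intro b hb hab
        have hsub : S.filter (R b) ⊆ S.filter (R a₀) := by
          intro c hc
          rw [Finset.mem_filter] at hc ⊢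
          exact ⟨hc.1, htrans _ _ _ hab hc.2⟩
        have := Finset.eq_of_subset_of_card_le hsub (hmin b hb)
        have h' : a₀ ∈ S.filter (R b) := by rw [this]; simp [ha₀, hrefl]
        exact (Finset.mem_filter.mp h').2
      have hss : S.filter (fun b => ¬ R a₀ b) ⊂ S := by
        rw [Finset.filter_ssubset]
        exact ⟨a₀, ha₀, by simp [hrefl]⟩
      obtain ⟨f, hf₁, hf₂, hf₃⟩ := ih _ hss
      have hlt := Finset.card_lt_card hss
      set m := (S.filter (fun b => ¬ R a₀ b)).card
      refine ⟨fun b => if R a₀ b then m + 1 else f b, fun a ha => ?_, fun a ha b hb hab => ?_,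
        fun a ha b hb hab => ?_⟩
      · by_cases h : R a₀ a
        · simp only [if_pos h]; omega
        · have := hf₁ a (by simp [ha, h])
          simp only [if_neg h]; omega
      · by_cases h : R a₀ a
        · simp [h, htrans _ _ _ h hab]
        · by_cases h' : R a₀ b
          · have := hf₁ a (by simp [ha, h])
            simp only [if_neg h, if_pos h']; omega
          · simp only [if_neg h, if_neg h']
            exact hf₂ a (by simp [ha, h]) b (by simp [hb, h']) hab
      · by_cases h : R a₀ a
        · by_cases h' : R a₀ b
          · exact htrans _ _ _ (hback a ha h) h'
          · have := hf₁ b (by simp [hb, h'])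
            simp only [if_pos h, if_neg h'] at hab
            omega
        · by_cases h' : R a₀ b
          · have := hf₁ a (by simp [ha, h])
            simp only [if_pos h', if_neg h] at hab
            omega
          · simp only [if_neg h, if_neg h'] at hab
            exact hf₃ a (by simp [ha, h]) b (by simp [hb, h']) hab

/-- If the graph induced by the first `m` vertices has a solution `Y`, then the invariant holds for a
suitable choice of levels on the vertices marked by `W`. -/
theorem exists_levels {k m : ℕ} {W Y : ℕ → ℕ} (hm : m ≤ n)
    (hW : ((Finset.range m).filter (W · ≠ 0)).card ≤ k + 1)
    (hY : Sol n adj fun v => if v < m then Y v else 1)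
    (hYk : ((Finset.range m).filter (Y · ≠ 0)).card ≤ k) :
    ∃ f : ℕ → ℕ, (∀ v, f v ≤ k + 1) ∧ (∀ v, W v = 0 → f v = 0) ∧ ∀ lvl del A : ℕ → ℕ,
      (∀ v < n, lvl v = f v) →
      (∀ v < n, del v ≠ 0 ↔ m ≤ v ∨ (W v ≠ 0 ∧ lvl v = 0)) → (∀ v < n, A v = 0) →
      ∃ kk, Config.Inv n adj lvl k m del ⟨del, A, k + 1⟩ kk (3 * k + 1) := by
  classical
  set delY : ℕ → ℕ := fun v => if v < m then Y v else 1 with hdelY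
  set S := (Finset.range m).filter (fun v => W v ≠ 0 ∧ Y v = 0) with hS
  have hScard : S.card ≤ k + 1 := by
    refine (Finset.card_le_card fun v => ?_).trans hW
    simp only [hS, Finset.mem_filter]
    tauto
  obtain ⟨g, hg₁, hg₂, hg₃⟩ := exists_numbering (ReflTransGen (Arc n adj delY))
    (fun _ => ReflTransGen.refl) (fun _ _ _ => ReflTransGen.trans) S
  refine ⟨fun v => if v ∈ S then g v else 0, fun v => ?_, fun v hv => ?_, ?_⟩
  · simp only
    split_ifs with h
    · have := hg₁ v h
      omega
    · omega
  · simp [hS, hv]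
  intro lvl del A hlvl hdel hA
  simp only at hlvl
  have hlvlS : ∀ v < n, lvl v ≠ 0 ↔ v ∈ S := by
    intro v hv
    rw [hlvl v hv]
    split_ifs with h
    · have := hg₁ v h
      simp only [h, iff_true]
      omega
    · simp [h]
  have hlvlg : ∀ v < n, v ∈ S → lvl v = g v := fun v hv h => by rw [hlvl v hv, if_pos h]
  have hTS : ∀ v, Terminal n lvl (k + 1) v ↔ v ∈ S := by
    intro v
    constructor
    · exact fun h => (hlvlS v h.1).mp h.2.1
    · intro h
      have hvn : v < n := by
        have := (Finset.mem_filter.mp h).1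
        rw [Finset.mem_range] at this
        omega
      have := hg₁ v h
      exact ⟨hvn, (hlvlS v hvn).mpr h, by rw [hlvlg v hvn h]; omega⟩
  -- The good separator: everything that still reaches a kept vertex of `W` once the solution is
  -- removed.
  set C : Set ℕ := {v | v < n ∧ delY v = 0 ∧ ∃ w, w ∈ S ∧ ReflTransGen (Arc n adj delY) v w}
    with hC
  have hSC : ∀ v ∈ S, v ∈ C := by
    intro v hv
    have := Finset.mem_filter.mp hv
    rw [Finset.mem_range] at this
    exact ⟨by omega, by simp [hdelY, this], v, hv, ReflTransGen.refl⟩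
  have hpath : ∀ u v, PathIn (Arc n adj del) C u v → ReflTransGen (Arc n adj delY) u v :=
    fun u v => ReflTransGen.mono (fun a b h =>
      ⟨h.1.1, h.2.1.1, h.2.2.2.2.1, h.1.2.1, h.2.1.2.1⟩) u v
  have hmonoS : ∀ w ∈ S, ∀ w' ∈ S, ReflTransGen (Arc n adj delY) w w' → lvl w ≤ lvl w' := by
    intro w hw w' hw' hp
    rw [hlvlg w (hSC w hw).1 hw, hlvlg w' (hSC w' hw').1 hw']
    exact hg₂ w hw w' hw' hp
  have hbudget : ((Finset.range m).filter (fun v => Y v ≠ 0 ∧ W v = 0)).card ≤ k :=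
    (Finset.card_le_card fun v => by simp only [Finset.mem_filter]; tauto).trans hYk
  refine ⟨((Finset.range m).filter (fun v => Y v ≠ 0 ∧ W v = 0)).card, ⟨C, ⟨?_, ?_⟩, ⟨?_, ?_⟩, ?_⟩,
    ?_, ?_, fun v hv => hv, ?_⟩
  · exact fun v hv => hSC v ((hTS v).mp hv)
  · exact fun v hv => hA v hv.1
  · exact fun w w' hw hw' hp =>
      hmonoS w ((hTS w).mp hw) w' ((hTS w').mp hw') (hpath w w' hp)
  · intro w v x y w₁ w₂ hw h₁ h₂ hl₁ hl₂ hxy hv hx hy hvx hvy p₁ p₂ p₃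
    have hvx' : Arc n adj delY v x := ⟨hv.1, hx.1, hvx.2.2.1, hv.2.1, hx.2.1⟩
    have hvy' : Arc n adj delY v y := ⟨hv.1, hy.1, hvy.2.2.1, hv.2.1, hy.2.1⟩
    replace p₁ := hpath _ _ p₁
    -- The path from `w` through `v` and `x` to `w₁` cannot descend, so the two levels are equal.
    -- Hence `w₁` reaches `w`, and `x` returns to `v`.
    have hkey : ∀ x w₁, Terminal n lvl (k + 1) w₁ → lvl w₁ ≤ lvl w → Arc n adj delY v x →
        ReflTransGen (Arc n adj delY) x w₁ → ReflTransGen (Arc n adj delY) x v := by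
      intro x w₁ h₁ hl₁ hvx p₂
      have hwS := (hTS _).mp hw
      have hwS₁ := (hTS _).mp h₁
      have h₃ := hmonoS w hwS w₁ hwS₁ ((p₁.tail hvx).trans p₂)
      have h₄ := hg₃ w₁ hwS₁ w hwS (by
        rw [← hlvlg _ h₁.1 hwS₁, ← hlvlg _ hw.1 hwS]; omega)
      exact (p₂.trans h₄).trans p₁
    exact hY v x y hxy hvx' hvy' (hkey x w₁ h₁ hl₁ hvx' (hpath _ _ p₂))
      (hkey y w₂ h₂ hl₂ hvy' (hpath _ _ p₃))
  -- A boundary vertex outside `Y` would itself reach a terminal and belong to `C`. One in both `Y`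
  -- and `W` has level 0 and is already deleted.
  · refine Finset.card_le_card fun u hu => ?_
    obtain ⟨hun, huC, v, hvC, huv⟩ := mem_boundary.mp hu
    have hdu : ¬ (m ≤ u ∨ (W u ≠ 0 ∧ lvl u = 0)) := by
      rw [← hdel u hun]
      simpa using huv.2.2.2.1
    push Not at hdu
    have hYu : Y u ≠ 0 := by
      intro hYu
      have hu0 : delY u = 0 := by simp [hdelY, hdu.1, hYu]
      obtain ⟨hvn, hv0, w, hw, hp⟩ := hvC
      exact huC ⟨hun, hu0, w, hw, ReflTransGen.head ⟨hun, hvn, huv.2.2.1, hu0, hv0⟩ hp⟩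
    simp only [Finset.mem_filter, Finset.mem_range]
    refine ⟨hdu.1, hYu, ?_⟩
    by_contra hWu
    have := (hlvlS u hun).mp (hdu.2 hWu)
    exact hYu (Finset.mem_filter.mp this).2.2
  -- The budget is at most `k` and the starting level is `k + 1`; this is the origin of `3 * k + 1`.
  · intro C' _
    simp only
    omega
  -- The vertices deleted at the start lie in both `Y` and `W`, and the budget counts the rest of
  -- `Y`.
  · have : (Finset.range m).filter (del · ≠ 0) ⊆
        (Finset.range m).filter (fun v => Y v ≠ 0 ∧ W v ≠ 0) := by
      intro v hv
      simp only [Finset.mem_filter, Finset.mem_range] at hv ⊢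
      have hvn : v < n := by omega
      obtain ⟨hWv, hl⟩ := ((hdel v hvn).mp hv.2).resolve_left (by omega)
      refine ⟨hv.1, fun hYv => ?_, hWv⟩
      exact (hlvlS v hvn).mpr (by simp [hS, hv.1, hWv, hYv]) hl
    have h₁ := Finset.card_le_card this
    have h₂ := Finset.card_filter_add_card_filter_not (s := (Finset.range m).filter (Y · ≠ 0))
      (fun v => W v ≠ 0)
    simp only [Finset.filter_filter, not_not] at h₂
    simp only
    omega
  -- No level exceeds `k + 1`, so nothing is claimed yet.
  · intro w v x y hw hlt
    exfalso
    simp only at hlt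
    rw [hlvl w hw] at hlt
    split_ifs at hlt with h
    · have := hg₁ w h
      omega
    · omega

/-- At the end of a successful search the deleted vertices form a solution. -/
theorem Config.Inv.sol {lvl W del₀ : ℕ → ℕ} {k m kk μ : ℕ} {σ : Config}
    (h : σ.Inv n adj lvl k m del₀ kk μ) (hq : σ.q = 0)
    (hdel : ∀ v < n, del₀ v ≠ 0 ↔ m ≤ v ∨ (W v ≠ 0 ∧ lvl v = 0))
    (hW : Sol n adj fun v => if v < m then W v else 1) : Sol n adj σ.del := by
  intro v x y hxy hvx hvy p₁ p₂
  -- If the component of `v` contains a vertex of positive level, it has been finished by the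
  -- search. Otherwise it avoids `W` entirely, and already `W` is a solution there.
  by_cases hscc : ∃ w < n, lvl w ≠ 0 ∧ ReflTransGen (Arc n adj σ.del) w v ∧
      ReflTransGen (Arc n adj σ.del) v w
  · obtain ⟨w, hw, hl, p₃, p₄⟩ := hscc
    exact h.done w v x y hw (by omega) hxy hvx hvy p₃ (p₁.trans p₄) (p₂.trans p₄)
  · have harc : ∀ a b, Arc n adj σ.del a b → ReflTransGen (Arc n adj σ.del) v a →
        ReflTransGen (Arc n adj σ.del) b v → Arc n adj (fun v => if v < m then W v else 1) a b := by
      have hmem : ∀ a < n, σ.del a = 0 → ReflTransGen (Arc n adj σ.del) v a →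
          ReflTransGen (Arc n adj σ.del) a v → (if a < m then W a else 1) = 0 := by
        intro a han ha p₃ p₄
        have hd : ¬ (m ≤ a ∨ (W a ≠ 0 ∧ lvl a = 0)) := by
          rw [← hdel a han]
          exact fun h' => h.mono a h' ha
        push Not at hd
        rw [if_pos hd.1]
        by_contra hWa
        exact hscc ⟨a, han, hd.2 hWa, p₄, p₃⟩
      intro a b hab p₃ p₄
      exact ⟨hab.1, hab.2.1, hab.2.2.1, hmem a hab.1 hab.2.2.2.1 p₃ (p₄.head hab),
        hmem b hab.2.1 hab.2.2.2.2 (p₃.tail hab) p₄⟩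
    have hpath : ∀ x, ReflTransGen (Arc n adj σ.del) x v → ReflTransGen (Arc n adj σ.del) v x →
        ReflTransGen (Arc n adj (fun v => if v < m then W v else 1)) x v := by
      intro x hp hvx
      induction hp using ReflTransGen.head_induction_on with
      | refl => exact ReflTransGen.refl
      | head hab hbv ih => exact ReflTransGen.head (harc _ _ hab hvx hbv) (ih (hvx.tail hab))
    exact hW v x y hxy (harc v x hvx ReflTransGen.refl p₁) (harc v y hvy ReflTransGen.refl p₂)
      (hpath x p₁ (ReflTransGen.single hvx)) (hpath y p₂ (ReflTransGen.single hvy))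

/-- The adjacency relation of a digraph on `Fin n`, as a relation between natural numbers. -/
def natAdj (D : Digraph (Fin n)) (u v : ℕ) : Prop := ∃ i j : Fin n, D.Adj i j ∧ i = u ∧ j = v

theorem natAdj_coe {D : Digraph (Fin n)} {i j : Fin n} : natAdj D i j ↔ D.Adj i j := by
  constructor
  · rintro ⟨i', j', h, hi, hj⟩
    rwa [Fin.ext hi, Fin.ext hj] at h
  · exact fun h => ⟨i, j, h, rfl, rfl⟩

theorem hasPath_deleteVertices {D : Digraph (Fin n)} {X : Set (Fin n)} {del : ℕ → ℕ}
    (hX : ∀ v : Fin n, v ∈ X ↔ del v ≠ 0) (u v : (Xᶜ : Set (Fin n))) :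
    (D.deleteVertices X).HasPath u v ↔
      ReflTransGen (Arc n (natAdj D) del) (u : Fin n) (v : Fin n) := by
  have h0 : ∀ w : (Xᶜ : Set (Fin n)), del (w : Fin n) = 0 := fun w => by
    by_contra h
    exact w.2 ((hX w).mpr h)
  constructor
  · intro h
    induction h with
    | refl => exact ReflTransGen.refl
    | tail _ hbc ih =>
      exact ih.tail ⟨Fin.is_lt _, Fin.is_lt _, natAdj_coe.mpr hbc, h0 _, h0 _⟩
  · intro h
    have key : ∀ a : ℕ, ReflTransGen (Arc n (natAdj D) del) (u : Fin n) a →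
        ∀ w : (Xᶜ : Set (Fin n)), ((w : Fin n) : ℕ) = a → (D.deleteVertices X).HasPath u w := by
      intro a ha
      induction ha with
      | refl =>
        intro w hw
        rw [Subtype.ext (Fin.ext hw)]
        exact ReflTransGen.refl
      | @tail b c _ hbc ih =>
        intro w hw
        obtain ⟨hb, hc, hadj, hb0, hc0⟩ := hbc
        have hbX : (⟨b, hb⟩ : Fin n) ∈ Xᶜ := fun h => (hX _).mp h hb0
        refine (ih ⟨⟨b, hb⟩, hbX⟩ rfl).tail ?_
        subst hw
        exact natAdj_coe.mp hadj
    exact key _ h v rfl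

/-- Inside a nontrivial strong component each vertex has at least one successor, the second vertex
of a path to some other member, so only uniqueness is a condition. Looplessness makes the component
of a vertex with a returning successor nontrivial. -/
theorem isOneOutRegularDeletionSet_iff {D : Digraph (Fin n)} (hD : ∀ v, ¬ D.Adj v v)
    {X : Set (Fin n)} {del : ℕ → ℕ} (hX : ∀ v : Fin n, v ∈ X ↔ del v ≠ 0) :
    D.IsOneOutRegularDeletionSet X ↔ Sol n (natAdj D) del := by
  have hpath := hasPath_deleteVertices (D := D) hX
  constructor
  · intro h v x y hxy hvx hvy p₁ p₂
    have hmem : ∀ a (ha : a < n), del a = 0 → (⟨a, ha⟩ : Fin n) ∈ Xᶜ :=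
      fun a ha h0 h => (hX _).mp h h0
    set v' : (Xᶜ : Set (Fin n)) := ⟨⟨v, hvx.1⟩, hmem v hvx.1 hvx.2.2.2.1⟩ with hv'
    set x' : (Xᶜ : Set (Fin n)) := ⟨⟨x, hvx.2.1⟩, hmem x hvx.2.1 hvx.2.2.2.2⟩ with hx'
    set y' : (Xᶜ : Set (Fin n)) := ⟨⟨y, hvy.2.1⟩, hmem y hvy.2.1 hvy.2.2.2.2⟩ with hy'
    have hvx' : (D.deleteVertices X).Adj v' x' := natAdj_coe.mp hvx.2.2.1
    have hvy' : (D.deleteVertices X).Adj v' y' := natAdj_coe.mp hvy.2.2.1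
    set S : Set (Xᶜ : Set (Fin n)) := {u | (D.deleteVertices X).HasPath v' u ∧
      (D.deleteVertices X).HasPath u v'} with hS
    have hvS : v' ∈ S := ⟨ReflTransGen.refl, ReflTransGen.refl⟩
    have hxS : x' ∈ S := ⟨ReflTransGen.single hvx', (hpath x' v').mpr p₁⟩
    have hyS : y' ∈ S := ⟨ReflTransGen.single hvy', (hpath y' v').mpr p₂⟩
    have hcomp : (D.deleteVertices X).IsStrongComponent S := by
      refine ⟨fun a ha b hb => ha.2.trans hb.1, fun T hT hST a ha => ?_⟩
      exact ⟨hT v' (hST hvS) a ha, hT a ha v' (hST hvS)⟩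
    have hnt : S.Nontrivial := ⟨v', hvS, x', hxS, fun h => by
      rw [← h] at hvx'
      exact hD _ hvx'⟩
    obtain ⟨w, -, hw⟩ := h S hcomp hnt ⟨v', hvS⟩
    have h₁ := hw ⟨x', hxS⟩ hvx'
    have h₂ := hw ⟨y', hyS⟩ hvy'
    rw [← h₂] at h₁
    have : x' = y' := congrArg Subtype.val h₁
    exact hxy (congrArg (fun a : (Xᶜ : Set (Fin n)) => ((a : Fin n) : ℕ)) this)
  · intro h S hS hnt v
    have h0 : ∀ w : (Xᶜ : Set (Fin n)), del (w : Fin n) = 0 := fun w => by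
      by_contra h
      exact w.2 ((hX w).mpr h)
    have harc : ∀ a b : (Xᶜ : Set (Fin n)), (D.deleteVertices X).Adj a b →
        Arc n (natAdj D) del (a : Fin n) (b : Fin n) := fun a b hab =>
      ⟨Fin.is_lt _, Fin.is_lt _, natAdj_coe.mpr hab, h0 a, h0 b⟩
    obtain ⟨u, hu, huv⟩ := hnt.exists_ne v.1
    have hvu := hS.prop v v.2 u hu
    rcases ReflTransGen.cases_head hvu with heq | ⟨w, hvw, hwu⟩
    · exact absurd heq.symm huv
    · have hwv : (D.deleteVertices X).HasPath w v := hwu.trans (hS.prop u hu v v.2)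
      -- `w` lies on a closed walk through `v`, so maximality of `S` absorbs it.
      have hwS : w ∈ S := by
        have hT : ∀ a ∈ insert w S, ∀ b ∈ insert w S, (D.deleteVertices X).HasPath a b := by
          have hto : ∀ a ∈ insert w S, (D.deleteVertices X).HasPath a v := by
            rintro a (rfl | ha)
            · exact hwv
            · exact hS.prop a ha v v.2
          have hfrom : ∀ a ∈ insert w S, (D.deleteVertices X).HasPath v a := by
            rintro a (rfl | ha)
            · exact ReflTransGen.single hvw
            · exact hS.prop v v.2 a ha
          exact fun a ha b hb => (hto a ha).trans (hfrom b hb)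
        exact hS.le_of_ge hT (Set.subset_insert w S) (Set.mem_insert w S)
      refine ⟨⟨w, hwS⟩, hvw, fun w' hw' => ?_⟩
      by_contra hne
      have hne' : ((w'.1 : Fin n) : ℕ) ≠ ((w : Fin n) : ℕ) := fun heq =>
        hne (Subtype.ext (Subtype.ext (Fin.ext heq)))
      exact h _ _ _ hne' (harc _ _ hw') (harc _ _ hvw)
        ((hpath _ _).mp (hS.prop w' w'.2 v v.2)) ((hpath _ _).mp hwv)

theorem oneOutRegularVertexDeletion_iff {D : Digraph (Fin n)} (hD : ∀ v, ¬ D.Adj v v) {k : ℕ} :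
    D.OneOutRegularVertexDeletion k ↔
      ∃ Y : ℕ → ℕ, Sol n (natAdj D) Y ∧ ((Finset.range n).filter (Y · ≠ 0)).card ≤ k := by
  classical
  constructor
  · rintro ⟨X, hXk, hX⟩
    refine ⟨fun v => if ∃ i ∈ X, (i : ℕ) = v then 1 else 0,
      (isOneOutRegularDeletionSet_iff hD fun v => ?_).mp hX, le_trans ?_ hXk⟩
    · simp [Fin.val_inj]
    · refine (Finset.card_le_card (t := X.image fun i : Fin n => (i : ℕ)) fun v hv => ?_).trans
        Finset.card_image_le
      simpa using (Finset.mem_filter.mp hv).2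
  · rintro ⟨Y, hY, hYk⟩
    refine ⟨Finset.univ.filter fun v : Fin n => Y v ≠ 0, le_trans ?_ hYk,
      (isOneOutRegularDeletionSet_iff hD fun v => ?_).mpr hY⟩
    · refine Finset.card_le_card_of_injOn (fun v : Fin n => (v : ℕ)) (fun v hv => ?_)
        (fun a _ b _ h => Fin.ext h)
      simpa using hv
    · simp

end CycleDeletion

/-! ### Cuts, residual capacities and augmenting paths. -/

namespace CycleDeletion

section Cut

open Classical in
/-- The capacity of the arcs that leave `S`, in a network on the numbers below `N`. -/
noncomputable def cut (N : ℕ) (c : ℕ → ℕ → ℕ) (S : Set ℕ) : ℕ :=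
  ∑ p ∈ Finset.range N, ∑ r ∈ Finset.range N, if p ∈ S ∧ r ∉ S then c p r else 0

variable {N : ℕ} {c c' : ℕ → ℕ → ℕ} {S : Set ℕ}

theorem cut_congr (h : ∀ p < N, ∀ r < N, c p r = c' p r) : cut N c S = cut N c' S := by
  refine Finset.sum_congr rfl fun p hp => Finset.sum_congr rfl fun r hr => ?_
  rw [h p (Finset.mem_range.mp hp) r (Finset.mem_range.mp hr)]

theorem le_cut {p r : ℕ} (hp : p < N) (hr : r < N) (hpS : p ∈ S) (hrS : r ∉ S) :
    c p r ≤ cut N c S := by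
  classical
  calc c p r = if p ∈ S ∧ r ∉ S then c p r else 0 := by simp [hpS, hrS]
    _ ≤ ∑ r ∈ Finset.range N, if p ∈ S ∧ r ∉ S then c p r else 0 :=
        Finset.single_le_sum (f := fun r => if p ∈ S ∧ r ∉ S then c p r else 0)
          (fun _ _ => Nat.zero_le _) (Finset.mem_range.mpr hr)
    _ ≤ _ := Finset.single_le_sum
          (f := fun p => ∑ r ∈ Finset.range N, if p ∈ S ∧ r ∉ S then c p r else 0)
          (fun _ _ => Nat.zero_le _) (Finset.mem_range.mpr hp)

theorem cut_single {u v m : ℕ} (hu : u < N) (hv : v < N) [Decidable (u ∈ S ∧ v ∉ S)] :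
    cut N (fun p r => if p = u ∧ r = v then m else 0) S = if u ∈ S ∧ v ∉ S then m else 0 := by
  classical
  unfold cut
  rw [Finset.sum_eq_single u, Finset.sum_eq_single v]
  · simp
  · intro r _ hr
    simp [hr]
  · simp [hv]
  · intro p _ hp
    simp [hp]
  · simp [hu]

theorem cut_add : cut N (fun p r => c p r + c' p r) S = cut N c S + cut N c' S := by
  simp only [cut, ← Finset.sum_add_distrib]
  refine Finset.sum_congr rfl fun p _ => Finset.sum_congr rfl fun r _ => ?_
  split_ifs <;> simp

/-- The residual capacities after sending one unit from `u` to `v`. -/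
def pushed (c : ℕ → ℕ → ℕ) (u v p r : ℕ) : ℕ :=
  if p = u ∧ r = v then c p r - 1 else if p = v ∧ r = u then c p r + 1 else c p r

open Classical in
-- One unit along `u v` changes every cut by the difference of the indicators of `v` and `u`. These
-- differences telescope along a path, so that flows need not be defined: residual capacities and
-- their cuts carry all the information.
theorem cut_pushed {u v : ℕ} (hu : u < N) (hv : v < N) (huv : u ≠ v) (hc : c u v ≠ 0) :
    cut N (pushed c u v) S + (if u ∈ S then 1 else 0) = cut N c S + (if v ∈ S then 1 else 0) := by
  have h : cut N (pushed c u v) S + (if u ∈ S ∧ v ∉ S then 1 else 0) =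
      cut N c S + (if v ∈ S ∧ u ∉ S then 1 else 0) := by
    rw [← cut_single hu hv, ← cut_single hv hu, ← cut_add, ← cut_add]
    refine cut_congr fun p _ r _ => ?_
    simp only [pushed]
    by_cases h₁ : p = u ∧ r = v
    · obtain ⟨rfl, rfl⟩ := h₁
      simp [huv]
      omega
    · by_cases h₂ : p = v ∧ r = u
      · obtain ⟨rfl, rfl⟩ := h₂
        simp [huv.symm]
      · simp [h₁, h₂]
  by_cases hu : u ∈ S <;> by_cases hv : v ∈ S <;> simp [hu, hv] at h ⊢ <;> omega

open Classical in
/-- The numbers from which a terminal can be reached, in a breadth-first search: `marks r x` is one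
more than the distance, if this is at most `r + 1`, and zero otherwise. -/
noncomputable def marks (N : ℕ) (T : ℕ → Prop) (c : ℕ → ℕ → ℕ) : ℕ → ℕ → ℕ
  | 0, x => if T x then 1 else 0
  | r + 1, x =>
      if marks N T c r x ≠ 0 then marks N T c r x
      else if ∃ y < N, marks N T c r y ≠ 0 ∧ c x y ≠ 0 then r + 2 else 0

/-- The properties of `marks` that matter for finding augmenting paths. -/
structure IsMarking (N : ℕ) (T : ℕ → Prop) (c : ℕ → ℕ → ℕ) (m : ℕ → ℕ) : Prop where
  terminal : ∀ x < N, m x = 1 ↔ T x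
  le : ∀ x < N, m x ≤ N + 1
  pred : ∀ x < N, 1 < m x → ∃ y < N, m y ≠ 0 ∧ m y < m x ∧ c x y ≠ 0
  closed : ∀ x < N, ∀ y < N, m y ≠ 0 → c x y ≠ 0 → m x ≠ 0

theorem marks_of_le {T : ℕ → Prop} {r r' x : ℕ} (h : marks N T c r x ≠ 0) (hr : r ≤ r') :
    marks N T c r' x = marks N T c r x := by
  induction r', hr using Nat.le_induction with
  | base => rfl
  | succ m _ ih => rw [marks, if_pos (by rw [ih]; exact h), ih]

theorem marks_le {T : ℕ → Prop} (r x : ℕ) : marks N T c r x ≤ r + 1 := by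
  induction r with
  | zero => rw [marks]; split_ifs <;> omega
  | succ r ih => rw [marks]; split_ifs <;> omega

theorem marks_succ_ne_zero {T : ℕ → Prop} {r x y : ℕ} (hy : y < N) (h : marks N T c r y ≠ 0)
    (hc : c x y ≠ 0) : marks N T c (r + 1) x ≠ 0 := by
  rw [marks]
  split_ifs with h₁ h₂
  · exact h₁
  · omega
  · exact fun _ => h₂ ⟨y, hy, h, hc⟩

/-- A vertex marked in round `r + 1` gets `r + 2`, more than any mark present before, which gives a
predecessor of smaller mark. Closedness is stabilization after `N` rounds. -/
theorem isMarking_marks (N : ℕ) (T : ℕ → Prop) (c : ℕ → ℕ → ℕ) :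
    IsMarking N T c (marks N T c N) where
  terminal x _ := by
    have h₁ : T x → marks N T c 0 x = 1 := fun h => by simp [marks, h]
    have h₀ : ¬ T x → marks N T c 0 x = 0 := fun h => by simp [marks, h]
    constructor
    · have : ∀ r, marks N T c r x = 1 → T x := by
        intro r
        induction r with
        | zero =>
          by_contra hcon
          push Not at hcon
          have := h₀ hcon.2
          omega
        | succ r ih =>
          rw [marks]
          split_ifs with h₂ h₃
          · exact ih
          · exact fun h' => by omega
          · exact False.elim
      exact this N
    · intro h
      have := h₁ h
      rw [marks_of_le (by omega) (Nat.zero_le N), this]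
  le x _ := marks_le N x
  pred x _ := by
    have : ∀ r, 1 < marks N T c r x →
        ∃ y < N, marks N T c r y ≠ 0 ∧ marks N T c r y < marks N T c r x ∧ c x y ≠ 0 := by
      intro r
      induction r with
      | zero =>
        have := marks_le (N := N) (c := c) (T := T) 0 x
        omega
      | succ r ih =>
        intro h
        by_cases h₁ : marks N T c r x ≠ 0
        · have h₂ := marks_of_le h₁ (Nat.le_succ r)
          rw [Nat.succ_eq_add_one] at h₂
          rw [h₂] at h ⊢
          obtain ⟨y, hy, hy₁, hy₂, hy₃⟩ := ih h
          have h₃ := marks_of_le hy₁ (Nat.le_succ r)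
          rw [Nat.succ_eq_add_one] at h₃
          exact ⟨y, hy, by rwa [h₃], by rwa [h₃], hy₃⟩
        · rw [marks, if_neg h₁] at h ⊢
          split_ifs at h ⊢ with h₂
          · obtain ⟨y, hy, hy₁, hy₂⟩ := h₂
            have h₃ := marks_of_le hy₁ (Nat.le_succ r)
            rw [Nat.succ_eq_add_one] at h₃
            have := marks_le (N := N) (c := c) (T := T) r y
            exact ⟨y, hy, by rwa [h₃], by omega, hy₂⟩
          · omega
    exact this N
  closed x hx y hy hmy hc := by
    have := stable_of_le (n := N) (fun r => {x | x < N ∧ marks N T c r x ≠ 0}) (fun r v hv => hv.1)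
      (fun r v hv => ⟨hv.1, by rw [marks_of_le hv.2 (Nat.le_succ r)]; exact hv.2⟩)
      (fun r hr v hv => by
        refine ⟨hv.1, fun hcon => ?_⟩
        have hv' := hv.2
        rw [marks, if_neg (by simpa using hcon)] at hv'
        split_ifs at hv' with h₂
        · obtain ⟨y, hy, hy₁, hy₂⟩ := h₂
          exact marks_succ_ne_zero hy (hr ⟨hy, hy₁⟩).2 hy₂ hcon
        · exact hv' rfl)
    exact (this ⟨hx, marks_succ_ne_zero hy hmy hc⟩).2

/-- By induction on the mark: the marked nodes form the smallest set that contains the terminals and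
is closed under residual predecessors. -/
theorem IsMarking.mem_of_closed {T : ℕ → Prop} {m : ℕ → ℕ} (h : IsMarking N T c m) {Z : Set ℕ}
    (hT : ∀ x, T x → x ∈ Z) (hZ : ∀ x < N, ∀ y < N, y ∈ Z → c x y ≠ 0 → x ∈ Z) {x : ℕ} (hx : x < N)
    (hm : m x ≠ 0) : x ∈ Z := by
  induction hd : m x using Nat.strong_induction_on generalizing x with
  | _ d ih =>
    by_cases h1 : m x = 1
    · exact hT x ((h.terminal x hx).mp h1)
    · obtain ⟨y, hy, hy₁, hy₂, hy₃⟩ := h.pred x hx (by omega)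
      exact hZ x hx y hy (ih (m y) (by omega) hy hy₁ rfl) hy₃

/-- The vertex following `u` on an augmenting path. -/
noncomputable def nextOnPath (N : ℕ) (c : ℕ → ℕ → ℕ) (m : ℕ → ℕ) (u : ℕ) : ℕ :=
  firstBelow N fun y => m y ≠ 0 ∧ m y < m u ∧ c u y ≠ 0

open Classical in
/-- The state of an augmentation that started at `a` with residual capacities `c₀`, and has reached
`u` with residual capacities `c` after `j` steps. -/
structure Augmenting (N : ℕ) (c₀ : ℕ → ℕ → ℕ) (m : ℕ → ℕ) (a j u : ℕ) (c : ℕ → ℕ → ℕ) : Prop where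
  lt : u < N
  ne_zero : m u ≠ 0
  le : m u ≤ N + 1 - j ∨ m u = 1
  agree : ∀ p < N, ∀ r < N, m p ≤ m u → m r ≤ m u → c p r = c₀ p r
  cut_eq : ∀ S : Set ℕ, cut N c S + (if a ∈ S then 1 else 0) =
    cut N c₀ S + (if u ∈ S then 1 else 0)

theorem Augmenting.start {T : ℕ → Prop} {m : ℕ → ℕ} (h : IsMarking N T c m) {a : ℕ} (ha : a < N)
    (hm : m a ≠ 0) : Augmenting N c m a 0 a c :=
  ⟨ha, hm, Or.inl (h.le a ha), fun _ _ _ _ _ _ => rfl, fun _ => rfl⟩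

theorem Augmenting.stay {c₀ : ℕ → ℕ → ℕ} {m : ℕ → ℕ} {a j u : ℕ} (h : Augmenting N c₀ m a j u c)
    (hu : ¬ 1 < m u) : Augmenting N c₀ m a (j + 1) u c :=
  ⟨h.lt, h.ne_zero, Or.inr (by have := h.ne_zero; omega), h.agree, h.cut_eq⟩

/-- Marks strictly decrease along the path, so every capacity changed so far involves a node with a
mark larger than that of `u`. The search, made with the old capacities, is therefore still valid at
`u`. -/
theorem Augmenting.next {T : ℕ → Prop} {c₀ : ℕ → ℕ → ℕ} {m : ℕ → ℕ} {a j u : ℕ}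
    (hm : IsMarking N T c₀ m) (h : Augmenting N c₀ m a j u c) (hu : 1 < m u) :
    nextOnPath N c m u < N ∧ nextOnPath N c m u ≠ u ∧
      ∀ c', (∀ p < N, ∀ r < N, c' p r = pushed c u (nextOnPath N c m u) p r) →
        Augmenting N c₀ m a (j + 1) (nextOnPath N c m u) c' := by
  obtain ⟨y, hy, hy₁, hy₂, hy₃⟩ := hm.pred u h.lt hu
  have hlt : nextOnPath N c m u < N := firstBelow_lt hy ⟨hy₁, hy₂, by
    rwa [h.agree u h.lt y hy le_rfl hy₂.le]⟩
  obtain ⟨h₁, h₂, h₃⟩ := firstBelow_spec hlt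
  change m (nextOnPath N c m u) ≠ 0 at h₁
  change m (nextOnPath N c m u) < m u at h₂
  change c u (nextOnPath N c m u) ≠ 0 at h₃
  set v := nextOnPath N c m u
  have huv : v ≠ u := fun heq => by rw [heq] at h₂; exact lt_irrefl _ h₂
  refine ⟨hlt, huv, fun c' hc' => ⟨hlt, h₁, ?_, fun p hp r hr hpm hrm => ?_, fun S => ?_⟩⟩
  · have := h.le
    omega
  · have hpu : p ≠ u := fun heq => by rw [heq] at hpm; omega
    have hru : r ≠ u := fun heq => by rw [heq] at hrm; omega
    rw [hc' p hp r hr, pushed, if_neg (by tauto), if_neg (by tauto)]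
    exact h.agree p hp r hr (by omega) (by omega)
  · have e₁ := h.cut_eq S
    have e₂ := cut_pushed (S := S) h.lt hlt huv.symm h₃
    rw [cut_congr hc']
    omega

/-- After `N` steps the bound `N + 1 - j` has come down to 1, the mark of the terminals. -/
theorem Augmenting.terminal {T : ℕ → Prop} {c₀ : ℕ → ℕ → ℕ} {m : ℕ → ℕ} {a u : ℕ}
    (hm : IsMarking N T c₀ m) (h : Augmenting N c₀ m a N u c) : T u := by
  have := h.le
  have := h.ne_zero
  exact (hm.terminal u h.lt).mp (by omega)

end Cut

section Network

open Classical in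
/-- The network in which the minimum cuts are the minimum vertex separators: each vertex `v` is split
into `v` and `n + v`. -/
noncomputable def capacity (n k : ℕ) (H : ℕ → ℕ → Prop) (p r : ℕ) : ℕ :=
  if p < n then (if r = n + p then 1 else 0) else if H (p - n) r then k + 1 else 0

variable {n k : ℕ} {H : ℕ → ℕ → Prop} {T : ℕ → Prop} {A : ℕ → ℕ}

/-- The cut of the network given by the boundary of `C`. -/
def sourceSide (n : ℕ) (H : ℕ → ℕ → Prop) (C : Set ℕ) : Set ℕ :=
  {p | (p < n ∧ p ∉ C) ∨ (n ≤ p ∧ ¬ ∃ v ∈ C, H (p - n) v)}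

theorem mem_sourceSide_of_lt {C : Set ℕ} {p : ℕ} (hp : p < n) : p ∈ sourceSide n H C ↔ p ∉ C :=
  ⟨fun h => h.elim (·.2) fun h => by omega, fun h => Or.inl ⟨hp, h⟩⟩

theorem mem_sourceSide_of_le {C : Set ℕ} {p : ℕ} (hp : n ≤ p) :
    p ∈ sourceSide n H C ↔ ¬ ∃ v ∈ C, H (p - n) v :=
  ⟨fun h => h.elim (fun h => by omega) (·.2), fun h => Or.inr ⟨hp, h⟩⟩

/-- The arcs of capacity `k + 1` do not cross, because `n + u` is on the source side only if `u` has
no arc into `C`. What crosses is the unit arc of each boundary vertex. -/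
theorem cut_capacity_le (hH : ∀ u v, H u v → u < n ∧ v < n) (C : Set ℕ) :
    cut (n + n) (capacity n k H) (sourceSide n H C) ≤ (boundary n H C).card := by
  classical
  have hcard : (boundary n H C).card =
      ∑ p ∈ Finset.range (n + n), if p ∈ boundary n H C then 1 else 0 := by
    rw [Finset.sum_ite_mem, Finset.inter_eq_right.mpr, Finset.card_eq_sum_ones]
    intro u hu
    have := (mem_boundary.mp hu).1
    simp only [Finset.mem_range]
    omega
  rw [hcard]
  refine Finset.sum_le_sum fun p hp => ?_
  have hterm : ∀ r, (if p ∈ sourceSide n H C ∧ r ∉ sourceSide n H C then capacity n k H p r else 0) ≤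
      if r = n + p then (if p ∈ boundary n H C then 1 else 0) else 0 := by
    intro r
    by_cases hpr : p ∈ sourceSide n H C ∧ r ∉ sourceSide n H C
    swap
    · simp [hpr]
    rw [if_pos hpr]
    obtain ⟨hpS, hrS⟩ := hpr
    by_cases hpn : p < n
    · by_cases hr : r = n + p
      · subst hr
        rw [mem_sourceSide_of_lt hpn] at hpS
        rw [mem_sourceSide_of_le (by omega), Nat.add_sub_cancel_left, not_not] at hrS
        simp [capacity, hpn, mem_boundary, hpS, hrS]
      · simp [capacity, hpn, hr]
    · rw [mem_sourceSide_of_le (by omega)] at hpS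
      rw [capacity, if_neg hpn, if_neg]
      · exact Nat.zero_le _
      · intro hpr
        rw [mem_sourceSide_of_lt (hH _ _ hpr).2, not_not] at hrS
        exact hpS ⟨r, hrS, hpr⟩
  refine (Finset.sum_le_sum fun r _ => hterm r).trans ?_
  rw [Finset.sum_ite_eq']
  split_ifs <;> simp

/-- A cut of capacity at most `k` is crossed by no arc of capacity `k + 1`. So if `p` is in the
boundary, `n + p` is beyond the cut, and the unit arc at `p` contributes. -/
theorem card_boundary_le_cut {S : Set ℕ}
    (hS : cut (n + n) (capacity n k H) S ≤ k) :
    (boundary n H {v | v < n ∧ v ∉ S}).card ≤ cut (n + n) (capacity n k H) S := by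
  classical
  have hcard : (boundary n H {v | v < n ∧ v ∉ S}).card =
      ∑ p ∈ Finset.range (n + n), if p ∈ boundary n H {v | v < n ∧ v ∉ S} then 1 else 0 := by
    rw [Finset.sum_ite_mem, Finset.inter_eq_right.mpr, Finset.card_eq_sum_ones]
    intro u hu
    have := (mem_boundary.mp hu).1
    simp only [Finset.mem_range]
    omega
  rw [hcard]
  refine Finset.sum_le_sum fun p hp => ?_
  split_ifs with h
  · obtain ⟨hp, hpS, v, ⟨hv, hvS⟩, hpv⟩ := mem_boundary.mp h
    have hpS' : p ∈ S := by
      by_contra hcon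
      exact hpS ⟨hp, hcon⟩
    have hout : n + p ∉ S := by
      intro hout
      have := le_cut (c := capacity n k H) (N := n + n) (show n + p < n + n by omega)
        (show v < n + n by omega) hout hvS
      rw [capacity, if_neg (by omega), Nat.add_sub_cancel_left, if_pos hpv] at this
      omega
    calc 1 = if p ∈ S ∧ n + p ∉ S then capacity n k H p (n + p) else 0 := by
          simp [hpS', hout, capacity, hp]
      _ ≤ _ := Finset.single_le_sum
          (f := fun r => if p ∈ S ∧ r ∉ S then capacity n k H p r else 0)
          (fun _ _ => Nat.zero_le _) (Finset.mem_range.mpr (by omega))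
  · exact Nat.zero_le _

/-- When no source is marked, the marked vertices form the far side of the farthest minimum
separator. -/
theorem isFar_of_residual (hH : ∀ u v, H u v → u < n ∧ v < n) (hT : ∀ v, T v → v < n)
    {c : ℕ → ℕ → ℕ} {f : ℕ} (hc : ∀ S : Set ℕ, (∀ v < n, A v ≠ 0 → v ∈ S) → (∀ v, T v → v ∉ S) →
      cut (n + n) c S + f = cut (n + n) (capacity n k H) S)
    {m : ℕ → ℕ} (hm : IsMarking (n + n) T c m) (hA : ∀ v < n, A v ≠ 0 → m v = 0)
    {C₀ : Set ℕ} (hC₀ : Sep T A C₀) (hk : (boundary n H C₀).card ≤ k) :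
    IsFar n H T A {v | v < n ∧ m v ≠ 0} := by
  set S₀ : Set ℕ := {p | m p = 0} with hS₀
  have hT₀ : ∀ v, T v → v ∉ S₀ := fun v hv h => by
    have := (hm.terminal v (by have := hT v hv; omega)).mpr hv
    rw [show m v = 0 from h] at this
    omega
  -- No residual arc leads from an unmarked to a marked node, so `f` equals the original capacity of
  -- this cut, and it is minimum.
  have hcut₀ : cut (n + n) c S₀ = 0 := by
    refine Finset.sum_eq_zero fun p hp => Finset.sum_eq_zero fun r hr => ?_
    split_ifs with h
    · by_contra hne
      exact hm.closed p (Finset.mem_range.mp hp) r (Finset.mem_range.mp hr) h.2 hne h.1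
    · rfl
  have hf : f = cut (n + n) (capacity n k H) S₀ := by
    rw [← hc S₀ hA hT₀, hcut₀, zero_add]
  have hsep : ∀ C, Sep T A C → cut (n + n) c (sourceSide n H C) + f ≤ (boundary n H C).card := by
    intro C hC
    rw [hc]
    · exact cut_capacity_le hH C
    · exact fun v hv hAv => (mem_sourceSide_of_lt hv).mpr fun hvC => hAv (hC.2 v hvC)
    · exact fun v hv h => (mem_sourceSide_of_lt (hT v hv)).mp h (hC.1 v hv)
  -- The separator `C₀` bounds `f` by `k`, which is what permits reading the cut back as a boundary.
  have hB : (boundary n H {v | v < n ∧ m v ≠ 0}).card ≤ f := by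
    have := hsep C₀ hC₀
    rw [hf]
    exact card_boundary_le_cut (k := k) (S := S₀) (by omega)
  refine ⟨⟨fun v hv => ⟨hT v hv, hT₀ v hv⟩, fun v hv => ?_⟩, fun C hC => ?_, fun C hC hle v hv => ?_⟩
  · by_contra hAv
    exact hv.2 (hA v hv.1 hAv)
  · have := hsep C hC
    omega
  -- Another minimum separator has residual cut zero too, so the complement of its source side is
  -- closed and contains all marked nodes. This is why the marked set is the smallest one.
  · have h₁ := hsep C hC
    have h₂ : cut (n + n) c (sourceSide n H C) = 0 := by omega
    have := hm.mem_of_closed (Z := (sourceSide n H C)ᶜ)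
      (fun x hx h => (mem_sourceSide_of_lt (hT x hx)).mp h (hC.1 x hx))
      (fun x hx y hy hyZ hxy hxS => hxy (Nat.le_zero.mp (h₂ ▸ le_cut hx hy hxS hyZ)))
      (show v < n + n by have := hv.1; omega) hv.2
    by_contra hvC
    exact this ((mem_sourceSide_of_lt hv.1).mpr hvC)

end Network

end CycleDeletion

/-! ### Logic, search, division and array filling as terms and commands. -/

namespace RAM

open CycleDeletion

/-- The value of the term is not zero. -/
def Term.Holds (e : Term) (s : State) : Prop := e.eval s ≠ 0

instance (e : Term) (s : State) : Decidable (e.Holds s) := inferInstanceAs (Decidable (_ ≠ _))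

namespace Term

def not (e : Term) : Term := .ite e (.const 0) (.const 1)

def and (e₁ e₂ : Term) : Term := .ite e₁ e₂ (.const 0)

def or (e₁ e₂ : Term) : Term := .ite e₁ (.const 1) e₂

def eq (e₁ e₂ : Term) : Term := not (.add (.sub e₁ e₂) (.sub e₂ e₁))

def lt (e₁ e₂ : Term) : Term := .sub e₂ e₁

/-- Some value of the register `x` below the value of `b` satisfies `e`. -/
def ex (x b : ℕ) (e : Term) : Term := .sum x b (.ite e (.const 1) (.const 0))

/-- The first value of the register `y` below the value of `b` that satisfies `e`; the register `x`
is auxiliary. -/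
def first (x y b : ℕ) (e : Term) : Term :=
  .sum x b (.ite (.ex y b (.and (.not (.lt (.reg x) (.reg y))) e)) (.const 0) (.const 1))

/-- The index of the entry in row `x` and column `y` of a square matrix with `b` rows. -/
def entry (b x y : ℕ) : Term := .add (.sum 59 b (.reg x)) (.reg y)

/-- The quotient of the value of `x`, which has to be less than that of `m`, by the value of `b`. -/
def div (m x b : ℕ) : Term :=
  .sum 58 m (.ite (.lt (.reg x) (.sum 59 b (.add (.reg 58) (.const 1)))) (.const 0) (.const 1))

/-- The remainder belonging to `div`. -/
def mod (m x b : ℕ) : Term := .sub (.reg x) (.sum 59 b (.div m x b))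

/-- The term does not read the array `a`. -/
def avoids (a : ℕ) : Term → Bool
  | .const _ => true
  | .reg _ => true
  | .read b i => decide (b ≠ a) && i.avoids a
  | .add e₁ e₂ => e₁.avoids a && e₂.avoids a
  | .sub e₁ e₂ => e₁.avoids a && e₂.avoids a
  | .ite c e₁ e₂ => c.avoids a && e₁.avoids a && e₂.avoids a
  | .sum _ _ e => e.avoids a

variable {s : State}

@[simp] theorem eval_const (m : ℕ) : (const m).eval s = m := rfl

@[simp] theorem eval_reg (x : ℕ) : (reg x).eval s = s.reg x := rfl

@[simp] theorem eval_read (a : ℕ) (i : Term) : (read a i).eval s = s.arr a (i.eval s) := rfl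

@[simp] theorem eval_add (e₁ e₂ : Term) : (add e₁ e₂).eval s = e₁.eval s + e₂.eval s := rfl

@[simp] theorem eval_sub (e₁ e₂ : Term) : (sub e₁ e₂).eval s = e₁.eval s - e₂.eval s := rfl

@[simp] theorem eval_sum (x b : ℕ) (e : Term) :
    (sum x b e).eval s = ∑ i ∈ Finset.range (s.reg b), e.eval (s.setReg x i) := rfl

@[simp] theorem eval_ite (c e₁ e₂ : Term) :
    (ite c e₁ e₂).eval s = if c.Holds s then e₁.eval s else e₂.eval s := by
  by_cases h : c.eval s = 0 <;> simp [eval, Holds, h]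

@[simp] theorem holds_reg (x : ℕ) : (reg x).Holds s ↔ s.reg x ≠ 0 := Iff.rfl

@[simp] theorem holds_read (a : ℕ) (i : Term) : (read a i).Holds s ↔ s.arr a (i.eval s) ≠ 0 :=
  Iff.rfl

@[simp] theorem holds_not (e : Term) : (not e).Holds s ↔ ¬ e.Holds s := by
  by_cases h : e.eval s = 0 <;> simp [Holds, not, h]

@[simp] theorem holds_and (e₁ e₂ : Term) : (and e₁ e₂).Holds s ↔ e₁.Holds s ∧ e₂.Holds s := by
  by_cases h : e₁.eval s = 0 <;> simp [Holds, and, h]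

@[simp] theorem holds_or (e₁ e₂ : Term) : (or e₁ e₂).Holds s ↔ e₁.Holds s ∨ e₂.Holds s := by
  by_cases h : e₁.eval s = 0 <;> simp [Holds, or, h]

@[simp] theorem holds_eq (e₁ e₂ : Term) : (eq e₁ e₂).Holds s ↔ e₁.eval s = e₂.eval s := by
  rw [eq, holds_not]
  simp only [Holds, eval_add, eval_sub]
  omega

@[simp] theorem holds_lt (e₁ e₂ : Term) : (lt e₁ e₂).Holds s ↔ e₁.eval s < e₂.eval s := by
  simp only [lt, Holds, eval_sub]
  omega

@[simp] theorem holds_ex (x b : ℕ) (e : Term) :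
    (ex x b e).Holds s ↔ ∃ i < s.reg b, e.Holds (s.setReg x i) := by
  simp only [Holds, ex, eval_sum, ne_eq, Finset.sum_eq_zero_iff, Finset.mem_range, eval_ite,
    eval_const]
  push Not
  refine exists_congr fun i => and_congr_right fun _ => ?_
  by_cases h : e.eval (s.setReg x i) = 0 <;> simp [h]

theorem eval_count (x b : ℕ) (e : Term) (p : ℕ → Prop) [DecidablePred p]
    (h : ∀ i < s.reg b, e.Holds (s.setReg x i) ↔ p i) :
    (ex x b e).eval s = ((Finset.range (s.reg b)).filter p).card := by
  rw [Finset.card_filter]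
  refine Finset.sum_congr rfl fun i hi => ?_
  have := h i (Finset.mem_range.mp hi)
  by_cases hp : p i <;> simp [hp, this]

/-- The term counts the `i` below the bound for which no `j ≤ i` satisfies `e`; there are as many as
the first solution, or the bound itself if there is none. -/
theorem eval_first {x y b : ℕ} {e : Term} (hx : x ≠ b) (hxy : x ≠ y) {p : ℕ → Prop}
    (h : ∀ i, ∀ j < s.reg b, e.Holds ((s.setReg x i).setReg y j) ↔ p j) :
    (first x y b e).eval s = firstBelow (s.reg b) p := by
  classical
  have hval : ∀ i ∈ Finset.range (s.reg b), (ite (ex y b (and (not (lt (reg x) (reg y))) e))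
      (const 0) (const 1)).eval (s.setReg x i) = if i < firstBelow (s.reg b) p then 1 else 0 := by
    intro i hi
    have hiff : (ex y b (and (not (lt (reg x) (reg y))) e)).Holds (s.setReg x i) ↔
        ¬ i < firstBelow (s.reg b) p := by
      simp only [holds_ex, State.setReg_reg, if_neg hx.symm, holds_and, holds_not, holds_lt,
        eval_reg, if_true, if_neg hxy, not_lt]
      constructor
      · rintro ⟨j, hj, hji, hp⟩
        exact (le_of_firstBelow ((h i j hj).mp hp)).trans hji
      · intro hle
        have hlt : firstBelow (s.reg b) p < s.reg b := hle.trans_lt (Finset.mem_range.mp hi)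
        exact ⟨_, hlt, hle, (h i _ hlt).mpr (firstBelow_spec hlt)⟩
    by_cases hlt : i < firstBelow (s.reg b) p
    · simp [hiff, hlt]
    · simp [hiff, hlt]
  rw [first, eval_sum, Finset.sum_congr rfl hval, ← Finset.card_filter]
  have : (Finset.range (s.reg b)).filter (· < firstBelow (s.reg b) p) =
      Finset.range (firstBelow (s.reg b) p) := by
    ext i
    have := firstBelow_le (s.reg b) p
    simp only [Finset.mem_filter, Finset.mem_range]
    omega
  rw [this, Finset.card_range]

@[simp] theorem eval_entry {b x y : ℕ} (hx : x ≠ 59) :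
    (entry b x y).eval s = s.reg b * s.reg x + s.reg y := by
  simp [entry, hx]

/-- The quotient is the number of `i` with `b * (i + 1) ≤ x`, the product being written as a sum of
constant terms. The range has to cover the quotient, hence the hypothesis that `x` is below `m`. -/
theorem eval_div {m x b : ℕ} (hx : x < 58) (hb : b < 58) (hm : s.reg x < s.reg m)
    (hpos : 0 < s.reg b) : (div m x b).eval s = s.reg x / s.reg b := by
  have hval : ∀ i ∈ Finset.range (s.reg m), (ite (lt (reg x) (sum 59 b (add (reg 58) (const 1))))
      (const 0) (const 1)).eval (s.setReg 58 i) = if i < s.reg x / s.reg b then 1 else 0 := by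
    intro i _
    have : i < s.reg x / s.reg b ↔ ¬ s.reg x < s.reg b * (i + 1) := by
      rw [← Nat.add_one_le_iff, Nat.le_div_iff_mul_le hpos, not_lt, mul_comm]
    by_cases h : s.reg x < s.reg b * (i + 1)
    · simp [this, h, hx.ne, hb.ne]
    · simp [this, h, hx.ne, hb.ne]
  rw [div, eval_sum, Finset.sum_congr rfl hval, ← Finset.card_filter]
  have : (Finset.range (s.reg m)).filter (· < s.reg x / s.reg b) =
      Finset.range (s.reg x / s.reg b) := by
    ext i
    have := Nat.div_le_self (s.reg x) (s.reg b)
    simp only [Finset.mem_filter, Finset.mem_range]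
    omega
  rw [this, Finset.card_range]

theorem eval_mod {m x b : ℕ} (hx : x < 58) (hb : b < 58) (hm : s.reg x < s.reg m) (hm' : m ≠ 59)
    (hpos : 0 < s.reg b) : (mod m x b).eval s = s.reg x % s.reg b := by
  have h : ∀ i, (div m x b).eval (s.setReg 59 i) = s.reg x / s.reg b := by
    intro i
    rw [eval_div hx hb] <;> simp [show x ≠ 59 by omega, show b ≠ 59 by omega, hm', hm, hpos]
  simp only [mod, eval_sub, eval_reg, eval_sum, h, Finset.sum_const, Finset.card_range, smul_eq_mul]
  have := Nat.div_add_mod (s.reg x) (s.reg b)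
  omega

/-- A loop that overwrites `a` may thus evaluate `e` as if still in its initial state. -/
theorem eval_avoids {a : ℕ} (e : Term) : e.avoids a → ∀ {s s' : State},
    (∀ y, s'.reg y = s.reg y) → (∀ b ≠ a, s'.arr b = s.arr b) → e.eval s' = e.eval s := by
  induction e with
  | const m => intro _ s s' _ _; rfl
  | reg x => intro _ s s' h _; exact h x
  | read b i ih =>
    intro h s s' hr ha
    simp only [avoids, Bool.and_eq_true, decide_eq_true_eq] at h
    simp only [eval_read, ih h.2 hr ha, ha b h.1]
  | add e₁ e₂ h₁ h₂ =>
    intro h s s' hr ha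
    simp only [avoids, Bool.and_eq_true] at h
    simp only [eval_add, h₁ h.1 hr ha, h₂ h.2 hr ha]
  | sub e₁ e₂ h₁ h₂ =>
    intro h s s' hr ha
    simp only [avoids, Bool.and_eq_true] at h
    simp only [eval_sub, h₁ h.1 hr ha, h₂ h.2 hr ha]
  | ite c e₁ e₂ h₀ h₁ h₂ =>
    intro h s s' hr ha
    simp only [avoids, Bool.and_eq_true] at h
    simp only [eval, h₀ h.1.1 hr ha, h₁ h.1.2 hr ha, h₂ h.2 hr ha]
  | sum x b e ih =>
    intro h s s' hr ha
    simp only [avoids] at h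
    simp only [eval_sum, hr b]
    exact Finset.sum_congr rfl fun i _ => ih h (fun y => by simp [hr y]) (fun c hc => ha c hc)

end Term

namespace Command

/-- The sequential composition of a list of commands. -/
def block : List Command → Command
  | [] => .skip
  | c :: cs => .seq c (block cs)

/-- Fill the array `a` with the values of `e`, a term in the register `x`, up to the value of `b`. -/
def fill (a x b : ℕ) (e : Term) : Command := .loop x b (.put a (.reg x) e)

/-- Fill the square matrix stored in the array `a`, with the value of `b` as number of rows, with the
values of `e`, a term in the row index `x` and the column index `y`. -/
def fillMatrix (a x y b : ℕ) (e : Term) : Command :=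
  .loop x b (.loop y b (.put a (.entry b x y) e))

variable {s : State}

@[simp] theorem exec_skip : Command.skip.exec s = s := rfl

@[simp] theorem exec_set (x : ℕ) (e : Term) : (Command.set x e).exec s = s.setReg x (e.eval s) :=
  rfl

@[simp] theorem exec_put (a : ℕ) (i e : Term) :
    (Command.put a i e).exec s = s.setArr a (i.eval s) (e.eval s) := rfl

@[simp] theorem exec_ite (e : Term) (c₁ c₂ : Command) :
    (Command.ite e c₁ c₂).exec s = if e.Holds s then c₁.exec s else c₂.exec s := by
  by_cases h : e.eval s = 0 <;> simp [exec, Term.Holds, h]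

@[simp] theorem exec_block_nil : (block []).exec s = s := rfl

@[simp] theorem exec_block_cons (c : Command) (cs : List Command) :
    (block (c :: cs)).exec s = (block cs).exec (c.exec s) := rfl

/-- The rule for counting loops. -/
theorem exec_loop_induction {x b : ℕ} {c : Command} (I : ℕ → State → Prop)
    (h0 : I 0 (s.setReg x 0))
    (hs : ∀ i < s.reg b, ∀ s', s'.reg x = i → I i s' → I (i + 1) ((c.exec s').setReg x (i + 1))) :
    I (s.reg b) ((Command.loop x b c).exec s) := by
  have hx : ∀ i, (loopState x c.exec s i).reg x = i := by rintro (_ | i) <;> simp [loopState]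
  have : ∀ i ≤ s.reg b, I i (loopState x c.exec s i) := by
    intro i
    induction i with
    | zero => exact fun _ => h0
    | succ i ih => exact fun hi => hs i (by omega) _ (hx i) (ih (by omega))
  exact this _ le_rfl

theorem exec_loop_put {a y b : ℕ} {i e : Term} (hi : i.avoids a) (he : e.avoids a) {base : ℕ}
    (hbase : ∀ j < s.reg b, i.eval (s.setReg y j) = base + j) :
    ((Command.loop y b (.put a i e)).exec s).arr a = fun z =>
      if base ≤ z ∧ z < base + s.reg b then e.eval (s.setReg y (z - base)) else s.arr a z := by
  have := exec_loop_induction (s := s) (x := y) (b := b) (c := .put a i e)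
    (fun j s' => (∀ z, s'.reg z = (s.setReg y j).reg z) ∧ (∀ b ≠ a, s'.arr b = s.arr b) ∧
      s'.arr a = fun z =>
        if base ≤ z ∧ z < base + j then e.eval (s.setReg y (z - base)) else s.arr a z)
    ⟨fun z => rfl, fun b _ => rfl, by
      funext z
      rw [if_neg (by omega)]
      rfl⟩
    (by
      rintro j hj s' - ⟨hr, ha, hv⟩
      refine ⟨fun z => ?_, fun c hc => ?_, ?_⟩
      · simp only [exec_put, State.setReg_reg, State.setArr_reg]
        by_cases hz : z = y
        · simp [hz]
        · simpa [hz] using hr z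
      · simpa [hc] using ha c hc
      · have h₁ : i.eval s' = base + j := by
          rw [i.eval_avoids hi hr (fun c hc => ha c hc), hbase j hj]
        have h₂ : e.eval s' = e.eval (s.setReg y j) := e.eval_avoids he hr (fun c hc => ha c hc)
        funext z
        simp only [exec_put, State.setReg_arr, State.setArr_arr, if_true, h₁, h₂,
          Function.update_apply, hv]
        by_cases hz : z = base + j
        · subst hz
          simp
        · rw [if_neg hz]
          have : (base ≤ z ∧ z < base + j) ↔ (base ≤ z ∧ z < base + (j + 1)) := by omega
          simp only [this])
  exact this.2.2

theorem exec_fill {a x b : ℕ} {e : Term} (he : e.avoids a) :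
    ((fill a x b e).exec s).arr a = fun z =>
      if z < s.reg b then e.eval (s.setReg x z) else s.arr a z := by
  rw [fill, exec_loop_put (base := 0) rfl he (fun j _ => by simp)]
  simp

theorem exec_fillMatrix {a x y b : ℕ} {e : Term} (he : e.avoids a) (hx : x ≠ b) (hy : y ≠ b)
    (hxy : x ≠ y) (hx' : x ≠ 59) {i j : ℕ} (hi : i < s.reg b)
    (hj : j < s.reg b) :
    ((fillMatrix a x y b e).exec s).arr a (s.reg b * i + j) =
      e.eval ((s.setReg x i).setReg y j) := by
  have := exec_loop_induction (s := s) (x := x) (b := b) (c := .loop y b (.put a (.entry b x y) e))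
    (fun i s' => (∀ z ≠ y, s'.reg z = (s.setReg x i).reg z) ∧ (∀ b ≠ a, s'.arr b = s.arr b) ∧
      ∀ i' < i, ∀ j < s.reg b, s'.arr a (s.reg b * i' + j) =
        e.eval ((s.setReg x i').setReg y j))
    ⟨fun z _ => rfl, fun b _ => rfl, fun i' hi' => by omega⟩
    (by
      rintro i hi s' hxs ⟨hr, ha, hv⟩
      have hb' : s'.reg b = s.reg b := by rw [hr b hy.symm]; simp [hx.symm]
      have harr := exec_loop_put (s := s') (a := a) (y := y) (b := b) (i := .entry b x y) (e := e)
        (base := s.reg b * i) rfl he (fun j _ => by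
          rw [Term.eval_entry hx']
          simp [hy.symm, hxy, hb', hxs])
      refine ⟨fun z hz => ?_, fun c hc => ?_, fun i' hi' j hj => ?_⟩
      · rw [State.setReg_reg, exec_reg _ (by simp [keeps, hz])]
        by_cases hzx : z = x
        · simp [hzx]
        · simpa [hzx] using hr z hz
      · rw [State.setReg_arr, exec_arr _ (by simp [keepsArr, hc])]
        exact ha c hc
      · rw [State.setReg_arr, harr, hb']
        simp only
        by_cases hii : i' = i
        · subst hii
          rw [if_pos (by omega), Nat.add_sub_cancel_left]
          refine e.eval_avoids he (fun z => ?_) (fun c hc => by simpa using ha c hc)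
          by_cases hzy : z = y
          · simp [hzy]
          · simpa [hzy] using hr z hzy
        -- Row `i` starts after the end of row `i'`, so it leaves the earlier entries intact.
        · have h₁ : s.reg b * (i' + 1) ≤ s.reg b * i := Nat.mul_le_mul_left _ (by omega)
          rw [mul_add, mul_one] at h₁
          rw [if_neg (by omega)]
          exact hv i' (by omega) j hj)
  exact this.2.2 i hi j hj

end Command

end RAM

/-! ### Computing the farthest minimum separator on the machine. -/

namespace RAM

open CycleDeletion Term Command

/-- The level stored for the vertex in register `x` is between `1` and the current level. -/
def isTerminal (x : ℕ) : Term := .and (.read 2 (.reg x)) (.not (.lt (.reg 13) (.read 2 (.reg x))))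

/-- Compute the capacities of the flow network. -/
def capacityCommand : Command :=
  fillMatrix 5 16 17 2 (.ite (.lt (.reg 16) (.reg 0))
    (.ite (.eq (.reg 17) (.add (.reg 0) (.reg 16))) (.const 1) (.const 0))
    (.ite (.and (.lt (.reg 17) (.reg 0))
        (.read 9 (.add (.sum 59 0 (.sub (.reg 16) (.reg 0))) (.reg 17))))
      (.add (.reg 1) (.const 1)) (.const 0)))

/-- Breadth-first search for the nodes of the residual network that reach a terminal. -/
def searchCommand : Command :=
  block [fill 6 16 2 (.ite (.and (.lt (.reg 16) (.reg 0)) (isTerminal 16)) (.const 1) (.const 0)),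
    .loop 18 2 (block [
      fill 7 16 2 (.ite (.read 6 (.reg 16)) (.read 6 (.reg 16))
        (.ite (.ex 17 2 (.and (.read 6 (.reg 17)) (.read 5 (.entry 2 16 17))))
          (.add (.reg 18) (.const 2)) (.const 0))),
      fill 6 16 2 (.read 7 (.reg 16))])]

/-- Advance along an augmenting path by one arc. -/
def advanceCommand : Command :=
  .ite (.lt (.const 1) (.read 6 (.reg 30)))
    (block [
      .set 31 (.first 17 16 2 (.and (.read 6 (.reg 16))
        (.and (.lt (.read 6 (.reg 16)) (.read 6 (.reg 30))) (.read 5 (.entry 2 30 16))))),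
      .put 5 (.entry 2 30 31) (.sub (.read 5 (.entry 2 30 31)) (.const 1)),
      .put 5 (.entry 2 31 30) (.add (.read 5 (.entry 2 31 30)) (.const 1)),
      .set 30 (.reg 31)])
    .skip

/-- Augment the flow along a path from a source to a terminal, if there is one. -/
def augmentCommand : Command :=
  block [.set 30 (.first 17 16 0 (.and (.read 4 (.reg 16)) (.read 6 (.reg 16)))),
    .ite (.lt (.reg 30) (.reg 0)) (.loop 19 2 advanceCommand) .skip]

/-- Compute the far side of the farthest minimum separator. -/
def farCommand : Command :=
  block [capacityCommand, .loop 15 5 (block [searchCommand, augmentCommand]), searchCommand]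

/-- The data on which `farCommand` operates. -/
structure FlowEnv (n k q : ℕ) (lvl A : ℕ → ℕ) (H : ℕ → ℕ → Prop) (s : State) : Prop where
  reg_zero : s.reg 0 = n
  reg_one : s.reg 1 = k
  reg_two : s.reg 2 = n + n
  reg_five : s.reg 5 = k + 2
  reg_level : s.reg 13 = q
  arr_level : ∀ v < n, s.arr 2 v = lvl v
  arr_source : ∀ v < n, s.arr 4 v = A v
  arr_arc : ∀ u < n, ∀ v < n, s.arr 9 (n * u + v) ≠ 0 ↔ H u v

variable {n k q : ℕ} {lvl A : ℕ → ℕ} {H : ℕ → ℕ → Prop} {s : State}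

theorem FlowEnv.of_eq {s' : State} (h : FlowEnv n k q lvl A H s)
    (hr : ∀ y, y = 0 ∨ y = 1 ∨ y = 2 ∨ y = 5 ∨ y = 13 → s'.reg y = s.reg y)
    (ha : ∀ a, a = 2 ∨ a = 4 ∨ a = 9 → s'.arr a = s.arr a) : FlowEnv n k q lvl A H s' where
  reg_zero := by rw [hr 0 (by simp), h.reg_zero]
  reg_one := by rw [hr 1 (by simp), h.reg_one]
  reg_two := by rw [hr 2 (by simp), h.reg_two]
  reg_five := by rw [hr 5 (by simp), h.reg_five]
  reg_level := by rw [hr 13 (by simp), h.reg_level]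
  arr_level := by rw [ha 2 (by simp)]; exact h.arr_level
  arr_source := by rw [ha 4 (by simp)]; exact h.arr_source
  arr_arc := by rw [ha 9 (by simp)]; exact h.arr_arc

theorem FlowEnv.exec (h : FlowEnv n k q lvl A H s) (c : Command)
    (hr : (c.keeps 0 && c.keeps 1 && c.keeps 2 && c.keeps 5 && c.keeps 13) = true)
    (ha : (c.keepsArr 2 && c.keepsArr 4 && c.keepsArr 9) = true) :
    FlowEnv n k q lvl A H (c.exec s) := by
  simp only [Bool.and_eq_true] at hr ha
  refine h.of_eq ?_ ?_
  · rintro y (rfl | rfl | rfl | rfl | rfl)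
    · exact c.exec_reg hr.1.1.1.1 s
    · exact c.exec_reg hr.1.1.1.2 s
    · exact c.exec_reg hr.1.1.2 s
    · exact c.exec_reg hr.1.2 s
    · exact c.exec_reg hr.2 s
  · rintro a (rfl | rfl | rfl)
    · exact c.exec_arr ha.1.1 s
    · exact c.exec_arr ha.1.2 s
    · exact c.exec_arr ha.2 s

theorem FlowEnv.setReg (h : FlowEnv n k q lvl A H s) {x : ℕ} (m : ℕ)
    (hx : x ≠ 0 ∧ x ≠ 1 ∧ x ≠ 2 ∧ x ≠ 5 ∧ x ≠ 13) : FlowEnv n k q lvl A H (s.setReg x m) := by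
  refine h.of_eq (fun y hy => ?_) fun _ _ => rfl
  rw [State.setReg_reg, if_neg]
  omega

/-- The residual capacities stored in array `5`. -/
def residual (n : ℕ) (s : State) (p r : ℕ) : ℕ := s.arr 5 ((n + n) * p + r)

theorem capacityCommand_spec (h : FlowEnv n k q lvl A H s) (hH : ∀ u v, H u v → u < n ∧ v < n)
    {p r : ℕ} (hp : p < n + n) (hr : r < n + n) :
    residual n (capacityCommand.exec s) p r = capacity n k H p r := by
  have := exec_fillMatrix (s := s) (a := 5) (x := 16) (y := 17) (b := 2)
    (e := .ite (.lt (.reg 16) (.reg 0))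
    (.ite (.eq (.reg 17) (.add (.reg 0) (.reg 16))) (.const 1) (.const 0))
    (.ite (.and (.lt (.reg 17) (.reg 0))
        (.read 9 (.add (.sum 59 0 (.sub (.reg 16) (.reg 0))) (.reg 17))))
      (.add (.reg 1) (.const 1)) (.const 0)))
    rfl (by omega) (by omega) (by omega) (by omega) (h.reg_two ▸ hp) (h.reg_two ▸ hr)
  rw [h.reg_two] at this
  rw [residual, capacityCommand, this, capacity]
  by_cases hpn : p < n
  · simp [h.reg_zero, hpn]
  · have harc : (r < n ∧ s.arr 9 (n * (p - n) + r) ≠ 0) ↔ H (p - n) r := by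
      constructor
      · exact fun h' => (h.arr_arc (p - n) (by omega) r h'.1).mp h'.2
      · exact fun h' => ⟨(hH _ _ h').2, (h.arr_arc _ (hH _ _ h').1 r (hH _ _ h').2).mpr h'⟩
    by_cases hpr : H (p - n) r
    · have := harc.mpr hpr
      simp [h.reg_zero, h.reg_one, hpn, hpr, this]
    · have := mt harc.mp hpr
      simp [h.reg_zero, hpn, hpr, this]

theorem isTerminal_spec (h : FlowEnv n k q lvl A H s) {x : ℕ} (hx : s.reg x < n) :
    (isTerminal x).Holds s ↔ lvl (s.reg x) ≠ 0 ∧ lvl (s.reg x) ≤ q := by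
  simp [isTerminal, h.arr_level _ hx, h.reg_level]

/-- Array `7` is a buffer: each round reads only the marks of the previous one, as the recursion of
`marks` demands. -/
theorem searchCommand_spec (h : FlowEnv n k q lvl A H s) {x : ℕ} (hx : x < n + n) :
    (searchCommand.exec s).arr 6 x =
      marks (n + n) (Terminal n lvl q) (residual n s) (n + n) x := by
  simp only [searchCommand, exec_block_cons, exec_block_nil]
  set s₀ := (fill 6 16 2 (.ite (.and (.lt (.reg 16) (.reg 0)) (isTerminal 16)) (.const 1)
    (.const 0))).exec s with hs₀
  have h₀ : FlowEnv n k q lvl A H s₀ := h.exec _ rfl rfl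
  have hres : residual n s₀ = residual n s := by
    funext p r
    simp only [residual, hs₀]
    rw [exec_arr _ rfl]
  have hinit : ∀ x < n + n, s₀.arr 6 x = marks (n + n) (Terminal n lvl q) (residual n s) 0 x := by
    intro x hx
    rw [hs₀, exec_fill rfl]
    have hT : (Term.and (.lt (.reg 16) (.reg 0)) (isTerminal 16)).Holds (s.setReg 16 x) ↔
        Terminal n lvl q x := by
      rw [holds_and, Terminal]
      have hlt : (Term.lt (.reg 16) (.reg 0)).Holds (s.setReg 16 x) ↔ x < n := by
        simp [h.reg_zero]
      rw [hlt]
      refine and_congr_right fun hxn => ?_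
      rw [isTerminal_spec (h.setReg (x := 16) x (by omega)) (by simpa)]
      simp
    simp only [h.reg_two, hx, if_true, marks, eval_ite, eval_const]
    congr
    exact propext hT
  have := exec_loop_induction (s := s₀) (x := 18) (b := 2) (c := block [
      fill 7 16 2 (.ite (.read 6 (.reg 16)) (.read 6 (.reg 16))
        (.ite (.ex 17 2 (.and (.read 6 (.reg 17)) (.read 5 (.entry 2 16 17))))
          (.add (.reg 18) (.const 2)) (.const 0))),
      fill 6 16 2 (.read 7 (.reg 16))])
    (fun i s' => FlowEnv n k q lvl A H s' ∧ residual n s' = residual n s ∧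
      ∀ x < n + n, s'.arr 6 x = marks (n + n) (Terminal n lvl q) (residual n s) i x)
    ⟨h₀.setReg 0 (by omega), hres, hinit⟩
    (by
      rintro i - s' hi ⟨he, hr, hm⟩
      simp only [exec_block_cons, exec_block_nil]
      set s₁ := (fill 7 16 2 (.ite (.read 6 (.reg 16)) (.read 6 (.reg 16))
        (.ite (.ex 17 2 (.and (.read 6 (.reg 17)) (.read 5 (.entry 2 16 17))))
          (.add (.reg 18) (.const 2)) (.const 0)))).exec s' with hs₁
      have h₁ : FlowEnv n k q lvl A H s₁ := he.exec _ rfl rfl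
      refine ⟨(h₁.exec _ rfl rfl).setReg _ (by omega), ?_, fun x hx => ?_⟩
      · rw [← hr]
        funext p r
        simp only [residual, State.setReg_arr]
        rw [exec_arr _ rfl, hs₁, exec_arr _ rfl]
      · rw [State.setReg_arr, exec_fill rfl]
        simp only [h₁.reg_two, hx, if_true, eval_read, eval_reg, State.setReg_reg,
          State.setReg_arr]
        rw [hs₁, exec_fill rfl]
        have hex : (Term.ex 17 2 (.and (.read 6 (.reg 17)) (.read 5 (.entry 2 16 17)))).Holds
            (s'.setReg 16 x) ↔ ∃ y < n + n, marks (n + n) (Terminal n lvl q) (residual n s) i y ≠ 0 ∧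
              residual n s x y ≠ 0 := by
          simp only [holds_ex, State.setReg_reg, he.reg_two, holds_and, holds_read, eval_reg,
            if_true, State.setReg_arr, eval_entry (show 16 ≠ 59 by omega)]
          refine exists_congr fun y => and_congr_right fun hy => ?_
          rw [← hm y hy, ← hr]
          simp [residual]
        simp only [he.reg_two, hx, if_true, eval_ite, holds_read, eval_reg, State.setReg_reg,
          State.setReg_arr, eval_read, hm x hx, hex, eval_add, hi, eval_const, marks]
        congr)
  have h₂ := this.2.2
  rw [h₀.reg_two] at h₂
  exact h₂ x hx

theorem matrix_index_inj {b i j i' j' : ℕ} (hj : j < b) (hj' : j' < b) :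
    b * i + j = b * i' + j' ↔ i = i' ∧ j = j' := by
  refine ⟨fun h => ?_, fun h => by rw [h.1, h.2]⟩
  have h₁ := congrArg (· / b) h
  simp only [Nat.mul_add_div (Nat.zero_lt_of_lt hj), Nat.div_eq_of_lt hj, Nat.div_eq_of_lt hj',
    add_zero] at h₁
  subst h₁
  exact ⟨rfl, by omega⟩

theorem advanceCommand_spec (h : FlowEnv n k q lvl A H s) {m : ℕ → ℕ} {c₀ : ℕ → ℕ → ℕ} {a j : ℕ}
    (hmark : ∀ x < n + n, s.arr 6 x = m x) (hm : IsMarking (n + n) (Terminal n lvl q) c₀ m)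
    (ha : Augmenting (n + n) c₀ m a j (s.reg 30) (residual n s)) :
    Augmenting (n + n) c₀ m a (j + 1) ((advanceCommand.exec s).reg 30)
      (residual n (advanceCommand.exec s)) := by
  have hcur := ha.lt
  rw [advanceCommand, exec_ite]
  simp only [holds_lt, eval_const, eval_read, eval_reg, hmark _ hcur]
  by_cases hlt : 1 < m (s.reg 30)
  swap
  · rw [if_neg hlt]
    exact ha.stay hlt
  rw [if_pos hlt]
  obtain ⟨hv, hne, hnext⟩ := ha.next hm hlt
  set u := s.reg 30 with hu
  set v := nextOnPath (n + n) (residual n s) m u with hvdef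
  have hfirst : (Term.first 17 16 2 (.and (.read 6 (.reg 16))
      (.and (.lt (.read 6 (.reg 16)) (.read 6 (.reg 30))) (.read 5 (.entry 2 30 16))))).eval s =
      v := by
    rw [eval_first (p := fun y => m y ≠ 0 ∧ m y < m u ∧ residual n s u y ≠ 0) (by omega) (by omega),
      h.reg_two]
    · rfl
    · intro i j hj
      rw [h.reg_two] at hj
      simp [hmark j hj, ← hu, hmark u hcur, residual, h.reg_two]
  -- The two entries are distinct, so the second write reads a value that the first has not altered.
  have huv : (n + n) * u + v ≠ (n + n) * v + u := by
    rw [Ne, matrix_index_inj hv hcur]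
    exact fun h' => hne h'.1.symm
  set s' := (block [
      .set 31 (.first 17 16 2 (.and (.read 6 (.reg 16))
        (.and (.lt (.read 6 (.reg 16)) (.read 6 (.reg 30))) (.read 5 (.entry 2 30 16))))),
      .put 5 (.entry 2 30 31) (.sub (.read 5 (.entry 2 30 31)) (.const 1)),
      .put 5 (.entry 2 31 30) (.add (.read 5 (.entry 2 31 30)) (.const 1)),
      .set 30 (.reg 31)]).exec s with hs'
  have hreg : s'.reg 30 = v := by simp [hs', hfirst]
  have harr : s'.arr 5 = Function.update (Function.update (s.arr 5) ((n + n) * u + v)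
      (residual n s u v - 1)) ((n + n) * v + u) (residual n s v u + 1) := by
    simp [hs', hfirst, h.reg_two, ← hu, Function.update_of_ne huv.symm, residual]
  rw [hreg]
  refine hnext _ fun p hp r hr => ?_
  simp only [pushed, residual, harr, Function.update_apply, matrix_index_inj hr hv,
    matrix_index_inj hr hcur]
  by_cases h₁ : p = u ∧ r = v
  · rw [if_neg (fun h₂ => hne (h₁.2.symm.trans h₂.2)), if_pos h₁, if_pos h₁,
      h₁.1, h₁.2]
  · rw [if_neg h₁, if_neg h₁]
    by_cases h₂ : p = v ∧ r = u
    · rw [if_pos h₂, if_pos h₂, h₂.1, h₂.2]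
    · rw [if_neg h₂, if_neg h₂]

/-- As many advances as there are nodes surely end at a terminal, and the telescoped identity then
lowers every cut between sources and terminals by exactly one. -/
theorem augmentCommand_spec (h : FlowEnv n k q lvl A H s)
    (hmark : ∀ x < n + n,
      s.arr 6 x = marks (n + n) (Terminal n lvl q) (residual n s) (n + n) x) :
    ((∃ a < n, A a ≠ 0 ∧ s.arr 6 a ≠ 0) → ∀ S : Set ℕ, (∀ v < n, A v ≠ 0 → v ∈ S) →
      (∀ v, Terminal n lvl q v → v ∉ S) →
      cut (n + n) (residual n (augmentCommand.exec s)) S + 1 = cut (n + n) (residual n s) S) ∧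
    ((¬ ∃ a < n, A a ≠ 0 ∧ s.arr 6 a ≠ 0) →
      residual n (augmentCommand.exec s) = residual n s) := by
  have hfirst : (Term.first 17 16 0 (.and (.read 4 (.reg 16)) (.read 6 (.reg 16)))).eval s =
      firstBelow n fun a => A a ≠ 0 ∧ s.arr 6 a ≠ 0 := by
    rw [eval_first (p := fun a => A a ≠ 0 ∧ s.arr 6 a ≠ 0) (by omega) (by omega), h.reg_zero]
    intro i j hj
    rw [h.reg_zero] at hj
    simp [h.arr_source j hj]
  set a := firstBelow n fun a => A a ≠ 0 ∧ s.arr 6 a ≠ 0 with ha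
  have h₁ := h.setReg (x := 30) a (by omega)
  simp only [augmentCommand, exec_block_cons, exec_block_nil, exec_set, hfirst, exec_ite, holds_lt,
    eval_reg, h₁.reg_zero]
  have hreg : (s.setReg 30 a).reg 30 = a := by simp
  rw [hreg]
  constructor
  · rintro ⟨b, hb, hAb⟩ S hS hT
    have han : a < n := firstBelow_lt hb hAb
    obtain ⟨hAa, hma⟩ := firstBelow_spec (p := fun a => A a ≠ 0 ∧ s.arr 6 a ≠ 0) han
    rw [if_pos han]
    set m := marks (n + n) (Terminal n lvl q) (residual n s) (n + n)
    have hm : IsMarking (n + n) (Terminal n lvl q) (residual n s) m := isMarking_marks _ _ _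
    have hma' : m a ≠ 0 := by rwa [← hmark a (by omega)]
    have := exec_loop_induction (s := s.setReg 30 a) (x := 19) (b := 2) (c := advanceCommand)
      (fun i s' => FlowEnv n k q lvl A H s' ∧ (∀ x < n + n, s'.arr 6 x = m x) ∧
        Augmenting (n + n) (residual n s) m a i (s'.reg 30) (residual n s'))
      ⟨h₁.setReg _ (by omega), hmark, by
        rw [State.setReg_reg, if_neg (by omega), hreg]
        exact Augmenting.start hm (by omega) hma'⟩
      (by
        rintro i - s' - ⟨he, hmk, haug⟩
        refine ⟨(he.exec _ rfl rfl).setReg _ (by omega), fun x hx => ?_, ?_⟩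
        · rw [State.setReg_arr, exec_arr _ rfl, hmk x hx]
        · rw [State.setReg_reg, if_neg (by omega)]
          exact advanceCommand_spec he hmk hm haug)
    obtain ⟨-, -, haug⟩ := this
    rw [h₁.reg_two] at haug
    have hterm := haug.terminal hm
    have hcut := haug.cut_eq S
    rwa [if_pos (hS a han hAa), if_neg (hT _ hterm), add_zero] at hcut
  · intro hno
    have han : ¬ a < n := fun han =>
      hno ⟨a, han, firstBelow_spec (p := fun a => A a ≠ 0 ∧ s.arr 6 a ≠ 0) han⟩
    rw [if_neg han]
    rfl

/-- The loop invariant: either each round so far has augmented, or no source reaches a terminal any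
more. A separator with boundary at most `k` excludes the former after `k + 2` rounds. -/
theorem farCommand_spec (h : FlowEnv n k q lvl A H s) (hH : ∀ u v, H u v → u < n ∧ v < n)
    {C : Set ℕ} (hC : Sep (Terminal n lvl q) A C) (hk : (boundary n H C).card ≤ k) :
    IsFar n H (Terminal n lvl q) A {v | v < n ∧ (farCommand.exec s).arr 6 v ≠ 0} := by
  simp only [farCommand, exec_block_cons, exec_block_nil]
  set s₁ := capacityCommand.exec s with hs₁
  have h₁ : FlowEnv n k q lvl A H s₁ := h.exec _ rfl rfl
  have := exec_loop_induction (s := s₁) (x := 15) (b := 5) (c := block [searchCommand,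
      augmentCommand])
    (fun i s' => FlowEnv n k q lvl A H s' ∧ ∃ f,
      (∀ S : Set ℕ, (∀ v < n, A v ≠ 0 → v ∈ S) → (∀ v, Terminal n lvl q v → v ∉ S) →
        cut (n + n) (residual n s') S + f = cut (n + n) (capacity n k H) S) ∧
      (f = i ∨ ∀ v < n, A v ≠ 0 →
        marks (n + n) (Terminal n lvl q) (residual n s') (n + n) v = 0))
    ⟨h₁.setReg _ (by omega), 0, fun S _ _ =>
      cut_congr fun p hp r hr => capacityCommand_spec h hH hp hr, Or.inl rfl⟩
    (by
      rintro i - s' - ⟨he, f, hf, hfi⟩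
      have hmark := fun x hx => searchCommand_spec he (x := x) hx
      have hres : residual n (searchCommand.exec s') = residual n s' := by
        funext p r
        rw [residual, exec_arr _ rfl, residual]
      have he' : FlowEnv n k q lvl A H (searchCommand.exec s') := he.exec _ rfl rfl
      rw [← hres] at hmark
      obtain ⟨hyes, hno⟩ := augmentCommand_spec he' hmark
      refine ⟨(he'.exec augmentCommand rfl rfl).setReg _ (by omega), ?_⟩
      simp only [exec_block_cons, exec_block_nil]
      have hset : residual n ((augmentCommand.exec (searchCommand.exec s')).setReg 15 (i + 1)) =
          residual n (augmentCommand.exec (searchCommand.exec s')) := rfl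
      rw [hset]
      by_cases hex : ∃ a < n, A a ≠ 0 ∧ (searchCommand.exec s').arr 6 a ≠ 0
      · refine ⟨f + 1, fun S hS hT => ?_, Or.inl ?_⟩
        · have e₁ := hyes hex S hS hT
          have e₂ := hf S hS hT
          rw [hres] at e₁
          omega
        · rcases hfi with rfl | hz
          · rfl
          · obtain ⟨a, ha, hAa, hma⟩ := hex
            rw [hmark a (by omega), hres] at hma
            exact absurd (hz a ha hAa) hma
      · rw [hno hex, hres]
        refine ⟨f, hf, Or.inr fun v hv hAv => ?_⟩
        by_contra hne
        exact hex ⟨v, hv, hAv, by rwa [hmark v (by omega), hres]⟩)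
  rw [h₁.reg_five] at this
  obtain ⟨he, f, hf, hfi⟩ := this
  set s₂ := (Command.loop 15 5 (block [searchCommand, augmentCommand])).exec s₁
  have hzero : ∀ v < n, A v ≠ 0 →
      marks (n + n) (Terminal n lvl q) (residual n s₂) (n + n) v = 0 := by
    -- The value `k + 2` for `f` would exceed the capacity of the cut given by `C`, which is at most
    -- `k`.
    refine hfi.resolve_left fun hf' => ?_
    have e₁ := hf (sourceSide n H C)
      (fun v hv hAv => (mem_sourceSide_of_lt hv).mpr fun hvC => hAv (hC.2 v hvC))
      (fun v hv hvS => (mem_sourceSide_of_lt hv.1).mp hvS (hC.1 v hv))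
    have e₂ := cut_capacity_le (k := k) hH C
    omega
  have hfar := isFar_of_residual hH (fun v hv => hv.1) hf (isMarking_marks _ _ _) hzero hC hk
  convert hfar using 1
  ext v
  simp only [Set.mem_ofPred_eq]
  refine and_congr_right fun hv => ?_
  rw [searchCommand_spec he (by omega)]

end RAM

/-! ### One step of the search on the machine. -/

namespace RAM

open CycleDeletion Term Command

/-- There is an arc from the vertex in register `x` to the vertex in register `y`, on the far side of
the separator. -/
def isArc (x y : ℕ) : Term := .and (.read 9 (.entry 0 x y)) (.read 6 (.reg y))

/-- Compute the arcs between vertices that are not deleted. -/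
def arcsCommand : Command :=
  fillMatrix 9 16 17 0 (.ite (.and (.read 0 (.entry 0 16 17))
    (.and (.not (.read 3 (.reg 16))) (.not (.read 3 (.reg 17))))) (.const 1) (.const 0))

/-- Find the vertices with several successors. -/
def branchingCommand : Command :=
  fill 10 16 0 (.ite (.ex 17 0 (.ex 18 0 (.and (isArc 16 17) (.and (isArc 16 18)
    (.not (.eq (.reg 17) (.reg 18))))))) (.const 1) (.const 0))

/-- Follow the forced paths from the current level. -/
def traceCommand : Command :=
  block [fill 11 16 0 (.ite (.ex 17 0 (.and (.reg 13) (.and (.eq (.read 2 (.reg 17)) (.reg 13))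
      (.and (.not (.read 10 (.reg 17))) (isArc 17 16))))) (.add (.reg 16) (.const 1)) (.const 0)),
    .loop 20 0 (block [
      fill 12 16 0 (.ite (.read 11 (.reg 16)) (.read 11 (.reg 16))
        (.ite (.lt (.first 18 17 0 (.and (.read 11 (.reg 17)) (.and (.not (isTerminal 17))
            (.and (.not (.read 10 (.reg 17))) (isArc 17 16))))) (.reg 0))
          (.read 11 (.first 18 17 0 (.and (.read 11 (.reg 17)) (.and (.not (isTerminal 17))
            (.and (.not (.read 10 (.reg 17))) (isArc 17 16))))))
          (.const 0))),
      fill 11 16 0 (.read 12 (.reg 16))])]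

/-- The vertex in register `16` shows that the current level is not finished. -/
def isBad : Term :=
  .and (.or (.and (.reg 13) (.eq (.read 2 (.reg 16)) (.reg 13))) (.read 11 (.reg 16)))
    (.or (.read 10 (.reg 16)) (.and (isTerminal 16) (.lt (.read 2 (.reg 16)) (.reg 13))))

/-- Add the vertex given by a term to the sources. -/
def addSource (e : Term) : Command := .put 4 e (.const 1)

/-- The first successor of the vertex in register `x`. -/
def firstSuccessor (x : ℕ) : Term := .first 17 16 0 (isArc x 16)

/-- Change the configuration according to the digit in register `32`. -/
def branchCommand : Command :=
  block [.set 33 (.first 17 16 0 isBad),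
    .ite (.lt (.reg 33) (.reg 0))
      (.ite (.and (.read 2 (.reg 33)) (.lt (.read 2 (.reg 33)) (.reg 13)))
        (addSource (.sub (.read 11 (.reg 33)) (.const 1)))
        (.ite (.eq (.reg 32) (.const 0)) (addSource (firstSuccessor 33))
          (.ite (.eq (.reg 32) (.const 1))
            (block [.set 34 (firstSuccessor 33),
              addSource (.first 17 16 0 (.and (isArc 33 16) (.not (.eq (.reg 16) (.reg 34)))))])
            (addSource (.sub (.read 11 (.reg 33)) (.const 1))))))
      (block [.set 35 (.first 17 16 0 (.and (.not (.read 6 (.reg 16)))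
          (.ex 18 0 (isArc 16 18)))),
        .ite (.lt (.reg 35) (.reg 0))
          (.ite (.eq (.reg 32) (.const 0)) (.put 3 (.reg 35) (.const 1))
            (addSource (firstSuccessor 35)))
          (.set 13 (.sub (.reg 13) (.const 1)))])]

/-- Move the last digit of register `12` to register `x`. -/
def digitCommand (x : ℕ) : Command := block [.set x (.mod 7 12 3), .set 12 (.div 7 12 3)]

/-- One step of the search. -/
def stepCommand : Command :=
  block [arcsCommand, farCommand, branchingCommand, traceCommand, digitCommand 32, branchCommand]

/-- The state of the memory after the far side of the separator was computed. -/
structure StepEnv (n : ℕ) (adj : ℕ → ℕ → Prop) (lvl : ℕ → ℕ) (σ : Config) (s : State) : Prop where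
  reg_zero : s.reg 0 = n
  reg_level : s.reg 13 = σ.q
  arr_level : ∀ v < n, s.arr 2 v = lvl v
  arr_del : ∀ v < n, s.arr 3 v = σ.del v
  arr_source : ∀ v < n, s.arr 4 v = σ.A v
  arr_far : ∀ v < n, s.arr 6 v ≠ 0 ↔ v ∈ σ.far n adj lvl
  arr_arc : ∀ u < n, ∀ v < n, s.arr 9 (n * u + v) ≠ 0 ↔ Arc n adj σ.del u v

variable {n k : ℕ} {adj : ℕ → ℕ → Prop} {lvl : ℕ → ℕ} {σ : Config} {s : State}

theorem arcsCommand_spec {del : ℕ → ℕ} (h₀ : s.reg 0 = n)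
    (hadj : ∀ u < n, ∀ v < n, s.arr 0 (n * u + v) ≠ 0 ↔ adj u v) (hdel : ∀ v < n, s.arr 3 v = del v)
    {u v : ℕ} (hu : u < n) (hv : v < n) :
    (arcsCommand.exec s).arr 9 (n * u + v) ≠ 0 ↔ Arc n adj del u v := by
  have := exec_fillMatrix (s := s) (a := 9) (x := 16) (y := 17) (b := 0)
    (e := .ite (.and (.read 0 (.entry 0 16 17))
      (.and (.not (.read 3 (.reg 16))) (.not (.read 3 (.reg 17))))) (.const 1) (.const 0))
    rfl (by omega) (by omega) (by omega) (by omega) (h₀ ▸ hu) (h₀ ▸ hv)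
  rw [h₀] at this
  rw [arcsCommand, this, Arc, ← hadj u hu v hv]
  simp [h₀, hdel u hu, hdel v hv, hu, hv]

theorem StepEnv.of_eq {s' : State} (h : StepEnv n adj lvl σ s)
    (hr : ∀ y, y = 0 ∨ y = 13 → s'.reg y = s.reg y)
    (ha : ∀ a, a = 2 ∨ a = 3 ∨ a = 4 ∨ a = 6 ∨ a = 9 → s'.arr a = s.arr a) :
    StepEnv n adj lvl σ s' where
  reg_zero := by rw [hr 0 (by simp), h.reg_zero]
  reg_level := by rw [hr 13 (by simp), h.reg_level]
  arr_level := by rw [ha 2 (by simp)]; exact h.arr_level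
  arr_del := by rw [ha 3 (by simp)]; exact h.arr_del
  arr_source := by rw [ha 4 (by simp)]; exact h.arr_source
  arr_far := by rw [ha 6 (by simp)]; exact h.arr_far
  arr_arc := by rw [ha 9 (by simp)]; exact h.arr_arc

theorem StepEnv.exec (h : StepEnv n adj lvl σ s) (c : Command)
    (hr : (c.keeps 0 && c.keeps 13) = true)
    (ha : (c.keepsArr 2 && c.keepsArr 3 && c.keepsArr 4 && c.keepsArr 6 && c.keepsArr 9) = true) :
    StepEnv n adj lvl σ (c.exec s) := by
  simp only [Bool.and_eq_true] at hr ha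
  refine h.of_eq ?_ ?_
  · rintro y (rfl | rfl)
    · exact c.exec_reg hr.1 s
    · exact c.exec_reg hr.2 s
  · rintro a (rfl | rfl | rfl | rfl | rfl)
    · exact c.exec_arr ha.1.1.1.1 s
    · exact c.exec_arr ha.1.1.1.2 s
    · exact c.exec_arr ha.1.1.2 s
    · exact c.exec_arr ha.1.2 s
    · exact c.exec_arr ha.2 s

theorem StepEnv.setReg (h : StepEnv n adj lvl σ s) {x : ℕ} (m : ℕ) (hx : x ≠ 0 ∧ x ≠ 13) :
    StepEnv n adj lvl σ (s.setReg x m) := by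
  refine h.of_eq (fun y hy => ?_) fun _ _ => rfl
  rw [State.setReg_reg, if_neg]
  omega

theorem StepEnv.isArc (h : StepEnv n adj lvl σ s) {x y : ℕ} (hx : x ≠ 59) (hxn : s.reg x < n)
    (hyn : s.reg y < n) : (isArc x y).Holds s ↔ σ.E n adj lvl (s.reg x) (s.reg y) := by
  rw [RAM.isArc, holds_and, holds_read, eval_entry hx, holds_read, h.reg_zero,
    h.arr_arc _ hxn _ hyn, eval_reg, h.arr_far _ hyn, Config.E]

theorem StepEnv.isTerminal (h : StepEnv n adj lvl σ s) {x : ℕ} (hx : s.reg x < n) :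
    (isTerminal x).Holds s ↔ Terminal n lvl σ.q (s.reg x) := by
  simp [RAM.isTerminal, h.arr_level _ hx, h.reg_level, Terminal, hx]

theorem branchingCommand_spec (h : StepEnv n adj lvl σ s) {v : ℕ} (hv : v < n) :
    (branchingCommand.exec s).arr 10 v ≠ 0 ↔ Branching n (σ.E n adj lvl) v := by
  rw [branchingCommand, exec_fill rfl]
  simp only [h.reg_zero, hv, if_true, eval_ite, eval_const]
  have hex : (Term.ex 17 0 (.ex 18 0 (.and (isArc 16 17) (.and (isArc 16 18)
    (.not (.eq (.reg 17) (.reg 18))))))).Holds (s.setReg 16 v) ↔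
      Branching n (σ.E n adj lvl) v := by
    simp only [holds_ex, State.setReg_reg, h.reg_zero, if_true, holds_and, holds_not, holds_eq,
      eval_reg, Branching]
    refine exists_congr fun x => and_congr_right fun hx => exists_congr fun y =>
      and_congr_right fun hy => ?_
    have he := ((h.setReg (x := 16) v (by omega)).setReg (x := 17) x (by omega)).setReg
      (x := 18) y (by omega)
    rw [he.isArc (by omega) (by simpa) (by simpa), he.isArc (by omega) (by simpa) (by simpa)]
    simp
  simp [hex]

/-- The vertices with several successors are stored in array `10`. -/
def BranchingEnv (n : ℕ) (adj : ℕ → ℕ → Prop) (lvl : ℕ → ℕ) (σ : Config) (s : State) : Prop :=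
  ∀ v < n, s.arr 10 v ≠ 0 ↔ Branching n (σ.E n adj lvl) v

theorem traceCommand_spec (h : StepEnv n adj lvl σ s) (hb : BranchingEnv n adj lvl σ s) {v : ℕ}
    (hv : v < n) : (traceCommand.exec s).arr 11 v = σ.trace n adj lvl v := by
  simp only [traceCommand, exec_block_cons, exec_block_nil]
  set s₀ := (fill 11 16 0 (.ite (.ex 17 0 (.and (.reg 13) (.and (.eq (.read 2 (.reg 17)) (.reg 13))
      (.and (.not (.read 10 (.reg 17))) (isArc 17 16))))) (.add (.reg 16) (.const 1))
      (.const 0))).exec s with hs₀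
  have h₀ : StepEnv n adj lvl σ s₀ := h.exec _ rfl rfl
  have hb₀ : BranchingEnv n adj lvl σ s₀ := by
    intro v hv
    rw [hs₀, exec_arr _ rfl]
    exact hb v hv
  have hinit : ∀ v < n, s₀.arr 11 v = trace n lvl σ.q (σ.E n adj lvl) 0 v := by
    intro v hv
    rw [hs₀, exec_fill rfl]
    have hex : (Term.ex 17 0 (.and (.reg 13) (.and (.eq (.read 2 (.reg 17)) (.reg 13))
      (.and (.not (.read 10 (.reg 17))) (isArc 17 16))))).Holds (s.setReg 16 v) ↔
        ∃ w < n, σ.q ≠ 0 ∧ lvl w = σ.q ∧ ¬ Branching n (σ.E n adj lvl) w ∧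
          σ.E n adj lvl w v := by
      simp only [holds_ex, State.setReg_reg, h.reg_zero]
      refine exists_congr fun w => and_congr_right fun hw => ?_
      have he := (h.setReg (x := 16) v (by omega)).setReg (x := 17) w (by omega)
      rw [holds_and, holds_and, holds_and, holds_not, he.isArc (by omega) (by simpa) (by simpa),
        ← hb w hw]
      simp [h.reg_level, h.arr_level w hw]
    simp only [h.reg_zero, hv, if_true, trace, eval_ite, hex, eval_add, eval_reg,
      State.setReg_reg, eval_const]
    congr
    exact propext hex
  have := exec_loop_induction (s := s₀) (x := 20) (b := 0) (c := block [
      fill 12 16 0 (.ite (.read 11 (.reg 16)) (.read 11 (.reg 16))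
        (.ite (.lt (.first 18 17 0 (.and (.read 11 (.reg 17)) (.and (.not (isTerminal 17))
            (.and (.not (.read 10 (.reg 17))) (isArc 17 16))))) (.reg 0))
          (.read 11 (.first 18 17 0 (.and (.read 11 (.reg 17)) (.and (.not (isTerminal 17))
            (.and (.not (.read 10 (.reg 17))) (isArc 17 16))))))
          (.const 0))),
      fill 11 16 0 (.read 12 (.reg 16))])
    (fun i s' => StepEnv n adj lvl σ s' ∧ BranchingEnv n adj lvl σ s' ∧
      ∀ v < n, s'.arr 11 v = trace n lvl σ.q (σ.E n adj lvl) i v)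
    ⟨h₀.setReg 0 (by omega), hb₀, hinit⟩
    (by
      rintro i - s' hi ⟨he, hbe, htr⟩
      simp only [exec_block_cons, exec_block_nil]
      set s₁ := (fill 12 16 0 (.ite (.read 11 (.reg 16)) (.read 11 (.reg 16))
        (.ite (.lt (.first 18 17 0 (.and (.read 11 (.reg 17)) (.and (.not (isTerminal 17))
            (.and (.not (.read 10 (.reg 17))) (isArc 17 16))))) (.reg 0))
          (.read 11 (.first 18 17 0 (.and (.read 11 (.reg 17)) (.and (.not (isTerminal 17))
            (.and (.not (.read 10 (.reg 17))) (isArc 17 16))))))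
          (.const 0)))).exec s' with hs₁
      have h₁ : StepEnv n adj lvl σ s₁ := he.exec _ rfl rfl
      refine ⟨(h₁.exec _ rfl rfl).setReg _ (by omega), fun v hv => ?_, fun v hv => ?_⟩
      · rw [State.setReg_arr, exec_arr _ rfl, hs₁, exec_arr _ rfl]
        exact hbe v hv
      · rw [State.setReg_arr, exec_fill rfl]
        simp only [h₁.reg_zero, hv, if_true, eval_read, eval_reg, State.setReg_reg,
          State.setReg_arr]
        rw [hs₁, exec_fill rfl]
        have hfirst : (Term.first 18 17 0 (.and (.read 11 (.reg 17)) (.and (.not (isTerminal 17))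
            (.and (.not (.read 10 (.reg 17))) (isArc 17 16))))).eval (s'.setReg 16 v) =
            firstBelow n fun u => trace n lvl σ.q (σ.E n adj lvl) i u ≠ 0 ∧
              ¬ Terminal n lvl σ.q u ∧ ¬ Branching n (σ.E n adj lvl) u ∧ σ.E n adj lvl u v := by
          have hreg : (s'.setReg 16 v).reg 0 = n := by simp [he.reg_zero]
          rw [eval_first (p := fun u => s'.arr 11 u ≠ 0 ∧ ¬ Terminal n lvl σ.q u ∧
            ¬ Branching n (σ.E n adj lvl) u ∧ σ.E n adj lvl u v) (by omega) (by omega), hreg]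
          · exact firstBelow_congr fun u hu => by rw [htr u hu]
          · intro z u hu
            rw [hreg] at hu
            have he' := ((he.setReg (x := 16) v (by omega)).setReg (x := 18) z (by omega)).setReg
              (x := 17) u (by omega)
            rw [holds_and, holds_and, holds_and, holds_not, holds_not,
              he'.isArc (by omega) (by simpa) (by simpa), he'.isTerminal (by simpa), ← hbe u hu]
            simp
        simp only [he.reg_zero, hv, if_true, eval_ite, holds_read, eval_reg, State.setReg_reg,
          State.setReg_arr, eval_read, holds_lt, hfirst, htr v hv, eval_const, trace,
          OfNat.zero_ne_ofNat, if_false]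
        by_cases h₁ : trace n lvl σ.q (σ.E n adj lvl) i v ≠ 0
        · rw [if_pos h₁, if_pos h₁]
        · rw [if_neg h₁, if_neg h₁]
          by_cases h₂ : (firstBelow n fun u => trace n lvl σ.q (σ.E n adj lvl) i u ≠ 0 ∧
              ¬ Terminal n lvl σ.q u ∧ ¬ Branching n (σ.E n adj lvl) u ∧ σ.E n adj lvl u v) < n
          · rw [if_pos h₂, if_pos h₂, htr _ h₂]
          · rw [if_neg h₂, if_neg h₂])
  have h₂ := this.2.2
  rw [h₀.reg_zero] at h₂
  exact h₂ v hv

theorem firstSuccessor_spec (h : StepEnv n adj lvl σ s) {x : ℕ} (hx : x ≠ 16 ∧ x ≠ 17 ∧ x ≠ 59)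
    (hxn : s.reg x < n) :
    (firstSuccessor x).eval s = firstBelow n (σ.E n adj lvl (s.reg x)) := by
  rw [firstSuccessor, eval_first (p := σ.E n adj lvl (s.reg x)) (by omega) (by omega), h.reg_zero]
  intro i j hj
  rw [h.reg_zero] at hj
  have he := (h.setReg (x := 17) i (by omega)).setReg (x := 16) j (by omega)
  rw [he.isArc (by omega) (by simpa [hx.1, hx.2.1]) (by simpa)]
  simp [hx.1, hx.2.1]

theorem isBad_spec (h : StepEnv n adj lvl σ s) (hb : BranchingEnv n adj lvl σ s)
    (ht : ∀ v < n, s.arr 11 v = σ.trace n adj lvl v) (hv : s.reg 16 < n) :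
    isBad.Holds s ↔ σ.Bad n adj lvl (s.reg 16) := by
  rw [isBad, holds_and, holds_or, holds_and, holds_or, holds_and, h.isTerminal hv, holds_read,
    holds_read, eval_reg, hb _ hv, ht _ hv, Config.Bad]
  simp [h.reg_level, h.arr_level _ hv]

theorem branchCommand_spec (h : StepEnv n adj lvl σ s) (hb : BranchingEnv n adj lvl σ s)
    (ht : ∀ v < n, s.arr 11 v = σ.trace n adj lvl v) :
    (∀ v < n, (branchCommand.exec s).arr 3 v = (σ.step n adj lvl (s.reg 32)).del v) ∧
    (∀ v < n, (branchCommand.exec s).arr 4 v = (σ.step n adj lvl (s.reg 32)).A v) ∧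
    (branchCommand.exec s).reg 13 = (σ.step n adj lvl (s.reg 32)).q := by
  have hbad : (Term.first 17 16 0 isBad).eval s = firstBelow n (σ.Bad n adj lvl) := by
    rw [eval_first (p := σ.Bad n adj lvl) (by omega) (by omega), h.reg_zero]
    intro i j hj
    rw [h.reg_zero] at hj
    have he := (h.setReg (x := 17) i (by omega)).setReg (x := 16) j (by omega)
    rw [isBad_spec he hb ht (by simpa)]
    simp
  simp only [branchCommand, exec_block_cons, exec_block_nil, exec_set, hbad, Config.step]
  set v := firstBelow n (σ.Bad n adj lvl)
  have h₁ : StepEnv n adj lvl σ (s.setReg 33 v) := h.setReg v (by omega)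
  have hv : (s.setReg 33 v).reg 33 = v := by simp
  have hd : (s.setReg 33 v).reg 32 = s.reg 32 := by simp
  have ht₁ : (s.setReg 33 v).arr 11 = s.arr 11 := rfl
  generalize s.setReg 33 v = s₁ at h₁ hv hd ht₁
  rw [← hd]
  by_cases hvn : v < n
  · have hsucc := firstSuccessor_spec h₁ (x := 33) (by omega) (by rwa [hv])
    rw [hv] at hsucc
    simp only [exec_ite, holds_lt, eval_reg, h₁.reg_zero, hv, hvn, if_true, holds_and, holds_read,
      h₁.arr_level v hvn, eval_read, h₁.reg_level, holds_eq, eval_const, ne_eq]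
    by_cases hl : lvl v ≠ 0 ∧ lvl v < σ.q
    · rw [if_pos hl, if_pos hl]
      simp +contextual [addSource, hv, ht₁, ht v hvn, h₁.reg_level, Function.update_apply,
        h₁.arr_del, h₁.arr_source]
    rw [if_neg hl, if_neg hl]
    by_cases hd₀ : s₁.reg 32 = 0
    · rw [if_pos hd₀, if_pos hd₀]
      simp +contextual [addSource, hsucc, h₁.reg_level, Function.update_apply,
        h₁.arr_del, h₁.arr_source]
    rw [if_neg hd₀, if_neg hd₀]
    by_cases hd₁ : s₁.reg 32 = 1
    · rw [if_pos hd₁, if_pos hd₁]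
      simp only [exec_block_cons, exec_block_nil, exec_set, hsucc]
      set x := firstBelow n (σ.E n adj lvl v)
      have h₂ : StepEnv n adj lvl σ (s₁.setReg 34 x) := h₁.setReg x (by omega)
      have hsecond : (Term.first 17 16 0 (.and (isArc 33 16) (.not (.eq (.reg 16) (.reg 34))))).eval
          (s₁.setReg 34 x) = firstBelow n fun y => σ.E n adj lvl v y ∧ y ≠ x := by
        rw [eval_first (p := fun y => σ.E n adj lvl v y ∧ y ≠ x) (by omega) (by omega),
          h₂.reg_zero]
        intro i j hj
        rw [h₂.reg_zero] at hj
        have he := (h₂.setReg (x := 17) i (by omega)).setReg (x := 16) j (by omega)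
        rw [holds_and, he.isArc (by omega) (by simpa [hv]) (by simpa)]
        simp [hv]
      simp +contextual [addSource, hsecond, h₁.reg_level, Function.update_apply,
        h₁.arr_del, h₁.arr_source]
    rw [if_neg hd₁, if_neg hd₁]
    simp +contextual [addSource, hv, ht₁, ht v hvn, h₁.reg_level, Function.update_apply,
        h₁.arr_del, h₁.arr_source]
  · have hfirst : (Term.first 17 16 0 (.and (.not (.read 6 (.reg 16)))
        (.ex 18 0 (isArc 16 18)))).eval s₁ =
        firstBelow n fun u => u ∉ σ.far n adj lvl ∧ ∃ x < n, σ.E n adj lvl u x := by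
      rw [eval_first (p := fun u => u ∉ σ.far n adj lvl ∧ ∃ x < n, σ.E n adj lvl u x) (by omega)
        (by omega), h₁.reg_zero]
      intro i j hj
      rw [h₁.reg_zero] at hj
      have he := (h₁.setReg (x := 17) i (by omega)).setReg (x := 16) j (by omega)
      rw [holds_and, holds_not, holds_read, holds_ex, he.reg_zero]
      refine and_congr ?_ (exists_congr fun x => and_congr_right fun hx => ?_)
      · rw [← h₁.arr_far j hj]
        simp
      · rw [(he.setReg (x := 18) x (by omega)).isArc (by omega) (by simpa) (by simpa)]
        simp
    simp only [exec_ite, holds_lt, eval_reg, h₁.reg_zero, hv, hvn, if_false, exec_block_cons,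
      exec_block_nil, exec_set, hfirst]
    set y := firstBelow n fun u => u ∉ σ.far n adj lvl ∧ ∃ x < n, σ.E n adj lvl u x
    have h₂ : StepEnv n adj lvl σ (s₁.setReg 35 y) := h₁.setReg y (by omega)
    have hy : (s₁.setReg 35 y).reg 35 = y := by simp
    have hd₂ : (s₁.setReg 35 y).reg 32 = s₁.reg 32 := by simp
    rw [← hd₂]
    generalize s₁.setReg 35 y = s₂ at h₂ hy hd₂
    simp only [h₂.reg_zero, hy, holds_eq, eval_reg, eval_const]
    by_cases hyn : y < n
    · rw [if_pos hyn, if_pos hyn]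
      have hsucc := firstSuccessor_spec h₂ (x := 35) (by omega) (by rwa [hy])
      rw [hy] at hsucc
      by_cases hd₀ : s₂.reg 32 = 0
      · rw [if_pos hd₀, if_pos hd₀]
        simp +contextual [hy, h₂.reg_level, Function.update_apply,
          h₂.arr_del, h₂.arr_source]
      · rw [if_neg hd₀, if_neg hd₀]
        simp +contextual [addSource, hsucc, h₂.reg_level, Function.update_apply,
          h₂.arr_del, h₂.arr_source]
    · rw [if_neg hyn, if_neg hyn]
      simp +contextual [h₂.reg_level, h₂.arr_del, h₂.arr_source]

/-- The state of the memory during the search, for the configuration `σ` and the remaining digits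
`r`. -/
structure SearchEnv (n k b m : ℕ) (adj : ℕ → ℕ → Prop) (lvl : ℕ → ℕ) (σ : Config) (r : ℕ)
    (s : State) : Prop where
  reg_zero : s.reg 0 = n
  reg_one : s.reg 1 = k
  reg_two : s.reg 2 = n + n
  reg_base : s.reg 3 = b
  reg_five : s.reg 5 = k + 2
  reg_bound : s.reg 7 = m
  reg_digits : s.reg 12 = r
  reg_level : s.reg 13 = σ.q
  arr_adj : ∀ u < n, ∀ v < n, s.arr 0 (n * u + v) ≠ 0 ↔ adj u v
  arr_level : ∀ v < n, s.arr 2 v = lvl v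
  arr_del : ∀ v < n, s.arr 3 v = σ.del v
  arr_source : ∀ v < n, s.arr 4 v = σ.A v

theorem digitCommand_spec {x : ℕ} (hx : x ≠ 3 ∧ x ≠ 7 ∧ x ≠ 12) (h : s.reg 12 < s.reg 7)
    (hb : 0 < s.reg 3) : ((digitCommand x).exec s).reg x = s.reg 12 % s.reg 3 ∧
      ((digitCommand x).exec s).reg 12 = s.reg 12 / s.reg 3 := by
  simp only [digitCommand, exec_block_cons, exec_block_nil, exec_set]
  rw [eval_mod (by omega) (by omega) h (by omega) hb, eval_div (by omega) (by omega)]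
  · simp [hx.2.2, hx.1.symm, hx.2.2.symm]
  · simpa [hx.2.1.symm, hx.2.2.symm]
  · simpa [hx.1.symm]

/-- Feasibility enters through the far side only; the other commands follow the definition of
`Config.step` literally. The bound `m` on `r` is there for the division that extracts a digit. -/
theorem stepCommand_spec {b m r : ℕ} (h : SearchEnv n k b m adj lvl σ r s) (hb : 0 < b)
    (hr : r < m) (hf : σ.Feasible n adj lvl k) :
    SearchEnv n k b m adj lvl (σ.step n adj lvl (r % b)) (r / b) (stepCommand.exec s) := by
  have h₀ : FlowEnv n k σ.q lvl σ.A (Arc n adj σ.del) (arcsCommand.exec s) := by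
    refine ⟨?_, ?_, ?_, ?_, ?_, ?_, ?_, ?_⟩
    · rw [exec_reg _ rfl, h.reg_zero]
    · rw [exec_reg _ rfl, h.reg_one]
    · rw [exec_reg _ rfl, h.reg_two]
    · rw [exec_reg _ rfl, h.reg_five]
    · rw [exec_reg _ rfl, h.reg_level]
    · rw [exec_arr _ rfl]
      exact h.arr_level
    · rw [exec_arr _ rfl]
      exact h.arr_source
    · intro u hu v hv
      exact arcsCommand_spec h.reg_zero h.arr_adj h.arr_del hu hv
  obtain ⟨C, hC, hk⟩ := hf
  have hfar := farCommand_spec h₀ (fun u v huv => ⟨huv.1, huv.2.1⟩) hC hk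
  have h₁ : StepEnv n adj lvl σ (farCommand.exec (arcsCommand.exec s)) := by
    refine ⟨?_, ?_, ?_, ?_, ?_, ?_, ?_⟩
    · rw [exec_reg _ rfl, h₀.reg_zero]
    · rw [exec_reg _ rfl, h₀.reg_level]
    · rw [exec_arr _ rfl]
      exact h₀.arr_level
    · rw [exec_arr _ rfl, exec_arr _ rfl]
      exact h.arr_del
    · rw [exec_arr _ rfl]
      exact h₀.arr_source
    · intro v hv
      -- Both sets are farthest minimum separators, so they agree by uniqueness.
      rw [Config.far, ← hfar.eq (isFar_far (terminal_lt _) hC), Set.mem_ofPred_eq]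
      simp [hv]
    · rw [exec_arr _ rfl]
      exact h₀.arr_arc
  set s₁ := farCommand.exec (arcsCommand.exec s) with hs₁
  have h₂ : StepEnv n adj lvl σ (branchingCommand.exec s₁) := h₁.exec _ rfl rfl
  have hb₂ : BranchingEnv n adj lvl σ (branchingCommand.exec s₁) := fun v hv =>
    branchingCommand_spec h₁ hv
  set s₂ := branchingCommand.exec s₁ with hs₂
  have h₃ : StepEnv n adj lvl σ (traceCommand.exec s₂) := h₂.exec _ rfl rfl
  have ht₃ := fun v hv => traceCommand_spec h₂ hb₂ (v := v) hv
  have hb₃ : BranchingEnv n adj lvl σ (traceCommand.exec s₂) := fun v hv => by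
    rw [exec_arr _ rfl]
    exact hb₂ v hv
  set s₃ := traceCommand.exec s₂ with hs₃
  have e₃ : s₃.reg 3 = b ∧ s₃.reg 7 = m ∧ s₃.reg 12 = r := by
    simp only [hs₃, hs₂, hs₁]
    refine ⟨?_, ?_, ?_⟩ <;> rw [exec_reg _ rfl, exec_reg _ rfl, exec_reg _ rfl, exec_reg _ rfl]
    exacts [h.reg_base, h.reg_bound, h.reg_digits]
  obtain ⟨hd, hr₄⟩ := digitCommand_spec (s := s₃) (x := 32) (by omega) (by omega) (by omega)
  rw [e₃.1, e₃.2.2] at hd hr₄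
  have h₄ : StepEnv n adj lvl σ ((digitCommand 32).exec s₃) := h₃.exec _ rfl rfl
  obtain ⟨f₁, f₂, f₃⟩ := branchCommand_spec h₄ hb₃ ht₃
  rw [hd] at f₁ f₂ f₃
  have hexec : stepCommand.exec s = branchCommand.exec ((digitCommand 32).exec s₃) := by
    simp only [stepCommand, exec_block_cons, exec_block_nil, hs₃, hs₂, hs₁]
  rw [← hexec] at f₁ f₂ f₃
  have hreg : ∀ y, stepCommand.keeps y → (stepCommand.exec s).reg y = s.reg y := fun y hy =>
    exec_reg _ hy _
  have harr : ∀ a, stepCommand.keepsArr a → (stepCommand.exec s).arr a = s.arr a := fun a ha =>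
    exec_arr _ ha _
  refine ⟨?_, ?_, ?_, ?_, ?_, ?_, ?_, f₃, ?_, ?_, f₁, f₂⟩
  · rw [hreg 0 rfl, h.reg_zero]
  · rw [hreg 1 rfl, h.reg_one]
  · rw [hreg 2 rfl, h.reg_two]
  · rw [hreg 3 rfl, h.reg_base]
  · rw [hreg 5 rfl, h.reg_five]
  · rw [hreg 7 rfl, h.reg_bound]
  · rw [hexec, exec_reg _ rfl, hr₄]
  · rw [harr 0 rfl]
    exact h.arr_adj
  · rw [harr 2 rfl]
    exact h.arr_level

end RAM

/-! ### Encoding the guesses by digits, and reachability in rounds. -/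

namespace CycleDeletion

open Relation

variable {n : ℕ} {adj : ℕ → ℕ → Prop} {lvl : ℕ → ℕ}

/-- `Config.run` recurses on the first step, whereas a machine loop appends a last one; the digit of
that step is `r / b ^ j % b`. -/
theorem Config.run_succ (b : ℕ) (σ : Config) (j r : ℕ) :
    σ.run n adj lvl b (j + 1) r = (σ.run n adj lvl b j r).step n adj lvl (r / b ^ j % b) := by
  induction j generalizing σ r with
  | zero => simp [Config.run]
  | succ j ih =>
    rw [Config.run, ih, Config.run, Nat.div_div_eq_div_mul, ← pow_succ']

/-- The number whose digits in base `b` are the values of `f` at the `j` numbers from `v` on that are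
marked by `W`, followed by the digits of `r`. -/
def code (W f : ℕ → ℕ) (b r : ℕ) : ℕ → ℕ → ℕ
  | 0, _ => r
  | j + 1, v => if W v = 0 then code W f b r j (v + 1) else f v + b * code W f b r j (v + 1)

/-- Only vertices marked by `W` use up a digit, so the exponent is the size of `W`, not `n`. -/
theorem code_lt {W f : ℕ → ℕ} {b r m : ℕ} (hf : ∀ v, f v < b) (hr : r < m) (j v : ℕ) :
    code W f b r j v < b ^ (∑ i ∈ Finset.range j, if W (v + i) = 0 then 0 else 1) * m := by
  induction j generalizing v with
  | zero => simpa [code] using hr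
  | succ j ih =>
    have h := ih (v + 1)
    rw [code, Finset.sum_range_succ']
    simp only [← add_assoc, add_right_comm v _ 1, add_zero]
    split_ifs with hW
    · simpa using h
    · rw [pow_succ, mul_comm _ b, mul_assoc]
      have := hf v
      nlinarith

theorem code_add_one_le {W f : ℕ → ℕ} {b r : ℕ} (hb : 0 < b) (j v : ℕ) :
    code W f b r j (v + 1) ≤ code W f b r (j + 1) v := by
  rw [code]
  split_ifs
  · exact le_rfl
  · nlinarith

/-- `reach n E r u v` holds if there is a path from `u` to `v` of length at most `r`. -/
def reach (n : ℕ) (E : ℕ → ℕ → Prop) : ℕ → ℕ → ℕ → Prop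
  | 0, u, v => u = v
  | r + 1, u, v => reach n E r u v ∨ ∃ w < n, E u w ∧ reach n E r w v

/-- The sets of vertices that reach `v` within `r` steps grow with `r`, so they are stable after `n`
rounds. -/
theorem reach_iff {E : ℕ → ℕ → Prop} (hE : ∀ u v, E u v → u < n ∧ v < n) {u v : ℕ} (hv : v < n) :
    reach n E n u v ↔ ReflTransGen E u v := by
  constructor
  · have : ∀ r u, reach n E r u v → ReflTransGen E u v := by
      intro r
      induction r with
      | zero => rintro u rfl; exact ReflTransGen.refl
      | succ r ih =>
        rintro u (h | ⟨w, -, huw, h⟩)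
        · exact ih u h
        · exact ReflTransGen.head huw (ih w h)
    exact this n u
  · have hrefl : ∀ r, reach n E r v v := by
      intro r
      induction r with
      | zero => rfl
      | succ r ih => exact Or.inl ih
    intro h
    induction h using ReflTransGen.head_induction_on with
    | refl => exact hrefl n
    | head huw _ ih =>
      refine stable_of_le (n := n) (fun r => {u | reach n E r u v}) ?_ (fun r u h => Or.inl h) ?_
        (Or.inr ⟨_, (hE _ _ huw).2, huw, ih⟩)
      · intro r
        induction r with
        | zero => rintro u rfl; exact hv
        | succ r ih =>
          rintro u (h | ⟨w, -, huw, -⟩)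
          · exact ih u h
          · exact (hE _ _ huw).1
      · rintro r hr u (h | ⟨w, hw, huw, h⟩)
        · exact h
        · exact Or.inr ⟨w, hw, huw, hr h⟩

end CycleDeletion

/-! ### Decoding a guess and running the search. -/

namespace RAM

open CycleDeletion Term Command

/-- The search. -/
def runCommand : Command := .loop 14 6 stepCommand

/-- Prepare the search in the graph induced by the vertices up to register `10`, for the levels given
by the digits of register `11`. -/
def initCommand : Command :=
  block [.set 12 (.reg 11),
    fill 3 16 0 (.ite (.lt (.reg 10) (.reg 16)) (.const 1) (.const 0)),
    fill 2 16 0 (.const 0),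
    fill 4 16 0 (.const 0),
    .loop 20 0 (.ite (.read 1 (.reg 20))
      (block [digitCommand 21, .put 2 (.reg 20) (.reg 21),
        .ite (.reg 21) .skip (.put 3 (.reg 20) (.const 1))])
      .skip),
    .set 13 (.add (.reg 1) (.const 1))]

variable {n k : ℕ} {adj : ℕ → ℕ → Prop} {lvl : ℕ → ℕ} {σ : Config} {s : State}

theorem runCommand_spec {b m r μ : ℕ} (h : SearchEnv n k b m adj lvl σ r s) (hb : 0 < b)
    (hr : r < m) (hμ : s.reg 6 = μ) (hf : ∀ j ≤ μ, (σ.run n adj lvl b j r).Feasible n adj lvl k) :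
    SearchEnv n k b m adj lvl (σ.run n adj lvl b μ r) (r / b ^ μ) (runCommand.exec s) := by
  have hset : ∀ {σ : Config} {r : ℕ} {s : State} (z : ℕ), SearchEnv n k b m adj lvl σ r s →
      SearchEnv n k b m adj lvl σ r (s.setReg 14 z) := fun z h =>
    ⟨by simpa using h.reg_zero, by simpa using h.reg_one, by simpa using h.reg_two,
      by simpa using h.reg_base, by simpa using h.reg_five, by simpa using h.reg_bound,
      by simpa using h.reg_digits, by simpa using h.reg_level, h.arr_adj, h.arr_level, h.arr_del,
      h.arr_source⟩
  have := exec_loop_induction (s := s) (x := 14) (b := 6) (c := stepCommand)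
    (fun j s' => SearchEnv n k b m adj lvl (σ.run n adj lvl b j r) (r / b ^ j) s')
    (by simpa [Config.run] using hset 0 h)
    (by
      intro j hj s' _ hs'
      rw [Config.run_succ, pow_succ, ← Nat.div_div_eq_div_mul]
      exact hset _ (stepCommand_spec hs' hb ((Nat.div_le_self _ _).trans_lt hr) (hf j (by omega))))
  rwa [hμ] at this

theorem initCommand_spec {b m i r : ℕ} {W f : ℕ → ℕ} (h₀ : s.reg 0 = n) (h₁ : s.reg 1 = k)
    (h₂ : s.reg 2 = n + n) (h₃ : s.reg 3 = b) (h₅ : s.reg 5 = k + 2) (h₇ : s.reg 7 = m)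
    (hi : s.reg 10 = i) (hadj : ∀ u < n, ∀ v < n, s.arr 0 (n * u + v) ≠ 0 ↔ adj u v)
    (hW : s.arr 1 = W) (hf : ∀ v, f v < b) (hfW : ∀ v, W v = 0 → f v = 0)
    (hG : s.reg 11 = code W f b r n 0) (hm : code W f b r n 0 < m) :
    SearchEnv n k b m adj f
      ⟨fun v => if i < v ∨ (W v ≠ 0 ∧ f v = 0) then 1 else 0, fun _ => 0, k + 1⟩ r
      (initCommand.exec s) := by
  have hb : 0 < b := Nat.zero_lt_of_lt (hf 0)
  set s₁ := (fill 4 16 0 (.const 0)).exec ((fill 2 16 0 (.const 0)).exec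
    ((fill 3 16 0 (.ite (.lt (.reg 10) (.reg 16)) (.const 1) (.const 0))).exec
      ((Command.set 12 (.reg 11)).exec s))) with hs₁
  have hreg : ∀ y, y ≠ 12 → y ≠ 16 → s₁.reg y = s.reg y := fun y hy hy' => by
    rw [hs₁, exec_reg _ (by simp [fill, keeps, hy']), exec_reg _ (by simp [fill, keeps, hy']),
      exec_reg _ (by simp [fill, keeps, hy']), exec_reg _ (by simp [keeps, hy])]
  have hdig : s₁.reg 12 = s.reg 11 := by
    rw [hs₁, exec_reg _ rfl, exec_reg _ rfl, exec_reg _ rfl]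
    simp
  have ha₂ : ∀ v < n, s₁.arr 2 v = 0 := fun v hv => by
    rw [hs₁, exec_arr _ rfl, exec_fill rfl, exec_reg _ rfl, exec_reg _ rfl, h₀]
    simp [hv]
  have ha₃ : ∀ v < n, s₁.arr 3 v = if i < v then 1 else 0 := fun v hv => by
    rw [hs₁, exec_arr _ rfl, exec_arr _ rfl, exec_fill rfl, exec_reg _ rfl, h₀]
    simp [hv, hi]
  have ha₄ : ∀ v < n, s₁.arr 4 v = 0 := fun v hv => by
    rw [hs₁, exec_fill rfl, exec_reg _ rfl, exec_reg _ rfl, exec_reg _ rfl, h₀]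
    simp [hv]
  have ha₀ : s₁.arr 0 = s.arr 0 := by
    rw [hs₁, exec_arr _ rfl, exec_arr _ rfl, exec_arr _ rfl, exec_arr _ rfl]
  have ha₁ : s₁.arr 1 = W := by
    rw [hs₁, exec_arr _ rfl, exec_arr _ rfl, exec_arr _ rfl, exec_arr _ rfl, hW]
  have := exec_loop_induction (s := s₁) (x := 20) (b := 0) (c := .ite (.read 1 (.reg 20))
      (block [digitCommand 21, .put 2 (.reg 20) (.reg 21),
        .ite (.reg 21) .skip (.put 3 (.reg 20) (.const 1))])
      .skip)
    -- Before vertex `j` is treated, register `12` holds the code of the vertices from `j` on. It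
    -- stays below `m`, as digit extraction requires.
    (fun j s' => (∀ y < 12, s'.reg y = s₁.reg y) ∧ s'.arr 0 = s₁.arr 0 ∧ s'.arr 1 = W ∧
      s'.arr 4 = s₁.arr 4 ∧ s'.reg 12 = code W f b r (n - j) j ∧ s'.reg 12 < m ∧
      (∀ v < n, s'.arr 2 v = if v < j then f v else 0) ∧
      ∀ v < n, s'.arr 3 v = if i < v ∨ (v < j ∧ W v ≠ 0 ∧ f v = 0) then 1 else 0)
    (by
      refine ⟨fun y hy => ?_, rfl, ha₁, rfl, ?_, ?_, fun v hv => ?_, fun v hv => ?_⟩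
      · rw [State.setReg_reg, if_neg (by omega)]
      · simpa [hdig] using hG
      · simpa [hdig, hG] using hm
      · simpa using ha₂ v hv
      · simpa using ha₃ v hv)
    (by
      rintro j hj s' hj' ⟨hr', hA₀, hA₁, hA₄, hc, hcm, hl, hd⟩
      rw [hreg 0 (by omega) (by omega), h₀] at hj
      have hcode := code_add_one_le (W := W) (f := f) (r := r) hb (n - (j + 1)) j
      rw [show n - j = n - (j + 1) + 1 by omega] at hc
      have hbase : s'.reg 3 = b := by rw [hr' 3 (by omega), hreg 3 (by omega) (by omega), h₃]
      have hbound : s'.reg 7 = m := by rw [hr' 7 (by omega), hreg 7 (by omega) (by omega), h₇]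
      simp only [exec_ite, holds_read, eval_reg, hj', hA₁]
      by_cases hWj : W j ≠ 0
      · rw [if_pos hWj]
        obtain ⟨hd₁, hd₂⟩ := digitCommand_spec (s := s') (x := 21) (by omega) (by omega)
          (by omega)
        rw [code, if_neg hWj] at hc
        rw [hbase, hc, Nat.add_mul_mod_self_left, Nat.mod_eq_of_lt (hf j)] at hd₁
        rw [hbase, hc, Nat.add_mul_div_left _ _ hb, Nat.div_eq_of_lt (hf j), zero_add] at hd₂
        have hk : ∀ y < 12, ((digitCommand 21).exec s').reg y = s₁.reg y := fun y hy => by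
          rw [exec_reg _ _, hr' y hy]
          simp [digitCommand, block, keeps]
          omega
        have hk₂₀ : ((digitCommand 21).exec s').reg 20 = j := by rw [exec_reg _ rfl, hj']
        have harr : ((digitCommand 21).exec s').arr = s'.arr := rfl
        simp only [exec_block_cons, exec_block_nil]
        generalize (digitCommand 21).exec s' = s₂ at hd₁ hd₂ hk hk₂₀ harr
        simp only [exec_put, eval_reg, exec_ite, holds_reg, State.setArr_reg, hk₂₀, hd₁,
          exec_skip, eval_const]
        have hlt : code W f b r (n - (j + 1)) (j + 1) < m := by rw [hc] at hcm; nlinarith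
        refine ⟨fun y hy => ?_, ?_, ?_, ?_, ?_, ?_, fun v hv => ?_, fun v hv => ?_⟩
        · rw [State.setReg_reg, if_neg (by omega)]
          split_ifs <;> exact hk y hy
        · split_ifs <;> simp [harr, hA₀]
        · split_ifs <;> simp [harr, hA₁]
        · split_ifs <;> simp [harr, hA₄]
        · split_ifs <;> simpa using hd₂
        · split_ifs <;> simpa [hd₂]
        · have : v < j + 1 ↔ v = j ∨ v < j := by omega
          by_cases hfj : f j ≠ 0
          · rw [if_pos hfj]
            simp only [State.setReg_arr, State.setArr_arr, if_true, Function.update_apply, harr,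
              hl v hv, this]
            by_cases hvj : v = j <;> simp [hvj]
          · rw [if_neg hfj]
            simp only [State.setReg_arr, State.setArr_arr, if_true, Function.update_apply, harr,
              hl v hv, this, show (2 : ℕ) ≠ 3 by omega, if_false]
            by_cases hvj : v = j <;> simp [hvj]
        · have hvj : v < j + 1 ↔ v = j ∨ v < j := by omega
          by_cases hfj : f j ≠ 0
          · rw [if_pos hfj]
            simp only [State.setReg_arr, State.setArr_arr, show (3 : ℕ) ≠ 2 by omega, if_false,
              harr, hd v hv]
            refine if_congr (or_congr_right ?_) rfl rfl
            rw [hvj]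
            by_cases h : v = j
            · simp [h, hfj]
            · simp [h]
          · rw [if_neg hfj]
            simp only [State.setReg_arr, State.setArr_arr, if_true, Function.update_apply,
              show (3 : ℕ) ≠ 2 by omega, if_false, harr, hd v hv, hvj]
            by_cases h : v = j
            · rw [if_pos h, if_pos (Or.inr ⟨Or.inl h, h ▸ hWj, h ▸ not_not.mp hfj⟩)]
            · simp [h]
      · rw [if_neg hWj]
        rw [ne_eq, not_not] at hWj
        rw [code, if_pos hWj] at hc
        refine ⟨fun y hy => ?_, hA₀, hA₁, hA₄, ?_, ?_, fun v hv => ?_, fun v hv => ?_⟩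
        · rw [State.setReg_reg, if_neg (by omega)]
          exact hr' y hy
        · simpa using hc
        · simpa using hcm
        · have : v < j + 1 ↔ v = j ∨ v < j := by omega
          simp only [State.setReg_arr, exec_skip, hl v hv, this]
          by_cases h : v = j
          · simp [h, hfW j hWj]
          · simp [h]
        · have hvj : v < j + 1 ↔ v = j ∨ v < j := by omega
          rw [State.setReg_arr, exec_skip, hd v hv]
          refine if_congr (or_congr_right ?_) rfl rfl
          rw [hvj]
          by_cases h : v = j
          · simp [h, hWj]
          · simp [h])
  rw [hreg 0 (by omega) (by omega), h₀] at this
  simp only [initCommand, exec_block_cons, exec_block_nil]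
  rw [← hs₁]
  obtain ⟨hr', hA₀, -, hA₄, hc, -, hl, hd⟩ := this
  have hr'' : ∀ y < 10, ∀ (s' : State) (z : ℕ), s'.reg y = s₁.reg y → (s'.setReg 13 z).reg y = s.reg y :=
    fun y hy s' z hs' => by
      rw [State.setReg_reg, if_neg (by omega), hs', hreg y (by omega) (by omega)]
  refine ⟨?_, ?_, ?_, ?_, ?_, ?_, ?_, ?_, ?_, fun v hv => ?_, fun v hv => ?_, fun v hv => ?_⟩
  · exact (hr'' 0 (by omega) _ _ (hr' 0 (by omega))).trans h₀
  · exact (hr'' 1 (by omega) _ _ (hr' 1 (by omega))).trans h₁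
  · exact (hr'' 2 (by omega) _ _ (hr' 2 (by omega))).trans h₂
  · exact (hr'' 3 (by omega) _ _ (hr' 3 (by omega))).trans h₃
  · exact (hr'' 5 (by omega) _ _ (hr' 5 (by omega))).trans h₅
  · exact (hr'' 7 (by omega) _ _ (hr' 7 (by omega))).trans h₇
  · rw [exec_set, State.setReg_reg, if_neg (by omega), hc, Nat.sub_self, code]
  · rw [exec_set, State.setReg_reg, if_pos rfl, eval_add, eval_reg, eval_const,
      hr' 1 (by omega), hreg 1 (by omega) (by omega), h₁]
  · rw [exec_set, State.setReg_arr, hA₀, ha₀]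
    exact hadj
  · rw [exec_set, State.setReg_arr, hl v hv, if_pos hv]
  · rw [exec_set, State.setReg_arr, hd v hv]
    simp [hv]
  · rw [exec_set, State.setReg_arr, hA₄, ha₄ v hv]

end RAM

/-! ### Verification of guesses and iterative compression. -/

namespace RAM

open CycleDeletion Term Command Relation

/-- Compute which vertices reach each other in the graph without the deleted vertices. -/
def reachCommand : Command :=
  block [arcsCommand,
    fillMatrix 13 16 17 0 (.ite (.eq (.reg 16) (.reg 17)) (.const 1) (.const 0)),
    .loop 20 0 (block [
      fillMatrix 14 16 17 0 (.ite (.or (.read 13 (.entry 0 16 17))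
        (.ex 18 0 (.and (.read 9 (.entry 0 16 18)) (.read 13 (.entry 0 18 17)))))
        (.const 1) (.const 0)),
      fillMatrix 13 16 17 0 (.read 14 (.entry 0 16 17))])]

/-- The deleted vertices up to register `10`. -/
def isDeleted : Term := .and (.not (.lt (.reg 10) (.reg 16))) (.read 3 (.reg 16))

/-- Check whether the deleted vertices form a solution, and store the answer in register `39`. -/
def verifyCommand : Command :=
  block [reachCommand,
    .set 39 (.and (.lt (.ex 16 0 isDeleted) (.add (.reg 1) (.const 1)))
      (.not (.ex 16 0 (.ex 17 0 (.ex 18 0 (.and (.not (.eq (.reg 17) (.reg 18)))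
        (.and (.and (.read 9 (.entry 0 16 17)) (.read 9 (.entry 0 16 18)))
          (.and (.read 13 (.entry 0 17 16)) (.read 13 (.entry 0 18 16))))))))))]

/-- Try the levels and branches given by register `11`. -/
def guessCommand : Command :=
  block [initCommand, runCommand, verifyCommand,
    .ite (.reg 39)
      (block [.set 37 (.const 1), fill 8 16 0 (.ite isDeleted (.const 1) (.const 0))])
      .skip]

/-- Turn a solution for the vertices before register `10` into one that respects this vertex, too. -/
def roundCommand : Command :=
  block [.put 1 (.reg 10) (.const 1), .set 37 (.const 0), .loop 11 7 guessCommand,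
    .ite (.reg 37) (fill 1 16 0 (.read 8 (.reg 16))) (.set 38 (.const 1))]

/-- Iterative compression. -/
def mainCommand : Command := .loop 10 0 roundCommand

variable {n k : ℕ} {adj : ℕ → ℕ → Prop} {s : State}

theorem reachCommand_spec (h₀ : s.reg 0 = n)
    (hadj : ∀ u < n, ∀ v < n, s.arr 0 (n * u + v) ≠ 0 ↔ adj u v) :
    (∀ u < n, ∀ v < n, (reachCommand.exec s).arr 9 (n * u + v) ≠ 0 ↔ Arc n adj (s.arr 3) u v) ∧
    ∀ u < n, ∀ v < n, (reachCommand.exec s).arr 13 (n * u + v) ≠ 0 ↔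
      ReflTransGen (Arc n adj (s.arr 3)) u v := by
  simp only [reachCommand, exec_block_cons, exec_block_nil]
  set s₁ := (fillMatrix 13 16 17 0 (.ite (.eq (.reg 16) (.reg 17)) (.const 1) (.const 0))).exec
    (arcsCommand.exec s) with hs₁
  have hn₁ : s₁.reg 0 = n := by rw [hs₁, exec_reg _ rfl, exec_reg _ rfl, h₀]
  have harc₁ : ∀ u < n, ∀ v < n, s₁.arr 9 (n * u + v) ≠ 0 ↔ Arc n adj (s.arr 3) u v := by
    intro u hu v hv
    rw [hs₁, exec_arr _ rfl, arcsCommand_spec h₀ hadj (fun _ _ => rfl) hu hv]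
  have hfill : ∀ (a : ℕ) (e : Term) (s : State), s.reg 0 = n → e.avoids a → ∀ u < n, ∀ v < n,
      ((fillMatrix a 16 17 0 e).exec s).arr a (n * u + v) =
        e.eval ((s.setReg 16 u).setReg 17 v) := by
    rintro a e s rfl he u hu v hv
    exact exec_fillMatrix he (by omega) (by omega) (by omega) (by omega) hu hv
  have := exec_loop_induction (s := s₁) (x := 20) (b := 0) (c := block [
      fillMatrix 14 16 17 0 (.ite (.or (.read 13 (.entry 0 16 17))
        (.ex 18 0 (.and (.read 9 (.entry 0 16 18)) (.read 13 (.entry 0 18 17)))))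
        (.const 1) (.const 0)),
      fillMatrix 13 16 17 0 (.read 14 (.entry 0 16 17))])
    (fun i s' => s'.reg 0 = n ∧
      (∀ u < n, ∀ v < n, s'.arr 9 (n * u + v) ≠ 0 ↔ Arc n adj (s.arr 3) u v) ∧
      ∀ u < n, ∀ v < n, s'.arr 13 (n * u + v) ≠ 0 ↔ reach n (Arc n adj (s.arr 3)) i u v)
    ⟨by simpa, harc₁, fun u hu v hv => by
      rw [State.setReg_arr, hs₁, hfill _ _ _ (by rw [exec_reg _ rfl, h₀]) rfl u hu v hv, reach]
      simp⟩
    (by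
      rintro i - s' - ⟨hn, harc, hreach⟩
      simp only [exec_block_cons, exec_block_nil]
      set s₂ := (fillMatrix 14 16 17 0 (.ite (.or (.read 13 (.entry 0 16 17))
        (.ex 18 0 (.and (.read 9 (.entry 0 16 18)) (.read 13 (.entry 0 18 17)))))
        (.const 1) (.const 0))).exec s' with hs₂
      have hn₂ : s₂.reg 0 = n := by rw [hs₂, exec_reg _ rfl, hn]
      refine ⟨?_, fun u hu v hv => ?_, fun u hu v hv => ?_⟩
      · rw [State.setReg_reg, if_neg (by omega), exec_reg _ rfl, hn₂]
      · rw [State.setReg_arr, exec_arr _ rfl, hs₂, exec_arr _ rfl]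
        exact harc u hu v hv
      · rw [State.setReg_arr, hfill _ _ _ hn₂ rfl u hu v hv]
        have hread : (Term.read 14 (.entry 0 16 17)).eval ((s₂.setReg 16 u).setReg 17 v) =
            s₂.arr 14 (n * u + v) := by simp [hn₂]
        have hor : (Term.or (.read 13 (.entry 0 16 17))
            (.ex 18 0 (.and (.read 9 (.entry 0 16 18)) (.read 13 (.entry 0 18 17))))).Holds
              ((s'.setReg 16 u).setReg 17 v) ↔ reach n (Arc n adj (s.arr 3)) (i + 1) u v := by
          rw [reach, ← hreach u hu v hv, holds_or, holds_ex]
          refine or_congr ?_ ?_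
          · simp [hn]
          · have h0 : ((s'.setReg 16 u).setReg 17 v).reg 0 = n := by simp [hn]
            rw [h0]
            refine exists_congr fun w => and_congr_right fun hw => ?_
            rw [← hreach w hw v hv, ← harc u hu w hw]
            simp [hn]
        rw [hread, hs₂, hfill _ _ _ hn rfl u hu v hv, eval_ite, eval_const, eval_const, ← hor]
        split_ifs with h <;> simp [h])
  rw [hn₁] at this
  refine ⟨this.2.1, fun u hu v hv => ?_⟩
  rw [this.2.2 u hu v hv, reach_iff (fun u v h => ⟨h.1, h.2.1⟩) hv]

theorem isDeleted_spec {i : ℕ} (hi : s.reg 10 = i) :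
    isDeleted.Holds s ↔ s.reg 16 < i + 1 ∧ s.arr 3 (s.reg 16) ≠ 0 := by
  simp [isDeleted, hi]

/-- Nothing is assumed about where array `3` came from, so the check is valid after any guess. Only
vertices up to `i` are counted, since the later ones are deleted just because they are not yet
released. -/
theorem verifyCommand_spec {i : ℕ} (h₀ : s.reg 0 = n) (h₁ : s.reg 1 = k) (hi : s.reg 10 = i)
    (hin : i < n) (hadj : ∀ u < n, ∀ v < n, s.arr 0 (n * u + v) ≠ 0 ↔ adj u v) :
    (verifyCommand.exec s).reg 39 ≠ 0 ↔
      ((Finset.range (i + 1)).filter (s.arr 3 · ≠ 0)).card ≤ k ∧ Sol n adj (s.arr 3) := by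
  obtain ⟨harc, hreach⟩ := reachCommand_spec h₀ hadj
  simp only [verifyCommand, exec_block_cons, exec_block_nil]
  have e₀ : (reachCommand.exec s).reg 0 = n := by rw [exec_reg _ rfl, h₀]
  have e₁ : (reachCommand.exec s).reg 1 = k := by rw [exec_reg _ rfl, h₁]
  have e₁₀ : (reachCommand.exec s).reg 10 = i := by rw [exec_reg _ rfl, hi]
  have e₃ : (reachCommand.exec s).arr 3 = s.arr 3 := exec_arr _ rfl _
  generalize reachCommand.exec s = s₁ at harc hreach e₀ e₁ e₁₀ e₃
  rw [exec_set, State.setReg_reg, if_pos rfl]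
  change Holds _ _ ↔ _
  rw [holds_and, holds_lt, holds_not, eval_count _ _ _ (fun v => v < i + 1 ∧ s.arr 3 v ≠ 0)
    (fun v _ => by rw [isDeleted_spec (i := i) (by simpa)]; simp [e₃]), e₀]
  refine and_congr ?_ ?_
  · have : (Finset.range n).filter (fun v => v < i + 1 ∧ s.arr 3 v ≠ 0) =
        (Finset.range (i + 1)).filter (s.arr 3 · ≠ 0) := by
      ext v
      simp only [Finset.mem_filter, Finset.mem_range]
      constructor
      · exact fun h => h.2
      · exact fun h => ⟨by omega, h⟩
    rw [this]
    simp [e₁]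
  · have hiff : ∀ v < n, ∀ x < n, ∀ y < n, (Term.and (.not (.eq (.reg 17) (.reg 18)))
        (.and (.and (.read 9 (.entry 0 16 17)) (.read 9 (.entry 0 16 18)))
          (.and (.read 13 (.entry 0 17 16)) (.read 13 (.entry 0 18 16))))).Holds
        (((s₁.setReg 16 v).setReg 17 x).setReg 18 y) ↔
        x ≠ y ∧ (Arc n adj (s.arr 3) v x ∧ Arc n adj (s.arr 3) v y) ∧
          ReflTransGen (Arc n adj (s.arr 3)) x v ∧ ReflTransGen (Arc n adj (s.arr 3)) y v := by
      intro v hv x hx y hy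
      rw [← harc v hv x hx, ← harc v hv y hy, ← hreach x hx v hv, ← hreach y hy v hv]
      simp [e₀]
    rw [holds_ex, e₀]
    constructor
    · intro h v x y hxy hvx hvy p₁ p₂
      refine h ⟨v, hvx.1, (holds_ex _ _ _).mpr ⟨x, by simpa [e₀] using hvx.2.1,
        (holds_ex _ _ _).mpr ⟨y, by simpa [e₀] using hvy.2.1, ?_⟩⟩⟩
      exact (hiff v hvx.1 x hvx.2.1 y hvy.2.1).mpr ⟨hxy, ⟨hvx, hvy⟩, p₁, p₂⟩
    · rintro h ⟨v, hv, h'⟩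
      obtain ⟨x, hx, h'⟩ := (holds_ex _ _ _).mp h'
      obtain ⟨y, hy, h'⟩ := (holds_ex _ _ _).mp h'
      obtain ⟨hxy, ⟨hvx, hvy⟩, p₁, p₂⟩ := (hiff v hv x (by simpa [e₀] using hx) y
        (by simpa [e₀] using hy)).mp h'
      exact h v x y hxy hvx hvy p₁ p₂

/-- The parameters and the input during the main computation. -/
structure MainEnv (n k : ℕ) (adj : ℕ → ℕ → Prop) (s : State) : Prop where
  reg_zero : s.reg 0 = n
  reg_one : s.reg 1 = k
  reg_two : s.reg 2 = n + n
  reg_base : s.reg 3 = k + 4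
  reg_five : s.reg 5 = k + 2
  reg_steps : s.reg 6 = 3 * k + 1
  reg_bound : s.reg 7 = (k + 4) ^ (4 * k + 2)
  arr_adj : ∀ u < n, ∀ v < n, s.arr 0 (n * u + v) ≠ 0 ↔ adj u v

theorem MainEnv.of_eq {s' : State} (h : MainEnv n k adj s) (hr : ∀ y < 8, s'.reg y = s.reg y)
    (ha : s'.arr 0 = s.arr 0) : MainEnv n k adj s' where
  reg_zero := by rw [hr 0 (by omega), h.reg_zero]
  reg_one := by rw [hr 1 (by omega), h.reg_one]
  reg_two := by rw [hr 2 (by omega), h.reg_two]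
  reg_base := by rw [hr 3 (by omega), h.reg_base]
  reg_five := by rw [hr 5 (by omega), h.reg_five]
  reg_steps := by rw [hr 6 (by omega), h.reg_steps]
  reg_bound := by rw [hr 7 (by omega), h.reg_bound]
  arr_adj := by rw [ha]; exact h.arr_adj

theorem MainEnv.exec (h : MainEnv n k adj s) (c : Command) (hc : c.wf 8) (ha : c.keepsArr 0) :
    MainEnv n k adj (c.exec s) :=
  h.of_eq (fun _ hy => c.exec_reg (keeps_of_wf hy c hc) s) (c.exec_arr ha s)

theorem MainEnv.setReg (h : MainEnv n k adj s) {x : ℕ} (m : ℕ) (hx : 8 ≤ x) :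
    MainEnv n k adj (s.setReg x m) :=
  h.of_eq (fun y hy => by rw [State.setReg_reg, if_neg (by omega)]) rfl

/-- The set marked by `W` is a solution for the graph induced by the first `i` vertices. -/
def Compressed (n k : ℕ) (adj : ℕ → ℕ → Prop) (i : ℕ) (W : ℕ → ℕ) : Prop :=
  ((Finset.range n).filter (W · ≠ 0)).card ≤ k ∧ Sol n adj fun v => if v < i then W v else 1

/-- Only `verifyCommand` matters here: initialization and search may have produced anything. -/
theorem guessCommand_sound {i : ℕ} (h : MainEnv n k adj s) (hi : s.reg 10 = i) (hin : i < n)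
    (hs : s.reg 37 ≠ 0 → Compressed n k adj (i + 1) (s.arr 8)) :
    (guessCommand.exec s).reg 37 ≠ 0 →
      Compressed n k adj (i + 1) ((guessCommand.exec s).arr 8) := by
  simp only [guessCommand, exec_block_cons, exec_block_nil]
  have h₁ : MainEnv n k adj (runCommand.exec (initCommand.exec s)) :=
    (h.exec _ rfl rfl).exec _ rfl rfl
  have hi₁ : (runCommand.exec (initCommand.exec s)).reg 10 = i := by
    rw [exec_reg _ rfl, exec_reg _ rfl, hi]
  have hf₁ : (runCommand.exec (initCommand.exec s)).reg 37 = s.reg 37 := by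
    rw [exec_reg _ rfl, exec_reg _ rfl]
  have ha₁ : (runCommand.exec (initCommand.exec s)).arr 8 = s.arr 8 := by
    rw [exec_arr _ rfl, exec_arr _ rfl]
  generalize runCommand.exec (initCommand.exec s) = s₁ at h₁ hi₁ hf₁ ha₁
  have hv := verifyCommand_spec h₁.reg_zero h₁.reg_one hi₁ hin h₁.arr_adj
  have h₂ : MainEnv n k adj (verifyCommand.exec s₁) := h₁.exec _ rfl rfl
  have hi₂ : (verifyCommand.exec s₁).reg 10 = i := by rw [exec_reg _ rfl, hi₁]
  have hf₂ : (verifyCommand.exec s₁).reg 37 = s.reg 37 := by rw [exec_reg _ rfl, hf₁]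
  have ha₂ : (verifyCommand.exec s₁).arr 8 = s.arr 8 := by rw [exec_arr _ rfl, ha₁]
  have hd₂ : (verifyCommand.exec s₁).arr 3 = s₁.arr 3 := exec_arr _ rfl _
  generalize verifyCommand.exec s₁ = s₂ at hv h₂ hi₂ hf₂ ha₂ hd₂
  simp only [exec_ite, holds_reg]
  by_cases hok : s₂.reg 39 ≠ 0
  · obtain ⟨hcard, hsol⟩ := hv.mp hok
    rw [if_pos hok]
    intro _
    simp only [exec_block_cons, exec_block_nil]
    have harr : ∀ v < n, ((fill 8 16 0 (.ite isDeleted (.const 1) (.const 0))).exec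
        ((Command.set 37 (.const 1)).exec s₂)).arr 8 v ≠ 0 ↔ v < i + 1 ∧ s₁.arr 3 v ≠ 0 := by
      intro v hv
      have hreg : ((Command.set 37 (.const 1)).exec s₂).reg 0 = n := by simp [h₂.reg_zero]
      rw [exec_fill rfl]
      simp only [hreg, hv, if_true, eval_ite, eval_const]
      have := isDeleted_spec (s := ((Command.set 37 (.const 1)).exec s₂).setReg 16 v) (i := i)
        (by simpa)
      rw [← hd₂]
      simp only [this]
      simp
    refine ⟨(Finset.card_le_card fun v hv => ?_).trans hcard, hsol.mono fun v hv hdel => ?_⟩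
    · rw [Finset.mem_filter, Finset.mem_range] at hv ⊢
      exact (harr v hv.1).mp hv.2
    · split_ifs with hvi
      · exact (harr v hv).mpr ⟨hvi, hdel⟩
      · exact one_ne_zero
  · rw [if_neg hok, exec_skip, hf₂, ha₂]
    exact hs

theorem guessCommand_found (h : s.reg 37 ≠ 0) : (guessCommand.exec s).reg 37 ≠ 0 := by
  simp only [guessCommand, exec_block_cons, exec_block_nil]
  have hf : (verifyCommand.exec (runCommand.exec (initCommand.exec s))).reg 37 = s.reg 37 := by
    rw [exec_reg _ rfl, exec_reg _ rfl, exec_reg _ rfl]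
  generalize verifyCommand.exec (runCommand.exec (initCommand.exec s)) = s₁ at hf
  rw [exec_ite]
  split_ifs
  · rw [exec_block_cons, exec_block_cons, exec_block_nil, exec_reg _ rfl]
    simp
  · rwa [exec_skip, hf]

/-- The number `G` is the code of the levels from `exists_levels` followed by the branches from
`exists_run`. It does not depend on the state, so the loop over all guesses meets it whatever
earlier guesses left in memory. -/
theorem exists_guess {i : ℕ} {W Y : ℕ → ℕ} (hin : i < n)
    (hW : ((Finset.range n).filter (W · ≠ 0)).card ≤ k + 1)
    (hWs : Sol n adj fun v => if v < i + 1 then W v else 1)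
    (hY : Sol n adj Y) (hYk : ((Finset.range n).filter (Y · ≠ 0)).card ≤ k) :
    ∃ G < (k + 4) ^ (4 * k + 2), ∀ s : State, MainEnv n k adj s → s.reg 10 = i → s.reg 11 = G →
      s.arr 1 = W → (guessCommand.exec s).reg 37 ≠ 0 := by
  have hsub : ∀ Z : ℕ → ℕ, ((Finset.range (i + 1)).filter (Z · ≠ 0)).card ≤
      ((Finset.range n).filter (Z · ≠ 0)).card := fun Z =>
    Finset.card_le_card (Finset.filter_subset_filter _ (Finset.range_subset_range.mpr hin))
  obtain ⟨f, hf, hfW, hinv⟩ := exists_levels (Nat.succ_le_of_lt hin) ((hsub W).trans hW)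
    (hY.mono fun v _ hv => by
      show (if v < i + 1 then Y v else 1) ≠ 0
      split_ifs <;> simp [hv]) ((hsub Y).trans hYk)
  set σ : Config := ⟨fun v => if i < v ∨ (W v ≠ 0 ∧ f v = 0) then 1 else 0, fun _ => 0, k + 1⟩
    with hσ
  have hdel : ∀ v < n, σ.del v ≠ 0 ↔ i + 1 ≤ v ∨ (W v ≠ 0 ∧ f v = 0) := fun v _ => by
    by_cases h : i < v ∨ (W v ≠ 0 ∧ f v = 0)
    · simp [hσ, h]
    · simp [hσ, h]
  obtain ⟨kk, hkk⟩ := hinv f σ.del σ.A (fun _ _ => rfl) hdel (fun _ _ => rfl)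
  obtain ⟨r, hr, hfeas, kk', μ', hq, hI⟩ := hkk.exists_run (b := k + 4) (by omega)
  have hsol := hI.sol hq hdel hWs
  have hcard := hI.card
  have hsum : (∑ j ∈ Finset.range n, if W (0 + j) = 0 then 0 else 1) ≤ k + 1 := by
    refine le_trans (le_of_eq ?_) hW
    rw [Finset.card_filter]
    refine Finset.sum_congr rfl fun j _ => ?_
    by_cases h : W j = 0 <;> simp [h]
  -- At most `k + 1` digits for levels and `3 * k + 1` for branches make `4 * k + 2`. The base `k +
  -- 4` exceeds all levels and is at least 3.
  have hG : code W f (k + 4) r n 0 < (k + 4) ^ (4 * k + 2) := by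
    refine (code_lt (fun v => (hf v).trans_lt (by omega)) hr n 0).trans_le ?_
    rw [← pow_add]
    exact Nat.pow_le_pow_right (by omega) (by omega)
  refine ⟨_, hG, fun s h hi h₁₁ hs => ?_⟩
  have hE := initCommand_spec h.reg_zero h.reg_one h.reg_two h.reg_base h.reg_five h.reg_bound hi
    h.arr_adj hs (fun v => (hf v).trans_lt (by omega)) hfW h₁₁ hG
  have hrm : r < (k + 4) ^ (4 * k + 2) :=
    hr.trans_le (Nat.pow_le_pow_right (by omega) (by omega))
  have hR := runCommand_spec hE (by omega) hrm
    (by rw [exec_reg _ rfl, h.reg_steps]) hfeas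
  have hi₁ : (runCommand.exec (initCommand.exec s)).reg 10 = i := by
    rw [exec_reg _ rfl, exec_reg _ rfl, hi]
  simp only [guessCommand, exec_block_cons, exec_block_nil]
  generalize runCommand.exec (initCommand.exec s) = s₁ at hR hi₁
  have hv := (verifyCommand_spec hR.reg_zero hR.reg_one hi₁ hin hR.arr_adj).mpr ⟨?_, ?_⟩
  · simp only [exec_ite, holds_reg]
    rw [if_pos hv, exec_block_cons, exec_block_cons, exec_block_nil,
      exec_reg _ rfl]
    simp
  · refine le_trans (Finset.card_le_card fun v => ?_) (Nat.le_of_add_right_le hcard)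
    simp only [Finset.mem_filter, Finset.mem_range]
    rintro ⟨hv, hd⟩
    exact ⟨hv, by rwa [← hR.arr_del v (by omega)]⟩
  · exact hsol.mono fun v hv hd => by rwa [hR.arr_del v hv]

/-- The invariant of iterative compression. -/
structure Compression (n k : ℕ) (adj : ℕ → ℕ → Prop) (i : ℕ) (s : State) : Prop where
  env : MainEnv n k adj s
  sound : s.reg 38 = 0 → Compressed n k adj i (s.arr 1)
  complete : s.reg 38 ≠ 0 →
    ¬ ∃ Y, Sol n adj Y ∧ ((Finset.range n).filter (Y · ≠ 0)).card ≤ k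

/-- Adding vertex `i` to the previous solution gives a set of size at most `k + 1` to compress. A
solution for the whole graph solves each stage as well, so a failed round refutes the instance for
good. -/
theorem Compression.next {i : ℕ} (h : Compression n k adj i s) (hi : s.reg 10 = i) (hin : i < n) :
    Compression n k adj (i + 1) (roundCommand.exec s) := by
  have hE : MainEnv n k adj (roundCommand.exec s) := h.env.exec _ rfl rfl
  simp only [roundCommand, exec_block_cons, exec_block_nil] at hE ⊢
  set s₁ := (Command.set 37 (.const 0)).exec ((Command.put 1 (.reg 10) (.const 1)).exec s) with hs₁
  have h₁ : MainEnv n k adj s₁ := (h.env.exec (.put 1 (.reg 10) (.const 1)) rfl rfl).exec _ rfl rfl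
  have hW₁ : s₁.arr 1 = Function.update (s.arr 1) i 1 := by simp [hs₁, hi]
  have hi₁ : s₁.reg 10 = i := by simp [hs₁, hi]
  have hz₁ : s₁.reg 37 = 0 := by simp [hs₁]
  have hf₁ : s₁.reg 38 = s.reg 38 := by simp [hs₁]
  clear_value s₁
  -- The value `G₀` is either a guess known to succeed or beyond the range. The second choice yields
  -- soundness of the loop without assuming that a solution exists.
  have hloop : ∀ G₀, (∀ s' : State, MainEnv n k adj s' → s'.reg 10 = i → s'.reg 11 = G₀ →
      s'.arr 1 = s₁.arr 1 → (guessCommand.exec s').reg 37 ≠ 0) ∨ (k + 4) ^ (4 * k + 2) ≤ G₀ →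
      (G₀ < (k + 4) ^ (4 * k + 2) → ((Command.loop 11 7 guessCommand).exec s₁).reg 37 ≠ 0) ∧
      (((Command.loop 11 7 guessCommand).exec s₁).reg 37 ≠ 0 →
        Compressed n k adj (i + 1) (((Command.loop 11 7 guessCommand).exec s₁).arr 8)) := by
    intro G₀ hG₀
    have := exec_loop_induction (s := s₁) (x := 11) (b := 7) (c := guessCommand)
      (fun j s' => MainEnv n k adj s' ∧ s'.reg 10 = i ∧ s'.arr 1 = s₁.arr 1 ∧
        (G₀ < j → s'.reg 37 ≠ 0) ∧ (s'.reg 37 ≠ 0 → Compressed n k adj (i + 1) (s'.arr 8)))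
      ⟨h₁.setReg _ (by omega), by simpa, rfl, fun h => by omega, fun h => by simp [hz₁] at h⟩
      (by
        rintro j hj s' hj' ⟨he, hi', hW', hfound, hsound⟩
        rw [h₁.reg_bound] at hj
        refine ⟨(he.exec guessCommand rfl rfl).setReg _ (by omega), ?_, ?_, fun hlt => ?_, ?_⟩
        · rw [State.setReg_reg, if_neg (by omega), exec_reg _ rfl, hi']
        · rw [State.setReg_arr, exec_arr _ rfl, hW']
        · rw [State.setReg_reg, if_neg (by omega)]
          rcases Nat.lt_succ_iff_lt_or_eq.mp hlt with hlt | rfl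
          · exact guessCommand_found (hfound hlt)
          · exact hG₀.resolve_right (by omega) s' he hi' hj' hW'
        · rw [State.setReg_reg, if_neg (by omega), State.setReg_arr]
          exact guessCommand_sound he hi' hin hsound)
    rw [h₁.reg_bound] at this
    exact ⟨this.2.2.2.1, this.2.2.2.2⟩
  have hsound := (hloop _ (Or.inr le_rfl)).2
  have hcomplete : s.reg 38 = 0 → (∃ Y, Sol n adj Y ∧
      ((Finset.range n).filter (Y · ≠ 0)).card ≤ k) →
      ((Command.loop 11 7 guessCommand).exec s₁).reg 37 ≠ 0 := by
    rintro hz ⟨Y, hY, hYk⟩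
    obtain ⟨hc, hs⟩ := h.sound hz
    have hcard : ((Finset.range n).filter (s₁.arr 1 · ≠ 0)).card ≤ k + 1 := by
      rw [hW₁]
      calc _ ≤ (insert i ((Finset.range n).filter (s.arr 1 · ≠ 0))).card := by
            refine Finset.card_le_card fun v => ?_
            simp only [Finset.mem_filter, Finset.mem_insert, Function.update_apply]
            rintro ⟨hv, hne⟩
            by_cases hvi : v = i
            · exact Or.inl hvi
            · exact Or.inr ⟨hv, by simpa [hvi] using hne⟩
        _ ≤ _ := (Finset.card_insert_le _ _).trans (by omega)
    have hsol : Sol n adj fun v => if v < i + 1 then s₁.arr 1 v else 1 := by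
      refine hs.mono fun v _ hv => ?_
      rw [hW₁, Function.update_apply]
      split_ifs with h₂ h₃
      · exact one_ne_zero
      · rwa [if_pos (by omega)] at hv
      · exact one_ne_zero
    obtain ⟨G, hG, hGs⟩ := exists_guess (k := k) hin hcard hsol hY hYk
    exact (hloop G (Or.inl hGs)).1 hG
  have hn₂ : ((Command.loop 11 7 guessCommand).exec s₁).reg 0 = n := by
    rw [exec_reg _ rfl, h₁.reg_zero]
  have hf₂ : ((Command.loop 11 7 guessCommand).exec s₁).reg 38 = s.reg 38 := by
    rw [exec_reg _ rfl, hf₁]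
  generalize (Command.loop 11 7 guessCommand).exec s₁ = s₂ at *
  refine ⟨hE, fun hz => ?_, fun hnz hY => ?_⟩
  · simp only [exec_ite, holds_reg] at hz ⊢
    by_cases hfound : s₂.reg 37 ≠ 0
    · rw [if_pos hfound, exec_fill rfl, hn₂]
      obtain ⟨hc, hs⟩ := hsound hfound
      refine ⟨(Finset.card_le_card fun v => ?_).trans hc, hs.mono fun v hv hne => ?_⟩
      · simp only [Finset.mem_filter, Finset.mem_range]
        rintro ⟨hv, hne⟩
        exact ⟨hv, by simpa [hv] using hne⟩
      · by_cases hvi : v < i + 1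
        · rw [if_pos hvi] at hne ⊢
          simpa [hv] using hne
        · rw [if_neg hvi]
          exact one_ne_zero
    · rw [if_neg hfound] at hz
      simp at hz
  · simp only [exec_ite, holds_reg] at hnz
    by_cases hz : s.reg 38 = 0
    · rw [if_pos (hcomplete hz hY), exec_reg _ rfl, hf₂] at hnz
      exact hnz hz
    · exact h.complete hz hY

theorem mainCommand_spec (h : MainEnv n k adj s) (hf : s.reg 38 = 0) (hW : s.arr 1 = fun _ => 0) :
    (mainCommand.exec s).reg 38 = 0 ↔
      ∃ Y, Sol n adj Y ∧ ((Finset.range n).filter (Y · ≠ 0)).card ≤ k := by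
  have := exec_loop_induction (s := s) (x := 10) (b := 0) (c := roundCommand)
    (fun i s' => Compression n k adj i s')
    -- At stage 0 all vertices count as deleted, so the empty set is a solution.
    ⟨h.setReg _ (by omega), fun _ => ⟨by simp [hW], fun v x y _ hvx => by
      have := hvx.2.2.2.1
      simp at this⟩, fun hne => by simp [hf] at hne⟩
    (by
      intro i hi s' hi' hs'
      rw [h.reg_zero] at hi
      have := hs'.next hi' hi
      exact ⟨this.env.setReg _ (by omega), fun hz => this.sound (by simpa using hz),
        fun hz => this.complete (by simpa using hz)⟩)
  rw [h.reg_zero] at this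
  constructor
  · intro hz
    obtain ⟨hc, hs⟩ := this.sound hz
    exact ⟨_, hs.mono fun v hv hne => by rwa [if_pos hv] at hne, hc⟩
  · intro hY
    by_contra hne
    exact this.complete hne hY

end RAM

/-! ### The complete program and its running time. -/

namespace RAM

open CycleDeletion Term Command

/-- Compute the parameters that are linear in the input. -/
def linearCommand : Command :=
  block [.set 2 (.add (.reg 0) (.reg 0)), .set 3 (.add (.reg 1) (.const 4)),
    .set 4 (.add (.add (.add (.reg 1) (.reg 1)) (.add (.reg 1) (.reg 1))) (.const 2)),
    .set 5 (.add (.reg 1) (.const 2)),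
    .set 6 (.add (.add (.add (.reg 1) (.reg 1)) (.reg 1)) (.const 1))]

/-- Compute the number of guesses, which is a power of register `3`. -/
def powerCommand : Command :=
  block [.set 7 (.const 1), .loop 8 4 (.set 7 (.sum 9 3 (.reg 7)))]

/-- The algorithm. -/
def solver : Program :=
  .seq linearCommand.compile (.seq powerCommand.compile (.seq mainCommand.compile
    (.assign 0 (.sub (.const 1) (.reg 38)))))

theorem powerCommand_spec (s : State) : (powerCommand.exec s).reg 7 = s.reg 3 ^ s.reg 4 := by
  simp only [powerCommand, exec_block_cons, exec_block_nil]
  have := exec_loop_induction (s := (Command.set 7 (.const 1)).exec s) (x := 8) (b := 4)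
    (c := .set 7 (.sum 9 3 (.reg 7)))
    (fun i s' => s'.reg 3 = s.reg 3 ∧ s'.reg 7 = s.reg 3 ^ i) (by simp)
    (by
      rintro i - s' - ⟨h₁, h₂⟩
      simp [h₁, h₂, pow_succ'])
  simpa using this.2

variable {n k : ℕ}

theorem mainEnv_inputState (D : Digraph (Fin n)) (k : ℕ) :
    MainEnv n k (natAdj D) (powerCommand.exec (linearCommand.exec (inputState D k))) where
  reg_zero := by rw [exec_reg _ rfl, exec_reg _ rfl]; simp [inputState]
  reg_one := by rw [exec_reg _ rfl, exec_reg _ rfl]; simp [inputState]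
  reg_two := by rw [exec_reg _ rfl]; simp [linearCommand, inputState]
  reg_base := by rw [exec_reg _ rfl]; simp [linearCommand, inputState]
  reg_five := by rw [exec_reg _ rfl]; simp [linearCommand, inputState]
  reg_steps := by rw [exec_reg _ rfl]; simp [linearCommand, inputState]; omega
  reg_bound := by
    rw [powerCommand_spec]
    have h₃ : (linearCommand.exec (inputState D k)).reg 3 = k + 4 := by
      simp [linearCommand, inputState]
    have h₄ : (linearCommand.exec (inputState D k)).reg 4 = 4 * k + 2 := by
      simp [linearCommand, inputState]
      omega
    rw [h₃, h₄]
  arr_adj u hu v hv := by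
    rw [exec_arr _ rfl, exec_arr _ rfl]
    simp only [inputState, natAdj, true_and, ne_eq, ite_eq_right_iff, one_ne_zero, imp_false,
      not_not]
    refine exists_congr fun i => exists_congr fun j => and_congr_right fun _ => ?_
    rw [mul_comm (i : ℕ), matrix_index_inj hv j.isLt]
    exact ⟨fun h => ⟨h.1.symm, h.2.symm⟩, fun h => ⟨h.1.symm, h.2.symm⟩⟩

/-- The three phases have 2, 7 and 8 parameters, because a phase must not write to its own loop
bounds: the first computes registers 2 to 6, the second the number of guesses in register 7, and the
third uses all of them. A single quantity `M` dominates every parameter. -/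
theorem exists_runs_solver : ∃ C d : ℕ, 1 ≤ C ∧ ∀ (n k : ℕ) (D : Digraph (Fin n)),
    (∀ v, ¬ D.Adj v v) → ∃ (t : ℕ) (s : State), Runs solver (inputState D k) t s ∧
      t ≤ C * (2 * max n 1 * (k + 4) ^ (4 * k + 2)) ^ d ∧
      (D.OneOutRegularVertexDeletion k → s.reg 0 = 1) ∧
      (¬ D.OneOutRegularVertexDeletion k → s.reg 0 = 0) := by
  obtain ⟨C₁, d₁, h₁⟩ := exists_time_le (p := 2) linearCommand rfl
  obtain ⟨C₂, d₂, h₂⟩ := exists_time_le (p := 7) powerCommand rfl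
  obtain ⟨C₃, d₃, h₃⟩ := exists_time_le (p := 8) mainCommand rfl
  -- The 4 pays for the final assignment, which turns the failure flag into the answer.
  refine ⟨C₁ + C₂ + C₃ + 4, d₁ + d₂ + d₃, by omega, fun n k D hD => ?_⟩
  set s := inputState D k with hs
  set s₁ := linearCommand.exec s with hs₁
  set s₂ := powerCommand.exec s₁ with hs₂
  set M := 2 * max n 1 * (k + 4) ^ (4 * k + 2) with hM
  have hE : MainEnv n k (natAdj D) s₂ := mainEnv_inputState D k
  have hL : s₂.reg 4 = 4 * k + 2 := by
    rw [hs₂, exec_reg _ rfl, hs₁, hs]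
    simp [linearCommand, inputState]
    omega
  have hB : 4 * k + 2 < (k + 4) ^ (4 * k + 2) := Nat.lt_pow_self (by omega)
  have hN : 1 ≤ max n 1 := le_max_right _ _
  have hnN : n ≤ max n 1 := le_max_left _ _
  have hk4 : k + 4 ≤ (k + 4) ^ (4 * k + 2) := Nat.le_self_pow (by omega) _
  have hM₁ : 2 * max n 1 ≤ M := Nat.le_mul_of_pos_right _ (by omega)
  have hM₂ : (k + 4) ^ (4 * k + 2) ≤ M := Nat.le_mul_of_pos_left _ (by omega)
  have hMpos : 1 ≤ M := by omega
  have hρ : ∀ b < 8, s₂.reg b ≤ M := by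
    intro b hb
    interval_cases b
    · rw [hE.reg_zero]; omega
    · rw [hE.reg_one]; omega
    · rw [hE.reg_two]; omega
    · rw [hE.reg_base]; omega
    · rw [hL]; omega
    · rw [hE.reg_five]; omega
    · rw [hE.reg_steps]; omega
    · rw [hE.reg_bound]; omega
  have hρ₁ : ∀ b < 7, s₁.reg b ≤ M := fun b hb => by
    rw [← exec_reg powerCommand (keeps_of_wf hb powerCommand rfl) s₁]
    exact hρ b (by omega)
  have hρ₀ : ∀ b < 2, s.reg b ≤ M := fun b hb => by
    rw [← exec_reg linearCommand (keeps_of_wf hb linearCommand rfl) s]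
    exact hρ₁ b (by omega)
  obtain ⟨t₁, u₁, hr₁, ht₁, ha₁⟩ := linearCommand.exists_runs (ρ := s.reg) (p := 2) (by omega) rfl
    s s (State.Agree.refl s) (fun _ _ => rfl)
  obtain ⟨t₂, u₂, hr₂, ht₂, ha₂⟩ := powerCommand.exists_runs (ρ := s₁.reg) (p := 7) (by omega) rfl
    s₁ u₁ ha₁ (fun _ _ => rfl)
  obtain ⟨t₃, u₃, hr₃, ht₃, ha₃⟩ := mainCommand.exists_runs (ρ := s₂.reg) (p := 8) (by omega) rfl
    s₂ u₂ ha₂ (fun _ _ => rfl)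
  have hpow : ∀ d, d ≤ d₁ + d₂ + d₃ → M ^ d ≤ M ^ (d₁ + d₂ + d₃) := fun d hd =>
    Nat.pow_le_pow_right hMpos hd
  have hspec := mainCommand_spec hE
    (by rw [hs₂, exec_reg _ rfl, hs₁, exec_reg _ rfl]; simp [hs, inputState])
    (by rw [hs₂, exec_arr _ rfl, hs₁, exec_arr _ rfl]; simp [hs, inputState])
  rw [← oneOutRegularVertexDeletion_iff hD] at hspec
  refine ⟨_, _, hr₁.seq (hr₂.seq (hr₃.seq (Runs.assign _ _ _))), ?_, fun h => ?_, fun h => ?_⟩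
  · have e₁ := (ht₁.trans (h₁ _ M hMpos hρ₀)).trans (Nat.mul_le_mul_left C₁ (hpow d₁ (by omega)))
    have e₂ := (ht₂.trans (h₂ _ M hMpos hρ₁)).trans (Nat.mul_le_mul_left C₂ (hpow d₂ (by omega)))
    have e₃ := (ht₃.trans (h₃ _ M hMpos hρ)).trans (Nat.mul_le_mul_left C₃ (hpow d₃ (by omega)))
    have e₄ : 1 ≤ M ^ (d₁ + d₂ + d₃) := Nat.one_le_pow _ _ hMpos
    simp only [Expr.cost, add_mul]
    omega
  · rw [State.setReg_reg, if_pos rfl]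
    simp [Expr.eval, ha₃.1 38 (by omega), hspec.mpr h]
  · have := mt hspec.mp h
    rw [State.setReg_reg, if_pos rfl]
    simp only [Expr.eval, ha₃.1 38 (by omega)]
    omega

/-- For `k ≥ 4` one has `k + 4 ≤ k ^ 2` and `4 * k + 2 ≤ 6 * k`, whence the constant 12 in front of
`k * log k`. Moreover `k * log k ≥ 1`, which absorbs the logarithms of the constants. -/
theorem isBigO_logb {C d : ℕ} (hC : 1 ≤ C) :
    (fun k : ℕ => Real.logb 2 (C * (2 * ((k : ℝ) + 4) ^ (4 * k + 2)) ^ d)) =O[atTop]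
      fun k : ℕ => (k : ℝ) * Real.log k := by
  have hlog2 : 0 < Real.log 2 := Real.log_pos (by norm_num)
  have hlogC : 0 ≤ Real.log C := Real.log_nonneg (by exact_mod_cast hC)
  refine IsBigO.of_bound ((Real.log C + d * (Real.log 2 + 12)) / Real.log 2) ?_
  filter_upwards [eventually_ge_atTop 4] with k hk
  have hk' : (4 : ℝ) ≤ k := by exact_mod_cast hk
  have hlogk : 1 ≤ Real.log k := by
    rw [Real.le_log_iff_exp_le (by linarith)]
    linarith [Real.exp_one_lt_d9]
  have hX : 1 ≤ (k : ℝ) * Real.log k := by nlinarith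
  have hlog4 : Real.log ((k : ℝ) + 4) ≤ 2 * Real.log k := by
    have := Real.log_le_log (x := (k : ℝ) + 4) (y := (k : ℝ) ^ 2) (by positivity) (by nlinarith)
    rwa [Real.log_pow, Nat.cast_ofNat] at this
  have hlog4' : 0 ≤ Real.log ((k : ℝ) + 4) := Real.log_nonneg (by linarith)
  have hval : Real.log (C * (2 * ((k : ℝ) + 4) ^ (4 * k + 2)) ^ d) =
      Real.log C + d * (Real.log 2 + (4 * k + 2) * Real.log ((k : ℝ) + 4)) := by
    have hC' : (C : ℝ) ≠ 0 := by positivity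
    rw [Real.log_mul hC' (by positivity), Real.log_pow, Real.log_mul (by norm_num) (by positivity),
      Real.log_pow]
    push_cast
    ring
  have hle : (4 * k + 2) * Real.log ((k : ℝ) + 4) ≤ 12 * (k * Real.log k) := by
    calc (4 * (k : ℝ) + 2) * Real.log ((k : ℝ) + 4) ≤ (6 * k) * (2 * Real.log k) :=
          mul_le_mul (by linarith) hlog4 hlog4' (by positivity)
      _ = _ := by ring
  rw [Real.logb, hval, Real.norm_of_nonneg (by positivity), Real.norm_of_nonneg (by positivity),
    div_mul_eq_mul_div]
  refine div_le_div_of_nonneg_right ?_ hlog2.le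
  have e₁ : Real.log C ≤ Real.log C * (k * Real.log k) := le_mul_of_one_le_right hlogC hX
  have e₂ : Real.log 2 + (4 * k + 2) * Real.log ((k : ℝ) + 4) ≤
      (Real.log 2 + 12) * (k * Real.log k) := by
    have := le_mul_of_one_le_right hlog2.le hX
    linarith
  have e₃ := mul_le_mul_of_nonneg_left e₂ (Nat.cast_nonneg (α := ℝ) d)
  linarith

end RAM

theorem theorem4 :
    ∃ (P : RAM.Program) (f : ℕ → ℝ) (c : ℕ),
      f =O[atTop] (fun k : ℕ => (k : ℝ) * Real.log (k : ℝ)) ∧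
      ∀ (n k : ℕ) (D : Digraph (Fin n)), (∀ v, ¬ D.Adj v v) →
        ∃ (t : ℕ) (s : RAM.State),
          RAM.Runs P (RAM.inputState D k) t s ∧
          (t : ℝ) ≤ (2 : ℝ) ^ f k * ((max n 1 : ℕ) : ℝ) ^ c ∧
          (D.OneOutRegularVertexDeletion k → s.reg 0 = 1) ∧
          (¬ D.OneOutRegularVertexDeletion k → s.reg 0 = 0) := by
  obtain ⟨C, d, hC, h⟩ := RAM.exists_runs_solver
  -- `f` is the binary logarithm of the time bound without its factor `max n 1 ^ d`, so that `2 ^ f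
  -- k` recovers this part exactly.
  refine ⟨RAM.solver, _, d, RAM.isBigO_logb (d := d) hC, fun n k D hD => ?_⟩
  obtain ⟨t, s, hr, ht, hyes, hno⟩ := h n k D hD
  refine ⟨t, s, hr, ?_, hyes, hno⟩
  have hC' : (0 : ℝ) < C := by exact_mod_cast hC
  rw [Real.rpow_logb (by norm_num) (by norm_num) (by positivity), mul_assoc, ← mul_pow]
  calc (t : ℝ) ≤ ((C * (2 * max n 1 * (k + 4) ^ (4 * k + 2)) ^ d : ℕ) : ℝ) := by exact_mod_cast ht
    _ = _ := by push_cast; ring
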